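/- Let $(M,g)$ be a closed connected smooth Riemannian manifold, let $p:\tilde M\to M$ be its universal cover with the lifted metric, and let $d$ be the Riemannian distance on $\tilde M$. Let $S^1=\mathbb R/\mathbb Z$ and let $L:TM\times S^1\to\mathbb R$ be a $C^2$ function such that (i) $\partial^2L/\partial v^2$ is positive definite everywhere; (ii) the Euler–Lagrange flow of $L$ is complete: every initial condition $(x,v)\in TM$ at time $t_0$ is the initial condition of a solution $\mathbb R\to M$ of $\frac{d}{dt}\frac{\partial L}{\partial v}-\frac{\partial L}{\partial x}=0$ defined for all time; (iii) there is $C>0$ with $L(x,v,t)\ge C\|v\|^2$ for all $(x,v,t)$. The lift of $L$ to $T\tilde M\times S^1$ is also denoted $L$. An absolutely continuous curve $\gamma:[a,b]\to\tilde M$ is a *minimizing segment* if it minimizes the action $\int_a^bL(\gamma,\dot\gamma,t)\,dt$ among all absolutely continuous curves $[a,b]\to\tilde M$ with the same endpoints. For $c<d$ in $[a,b]$ its *average displacement* over $[c,d]$ is $\rho(\gamma;c,d)=d(\gamma(c),\gamma(d))/(d-c)$. For $\lambda>1$ and $\epsilon>0$, $\gamma$ is a *$(\lambda,\epsilon)$-quasi-geodesic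 segment* if $\lambda^{-1}(t-s)-\epsilon\le d(\gamma(s),\gamma(t))\le\lambda(t-s)+\epsilon$ for all $a\le s\le t\le b$. For $K\in\mathbb R$ let $\mathcal M_K$ be the set of all minimizing segments $\gamma:[a,b]\to\tilde M$ (over all real $a<b$) with $b-a$ a positive integer and $\rho(\gamma;a,b)=K$. **Proposition 2.1.** (a) For every $K$ there is $K''>K$, depending only on $L$ and $K$, such that every $\gamma:[a,b]\to\tilde M$ in $\mathcal M_K$ is differentiable at every $t\in[a,b]$ (one-sidedly at the endpoints) with $\|\dot\gamma(t)\|\le K''$. There is $K_0>0$, depending only on $L$, such that for every $K>K_0$ both of the following hold. (b) There are $k''>0$ and a positive integer $N_0$, depending only on $K$ and $L$, such that for every $\gamma:[a,b]\to\tilde M$ in $\mathcal M_K$ and every $[c,d]\subset[a,b]$ with $d-c\ge N_0$ one has $\rho(\gamma;c,d)\ge k''$. (c) There are $\lambda>1$ and $\epsilon>0$, depending only on $K$ and $L$, such that every $\gamma$ in $\mathcal M_K$ is a $(\lambda,\epsilon)$-quasi-geodesic segment. -/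

import Mathlib

open scoped Manifold ContDiff Bundle

namespace Lagrangian

noncomputable section

/-- The velocity at time `t` of a curve on the whole line. -/
def velocity {n : ℕ} {M : Type*} [TopologicalSpace M]
    [ChartedSpace (EuclideanSpace ℝ (Fin n)) M] (γ : ℝ → M) (t : ℝ) :
    TangentSpace (𝓡 n) (γ t) :=
  mfderiv 𝓘(ℝ, ℝ) (𝓡 n) γ t (1 : ℝ)

/-- The velocity at time `t ∈ [a, b]` of a curve segment `γ : [a, b] → M` (one-sided at the
endpoints). A curve segment is given by a map on `ℝ` of which only the restriction to `[a, b]`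
matters. -/
def segVelocity {n : ℕ} {M : Type*} [TopologicalSpace M]
    [ChartedSpace (EuclideanSpace ℝ (Fin n)) M] (γ : ℝ → M) (a b t : ℝ) :
    TangentSpace (𝓡 n) (γ t) :=
  mfderivWithin 𝓘(ℝ, ℝ) (𝓡 n) γ (Set.Icc a b) t (1 : ℝ)

/-- The Lagrangian `L(x, v, t)` read in the chart of `M` at `x₀`, as a function of the position
`q`, the velocity `u` and the time `t`, with `q`, `u` in the model space `ℝⁿ`. -/
def inChart {n : ℕ} {M : Type*} [TopologicalSpace M]
    [ChartedSpace (EuclideanSpace ℝ (Fin n)) M]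
    (L : TangentBundle (𝓡 n) M → ℝ → ℝ) (x₀ : M) (q u : EuclideanSpace ℝ (Fin n)) (t : ℝ) : ℝ :=
  L ⟨(chartAt (EuclideanSpace ℝ (Fin n)) x₀).symm q,
    mfderiv (𝓡 n) (𝓡 n) (chartAt (EuclideanSpace ℝ (Fin n)) x₀).symm q u⟩ t

/-- A `C²` curve `γ : ℝ → M` solves the Euler-Lagrange equations
`d/dt (∂L/∂v)(γ, γ', t) = (∂L/∂x)(γ, γ', t)`: in every chart of the atlas family `chartAt`, at
every time at which the curve is in the domain of the chart, with `q` the curve in the chart. -/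
def IsEulerLagrangeSolution {n : ℕ} {M : Type*} [TopologicalSpace M]
    [ChartedSpace (EuclideanSpace ℝ (Fin n)) M]
    (L : TangentBundle (𝓡 n) M → ℝ → ℝ) (γ : ℝ → M) : Prop :=
  ContMDiff 𝓘(ℝ, ℝ) (𝓡 n) 2 γ ∧
  ∀ (x₀ : M) (t : ℝ), γ t ∈ (chartAt (EuclideanSpace ℝ (Fin n)) x₀).source →
    let q : ℝ → EuclideanSpace ℝ (Fin n) :=
      fun s => chartAt (EuclideanSpace ℝ (Fin n)) x₀ (γ s)
    HasDerivAt
      (fun s => fderiv ℝ (fun u => inChart L x₀ (q s) u s) (deriv q s))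
      (fderiv ℝ (fun y => inChart L x₀ y (deriv q t) t) (q t)) t

/-- The standing hypotheses on a time-periodic Lagrangian. A function on `TM × S¹`, where
`S¹ = ℝ / ℤ`, is given as a function on `TM × ℝ` with period `1` in time. -/
structure StandingHypotheses {n : ℕ} {M : Type*} [TopologicalSpace M]
    [ChartedSpace (EuclideanSpace ℝ (Fin n)) M] [IsManifold (𝓡 n) ∞ M]
    [Bundle.RiemannianBundle (fun x : M => TangentSpace (𝓡 n) x)]
    (L : TangentBundle (𝓡 n) M → ℝ → ℝ) : Prop where
  periodic : ∀ z t, L z (t + 1) = L z t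
  contMDiff : ContMDiff ((𝓡 n).tangent.prod 𝓘(ℝ, ℝ)) 𝓘(ℝ, ℝ) 2
    (fun z : TangentBundle (𝓡 n) M × ℝ => L z.1 z.2)
  /-- Convexity: the Hessian of `L` in the fibre direction is positive definite. -/
  convex : ∀ (x : M) (v w : TangentSpace (𝓡 n) x) (t : ℝ), w ≠ 0 →
    0 < iteratedDeriv 2 (fun s : ℝ => L ⟨x, v + s • w⟩ t) 0
  /-- Completeness: the Euler-Lagrange flow exists, that is, every initial condition is the
  initial condition of a solution that is defined for all time. -/
  complete : ∀ (t₀ : ℝ) (z : TangentBundle (𝓡 n) M),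
    ∃ γ : ℝ → M, IsEulerLagrangeSolution L γ ∧
      (⟨γ t₀, velocity γ t₀⟩ : TangentBundle (𝓡 n) M) = z
  /-- Superquadratic growth. -/
  superquadratic : ∃ C : ℝ, 0 < C ∧
    ∀ (x : M) (v : TangentSpace (𝓡 n) x) (t : ℝ), C * ‖v‖ ^ 2 ≤ L ⟨x, v⟩ t

/-- `p : X → M` is the universal covering of the Riemannian manifold `M`, and `X` carries the
lifted differentiable structure and the lifted Riemannian metric. -/
structure IsRiemannianUniversalCover {n : ℕ} {M X : Type*}
    [TopologicalSpace M] [ChartedSpace (EuclideanSpace ℝ (Fin n)) M]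
    [Bundle.RiemannianBundle (fun x : M => TangentSpace (𝓡 n) x)]
    [TopologicalSpace X] [ChartedSpace (EuclideanSpace ℝ (Fin n)) X]
    [Bundle.RiemannianBundle (fun x : X => TangentSpace (𝓡 n) x)]
    (p : X → M) : Prop where
  simplyConnected : SimplyConnectedSpace X
  isCoveringMap : IsCoveringMap p
  isLocalDiffeomorph : IsLocalDiffeomorph (𝓡 n) (𝓡 n) ∞ p
  norm_mfderiv : ∀ (x : X) (v : TangentSpace (𝓡 n) x), ‖mfderiv (𝓡 n) (𝓡 n) p x v‖ = ‖v‖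

/-- The lift to `TX × S¹` of a Lagrangian on `TM × S¹`. -/
def lift {n : ℕ} {M X : Type*}
    [TopologicalSpace M] [ChartedSpace (EuclideanSpace ℝ (Fin n)) M]
    [TopologicalSpace X] [ChartedSpace (EuclideanSpace ℝ (Fin n)) X]
    (L : TangentBundle (𝓡 n) M → ℝ → ℝ) (p : X → M) :
    TangentBundle (𝓡 n) X → ℝ → ℝ :=
  fun z t => L (tangentMap (𝓡 n) (𝓡 n) p z) t

/-- The action `∫_a^b L(γ, γ', t) dt` of a curve segment, as an element of `[0, ∞]`. The
Lagrangians considered are nonnegative, so that the integral always makes sense, and it is `∞`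
exactly if the integrand is not integrable. -/
def action {n : ℕ} {X : Type*} [TopologicalSpace X]
    [ChartedSpace (EuclideanSpace ℝ (Fin n)) X]
    (L : TangentBundle (𝓡 n) X → ℝ → ℝ) (γ : ℝ → X) (a b : ℝ) : ENNReal :=
  ∫⁻ t in Set.Icc a b, ENNReal.ofReal (L ⟨γ t, segVelocity γ a b t⟩ t)

/-- `γ : [a, b] → X` is a minimizing segment of the Lagrangian `L` on `X`: it is absolutely
continuous and minimizes the action among all absolutely continuous curves `[a, b] → X` with the
same endpoints. -/
def IsMinimizingSegment {n : ℕ} {X : Type*} [MetricSpace X]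
    [ChartedSpace (EuclideanSpace ℝ (Fin n)) X]
    (L : TangentBundle (𝓡 n) X → ℝ → ℝ) (γ : ℝ → X) (a b : ℝ) : Prop :=
  AbsolutelyContinuousOnInterval γ a b ∧
  ∀ β : ℝ → X, AbsolutelyContinuousOnInterval β a b → β a = γ a → β b = γ b →
    action L γ a b ≤ action L β a b

/-- The average displacement `ρ(γ; a, b)` over the interval `[a, b]`, `a < b`. -/
def avgDisplacement {X : Type*} [MetricSpace X] (γ : ℝ → X) (a b : ℝ) : ℝ :=
  dist (γ a) (γ b) / (b - a)

/-- `γ : [a, b] → X` is a `(lam, ε)`-quasi-geodesic segment. -/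
def IsQuasiGeodesicSegment {X : Type*} [MetricSpace X] (lam ε : ℝ) (γ : ℝ → X) (a b : ℝ) :
    Prop :=
  ∀ c d : ℝ, a ≤ c → c ≤ d → d ≤ b →
    lam⁻¹ * (d - c) - ε ≤ dist (γ c) (γ d) ∧ dist (γ c) (γ d) ≤ lam * (d - c) + ε

/-- `γ : [a, b] → X` is a minimizing segment of positive integer time length and of average
displacement `K`. -/
def IsIntegerMinimizer {n : ℕ} {X : Type*} [MetricSpace X]
    [ChartedSpace (EuclideanSpace ℝ (Fin n)) X]
    (L : TangentBundle (𝓡 n) X → ℝ → ℝ) (K : ℝ) (γ : ℝ → X) (a b : ℝ) : Prop :=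
  a < b ∧ (∃ m : ℕ, b - a = m) ∧ IsMinimizingSegment L γ a b ∧ avgDisplacement γ a b = K

end

end Lagrangian

/-! Two bounds drive everything. Joining two points by an almost shortest curve of almost constant
speed shows that a minimizer of average displacement at most `V` has action at most `A V` times its
duration, where `A V` bounds `L` on speeds up to `V + 1`; it exists because `M` is compact and `L`
is periodic. Conversely, superquadratic growth and Cauchy–Schwarz give `C * dist² ≤ duration *
action`.

Parts (b) and (c) come from an exchange argument on the points `γ (a + i)`. Suppose one unit step
has length `r`, and elsewhere there is a long stretch of bounded average action. With `m = ⌈r⌉`, the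
stretch contains a block of `2m` steps of action `O(m)`. Traverse that block in time `m` and give
the saved time to the step, which then takes time `m + 1`; the pieces in between are only shifted by
integers, which periodicity allows. The two new pieces cost `O(m)`, while the original step costs at
least `C r²`, so minimality bounds `r` (`IsMinimizingChain.sq_dist_le_of_slow`). Taking the whole
curve as the stretch bounds all steps by some `R` depending on `K`; hence the action is at most
affine in time on every subinterval, which is the upper quasi-geodesic bound. Taking as the stretch
an interval `[c, d]` of average displacement below `1`, long compared with `R`, bounds all steps by
a constant `K₀` that does not depend on `K`. Average displacement `K > K₀` forces some step of
length at least `K`, so such an interval cannot exist: (b) holds with `k'' = 1`, and the lower bound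
in (c) follows.

Part (a) combines regularity of minimizers with compactness. In a chart, comparison with the affine
curve and uniform convexity give the excess estimate `∫ ‖q' - slope‖ ≤ c (t - s)²`
(`IsTonelliOn.excess_le`). It makes the slopes of a minimizer Cauchy on short intervals around a
time of bounded velocity, so the minimizer is `C¹` there, satisfies the Euler–Lagrange equation, and
stays close to an Euler–Lagrange solution that is close to it at one time
(`IsTonelliOn.exists_propagation`).

If no bound `K''` existed, there would be minimizers with bad times `τ'`, at which the velocity
fails to exist or tends to infinity. The affine action bound supplies a time `τ` of bounded speed
within distance `1` of `τ'`, and an integer shift puts `τ` in `[0, 1]`. Along an ultrafilter the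
projected velocities at `τ` converge in `TM`; completeness of the flow gives a global solution `η`
with the limiting initial condition, and propagation along `η` makes the velocities at `τ'` exist
and converge to a velocity of `η`, a contradiction. -/

open Set Filter Topology MeasureTheory AbsolutelyContinuousOnInterval
open scoped NNReal ENNReal



/-! ### Absolutely continuous curves in metric spaces -/

namespace AbsolutelyContinuousOnInterval

variable {X Y : Type*} [PseudoMetricSpace X] [PseudoMetricSpace Y]

theorem of_dist_le {f : ℝ → X} {g : ℝ → Y} {a b : ℝ} {K : ℝ}
    (hf : AbsolutelyContinuousOnInterval f a b)
    (h : ∀ x ∈ uIcc a b, ∀ y ∈ uIcc a b, dist (g x) (g y) ≤ K * dist (f x) (f y)) :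
    AbsolutelyContinuousOnInterval g a b := by
  have hf' : Tendsto (fun E : ℕ × (ℕ → ℝ × ℝ) ↦
      K * ∑ i ∈ Finset.range E.1, dist (f (E.2 i).1) (f (E.2 i).2))
      (totalLengthFilter ⊓ 𝓟 (disjWithin a b)) (𝓝 0) := by
    simpa using Tendsto.const_mul K hf
  refine squeeze_zero' (Eventually.of_forall fun t ↦ Finset.sum_nonneg fun i _ ↦ dist_nonneg)
    ?_ hf'
  filter_upwards [mem_inf_of_right (mem_principal_self _)] with E hE
  rw [Finset.mul_sum]
  exact Finset.sum_le_sum fun i hi ↦ h _ (hE.1 i hi).1 _ (hE.1 i hi).2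

theorem lipschitz_comp {f : ℝ → X} {φ : X → Y} {a b : ℝ} {K : ℝ≥0}
    (hf : AbsolutelyContinuousOnInterval f a b) (hφ : LipschitzOnWith K φ (f '' uIcc a b)) :
    AbsolutelyContinuousOnInterval (φ ∘ f) a b :=
  hf.of_dist_le fun x hx y hy ↦
    hφ.dist_le_mul _ (mem_image_of_mem f hx) _ (mem_image_of_mem f hy)

theorem congr {f g : ℝ → X} {a b : ℝ} (hf : AbsolutelyContinuousOnInterval f a b)
    (h : EqOn g f (uIcc a b)) : AbsolutelyContinuousOnInterval g a b :=
  hf.of_dist_le (K := 1) fun _ hx _ hy ↦ by rw [h hx, h hy, one_mul]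

/-- Clamping to `[c, d]` is monotone and `1`-Lipschitz, so it sends disjoint intervals to disjoint
intervals without increasing their total length. It extends a curve beyond its interval, as needed
for concatenation. -/
theorem comp_clamp {f : ℝ → X} {c d : ℝ} (hcd : c ≤ d)
    (hf : AbsolutelyContinuousOnInterval f c d) (a b : ℝ) :
    AbsolutelyContinuousOnInterval (fun t ↦ f (max c (min t d))) a b := by
  rw [absolutelyContinuousOnInterval_iff] at hf ⊢
  intro ε hε
  obtain ⟨δ, hδ, h⟩ := hf ε hε
  refine ⟨δ, hδ, fun E hE hlen ↦ ?_⟩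
  refine h ⟨E.1, fun i ↦ (max c (min (E.2 i).1 d), max c (min (E.2 i).2 d))⟩ ⟨?_, ?_⟩ ?_
  · intro i _
    simp only [uIcc_of_le hcd, mem_Icc]
    refine ⟨⟨le_max_left _ _, max_le hcd (min_le_right _ _)⟩,
      ⟨le_max_left _ _, max_le hcd (min_le_right _ _)⟩⟩
  · refine hE.2.mono fun i ↦ ?_
    intro z hz
    simp only [uIoc, mem_Ioc] at hz ⊢
    grind
  · refine lt_of_le_of_lt (Finset.sum_le_sum fun i _ ↦ ?_) hlen
    simp only [Real.dist_eq]
    have h1 := abs_max_sub_max_le_abs (min (E.2 i).1 d) (min (E.2 i).2 d) c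
    have h2 := abs_min_sub_min_le_max (E.2 i).1 d (E.2 i).2 d
    rw [max_comm c, max_comm c]
    refine h1.trans (h2.trans ?_)
    simp

/-- An increment of `f` is at most the sum of the increments of the two clamped curves; if it
straddles `b`, this is the triangle inequality through `f b`. -/
theorem trans {f : ℝ → X} {a b c : ℝ} (hab : a ≤ b) (hbc : b ≤ c)
    (h₁ : AbsolutelyContinuousOnInterval f a b) (h₂ : AbsolutelyContinuousOnInterval f b c) :
    AbsolutelyContinuousOnInterval f a c := by
  have k₁ := h₁.comp_clamp hab a c
  have k₂ := h₂.comp_clamp hbc a c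
  have hs : Tendsto (fun E : ℕ × (ℕ → ℝ × ℝ) ↦
      ∑ i ∈ Finset.range E.1, dist (f (max a (min (E.2 i).1 b))) (f (max a (min (E.2 i).2 b)))
      + ∑ i ∈ Finset.range E.1, dist (f (max b (min (E.2 i).1 c))) (f (max b (min (E.2 i).2 c))))
      (totalLengthFilter ⊓ 𝓟 (disjWithin a c)) (𝓝 0) := by
    simpa using Tendsto.add k₁ k₂
  refine squeeze_zero' (Eventually.of_forall fun t ↦ Finset.sum_nonneg fun i _ ↦ dist_nonneg)
    ?_ hs
  filter_upwards [mem_inf_of_right (mem_principal_self _)] with E hE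
  rw [← Finset.sum_add_distrib]
  refine Finset.sum_le_sum fun i hi ↦ ?_
  obtain ⟨hx, hy⟩ := hE.1 i hi
  rw [uIcc_of_le (hab.trans hbc)] at hx hy
  have key : ∀ x ∈ Icc a c, (x ≤ b ∧ max a (min x b) = x ∧ max b (min x c) = b) ∨
      (b ≤ x ∧ max a (min x b) = b ∧ max b (min x c) = x) := by
    intro x hx
    rcases le_total x b with h | h
    · left; grind
    · right; grind
  rcases key _ hx with ⟨_, h1, h2⟩ | ⟨_, h1, h2⟩ <;> rcases key _ hy with ⟨_, h3, h4⟩ | ⟨_, h3, h4⟩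
    <;> rw [h1, h2, h3, h4]
  · simp
  · exact dist_triangle _ _ _
  · rw [add_comm]; exact dist_triangle _ _ _
  · simp

end AbsolutelyContinuousOnInterval

/-! ### The fundamental theorem of calculus for absolutely continuous curves in `ℝⁿ`, by components
-/

section Euclidean

variable {n : ℕ}

local notation "𝔼" => EuclideanSpace ℝ (Fin n)

theorem hasDerivAt_euclidean_iff {f : ℝ → 𝔼} {f' : 𝔼} {t : ℝ} :
    HasDerivAt f f' t ↔ ∀ i, HasDerivAt (fun s ↦ f s i) (f' i) t := by
  rw [← hasDerivAt_pi (φ := fun s i ↦ f s i)]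
  constructor
  · intro h
    exact (EuclideanSpace.equiv (Fin n) ℝ).toContinuousLinearMap.hasFDerivAt.comp_hasDerivAt t h
  · intro h
    exact (EuclideanSpace.equiv (Fin n) ℝ).symm.toContinuousLinearMap.hasFDerivAt.comp_hasDerivAt
      t h

theorem AbsolutelyContinuousOnInterval.euclidean_apply {f : ℝ → 𝔼} {a b : ℝ}
    (hf : AbsolutelyContinuousOnInterval f a b) (i : Fin n) :
    AbsolutelyContinuousOnInterval (fun s ↦ f s i) a b :=
  hf.of_dist_le (K := 1) fun x _ y _ ↦ by
    rw [one_mul, dist_eq_norm, dist_eq_norm]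
    exact PiLp.norm_apply_le (f x - f y) i

theorem AbsolutelyContinuousOnInterval.ae_hasDerivAt {f : ℝ → 𝔼} {a b : ℝ}
    (hf : AbsolutelyContinuousOnInterval f a b) :
    ∀ᵐ t : ℝ, t ∈ uIcc a b → HasDerivAt f (deriv f t) t := by
  have h : ∀ᵐ t : ℝ, ∀ i : Fin n, t ∈ uIcc a b → DifferentiableAt ℝ (fun s ↦ f s i) t :=
    ae_all_iff.2 fun i ↦ (hf.euclidean_apply i).ae_differentiableAt
  filter_upwards [h] with t ht hmem
  refine DifferentiableAt.hasDerivAt ?_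
  exact (hasDerivAt_euclidean_iff (f' := WithLp.toLp 2 fun i ↦ deriv (fun s ↦ f s i) t).2
    fun i ↦ (ht i hmem).hasDerivAt).differentiableAt

theorem AbsolutelyContinuousOnInterval.ae_deriv_apply {f : ℝ → 𝔼} {a b : ℝ}
    (hf : AbsolutelyContinuousOnInterval f a b) (i : Fin n) :
    ∀ᵐ t : ℝ, t ∈ uIcc a b → deriv (fun s ↦ f s i) t = deriv f t i := by
  filter_upwards [hf.ae_hasDerivAt] with t ht hmem
  exact (hasDerivAt_euclidean_iff.1 (ht hmem) i).deriv

theorem AbsolutelyContinuousOnInterval.intervalIntegrable_deriv_euclidean {f : ℝ → 𝔼} {a b : ℝ}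
    (hf : AbsolutelyContinuousOnInterval f a b) :
    IntervalIntegrable (deriv f) volume a b := by
  have h : ∀ i, IntervalIntegrable (fun t ↦ deriv f t i) volume a b := fun i ↦ by
    refine ((hf.euclidean_apply i).intervalIntegrable_deriv).congr_ae ?_
    rw [EventuallyEq, ae_restrict_iff' measurableSet_uIoc]
    filter_upwards [hf.ae_deriv_apply i] with t ht hmem
    exact ht (uIoc_subset_uIcc hmem)
  rw [intervalIntegrable_iff]
  exact (EuclideanSpace.equiv (Fin n) ℝ).symm.toContinuousLinearMap.integrable_comp
    (Integrable.of_eval fun i ↦ (h i).def')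

theorem AbsolutelyContinuousOnInterval.integral_deriv_euclidean {f : ℝ → 𝔼} {a b : ℝ}
    (hf : AbsolutelyContinuousOnInterval f a b) :
    ∫ t in a..b, deriv f t = f b - f a := by
  ext i
  have h1 := ContinuousLinearMap.intervalIntegral_comp_comm (EuclideanSpace.proj (𝕜 := ℝ) i)
    hf.intervalIntegrable_deriv_euclidean
  have h2 := (hf.euclidean_apply i).integral_deriv_eq_sub
  rw [intervalIntegral.integral_congr_ae (g := fun t ↦ deriv f t i)] at h2
  · simpa [h2] using h1.symm
  · filter_upwards [hf.ae_deriv_apply i] with t ht hmem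
    exact ht (uIoc_subset_uIcc hmem)

end Euclidean



/-! ### Tonelli Lagrangians on open sets of a vector space: bounds on compact sets -/

namespace Lagrangian

/-- A `C²` Lagrangian `F (q, u, t)` on an open set `U` of a vector space, convex and of
superquadratic growth in the velocity `u`. -/
structure IsTonelliOn {E : Type*} [NormedAddCommGroup E] [NormedSpace ℝ E]
    (F : E × E × ℝ → ℝ) (U : Set E) (C : ℝ) : Prop where
  isOpen : IsOpen U
  contDiffOn : ContDiffOn ℝ 2 F (U ×ˢ univ)
  convex : ∀ q ∈ U, ∀ v w : E, ∀ t : ℝ, w ≠ 0 →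
    0 < iteratedDeriv 2 (fun s : ℝ ↦ F (q, v + s • w, t)) 0
  growth_pos : 0 < C
  growth : ∀ q ∈ U, ∀ u t, C * ‖u‖ ^ 2 ≤ F (q, u, t)

theorem add_le_of_second_deriv_ge {g g' g'' : ℝ → ℝ} {k : ℝ}
    (hg : ∀ s ∈ Icc (0 : ℝ) 1, HasDerivAt g (g' s) s)
    (hg' : ∀ s ∈ Icc (0 : ℝ) 1, HasDerivAt g' (g'' s) s)
    (hk : ∀ s ∈ Icc (0 : ℝ) 1, 2 * k ≤ g'' s) : g 0 + g' 0 + k ≤ g 1 := by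
  have h1 : ∀ s ∈ Icc (0 : ℝ) 1, g' 0 + 2 * k * s ≤ g' s := by
    have hm : MonotoneOn (fun s ↦ g' s - 2 * k * s) (Icc (0 : ℝ) 1) := by
      have hd : ∀ s ∈ Icc (0 : ℝ) 1, HasDerivAt (fun s ↦ g' s - 2 * k * s) (g'' s - 2 * k) s :=
        fun s hs ↦ by simpa using (hg' s hs).fun_sub ((hasDerivAt_id s).const_mul (2 * k))
      refine monotoneOn_of_deriv_nonneg (convex_Icc _ _)
        (fun s hs ↦ (hd s hs).continuousAt.continuousWithinAt)
        (fun s hs ↦ (hd s (interior_subset hs)).differentiableAt.differentiableWithinAt) ?_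
      intro s hs
      rw [(hd s (interior_subset hs)).deriv]
      linarith [hk s (interior_subset hs)]
    intro s hs
    have := hm (left_mem_Icc.2 zero_le_one) hs hs.1
    simp only [mul_zero, sub_zero] at this
    linarith
  have hm : MonotoneOn (fun s ↦ g s - g' 0 * s - k * s ^ 2) (Icc (0 : ℝ) 1) := by
    have hd : ∀ s ∈ Icc (0 : ℝ) 1, HasDerivAt (fun s ↦ g s - g' 0 * s - k * s ^ 2)
        (g' s - g' 0 - k * (2 * s)) s := fun s hs ↦ by
      simpa using ((hg s hs).fun_sub ((hasDerivAt_id s).const_mul (g' 0))).fun_sub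
        (((hasDerivAt_id s).fun_pow 2).const_mul k)
    refine monotoneOn_of_deriv_nonneg (convex_Icc _ _)
      (fun s hs ↦ (hd s hs).continuousAt.continuousWithinAt)
      (fun s hs ↦ (hd s (interior_subset hs)).differentiableAt.differentiableWithinAt) ?_
    intro s hs
    rw [(hd s (interior_subset hs)).deriv]
    linarith [h1 s (interior_subset hs)]
  have := hm (left_mem_Icc.2 zero_le_one) (right_mem_Icc.2 zero_le_one) zero_le_one
  simp only [mul_zero, mul_one, one_pow] at this
  linarith

namespace IsTonelliOn

variable {E : Type*} [NormedAddCommGroup E] [NormedSpace ℝ E]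
  {F : E × E × ℝ → ℝ} {U : Set E} {C : ℝ} (hF : IsTonelliOn F U C)
include hF

theorem isOpen_prod : IsOpen (U ×ˢ (univ : Set (E × ℝ))) := hF.isOpen.prod isOpen_univ

theorem contDiffAt {q : E} (hq : q ∈ U) (u : E) (t : ℝ) : ContDiffAt ℝ 2 F (q, u, t) :=
  hF.contDiffOn.contDiffAt (hF.isOpen_prod.mem_nhds ⟨hq, mem_univ _⟩)

theorem hasFDerivAt {q : E} (hq : q ∈ U) (u : E) (t : ℝ) :
    HasFDerivAt F (fderiv ℝ F (q, u, t)) (q, u, t) :=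
  ((hF.contDiffAt hq u t).differentiableAt two_ne_zero).hasFDerivAt

theorem contDiffAt_fderiv {q : E} (hq : q ∈ U) (u : E) (t : ℝ) :
    ContDiffAt ℝ 1 (fderiv ℝ F) (q, u, t) :=
  (hF.contDiffAt hq u t).fderiv_right (by norm_num)

theorem continuousOn_fderiv : ContinuousOn (fderiv ℝ F) (U ×ˢ univ) := fun z hz ↦
  (hF.contDiffAt_fderiv hz.1 z.2.1 z.2.2).continuousAt.continuousWithinAt

theorem hasDerivAt_ray {q : E} (hq : q ∈ U) (v w : E) (t s : ℝ) :
    HasDerivAt (fun s : ℝ ↦ F (q, v + s • w, t))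
      (fderiv ℝ F (q, v + s • w, t) (0, w, 0)) s := by
  have h1 : HasDerivAt (fun s : ℝ ↦ ((q, v + s • w, t) : E × E × ℝ)) (0, w, 0) s := by
    refine (hasDerivAt_const s q).prodMk (HasDerivAt.prodMk ?_ (hasDerivAt_const s t))
    simpa using ((hasDerivAt_id s).smul_const w).const_add v
  exact (hF.hasFDerivAt hq _ _).comp_hasDerivAt s h1

theorem hasDerivAt_deriv_ray {q : E} (hq : q ∈ U) (v w : E) (t s : ℝ) :
    HasDerivAt (fun s : ℝ ↦ fderiv ℝ F (q, v + s • w, t) (0, w, 0))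
      (fderiv ℝ (fderiv ℝ F) (q, v + s • w, t) (0, w, 0) (0, w, 0)) s := by
  have h1 : HasDerivAt (fun s : ℝ ↦ ((q, v + s • w, t) : E × E × ℝ)) (0, w, 0) s := by
    refine (hasDerivAt_const s q).prodMk (HasDerivAt.prodMk ?_ (hasDerivAt_const s t))
    simpa using ((hasDerivAt_id s).smul_const w).const_add v
  have h2 := ((hF.contDiffAt_fderiv hq (v + s • w) t).differentiableAt one_ne_zero).hasFDerivAt
  have h3 := HasFDerivAt.comp_hasDerivAt s h2 h1
  simpa using h3.clm_apply (hasDerivAt_const s ((0, w, 0) : E × E × ℝ))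

theorem second_fderiv_pos {q : E} (hq : q ∈ U) (v : E) {w : E} (hw : w ≠ 0) (t : ℝ) :
    0 < fderiv ℝ (fderiv ℝ F) (q, v, t) (0, w, 0) (0, w, 0) := by
  have h := hF.convex q hq v w t hw
  rw [iteratedDeriv_succ, iteratedDeriv_one] at h
  have h1 : deriv (fun s : ℝ ↦ F (q, v + s • w, t)) =
      fun s ↦ fderiv ℝ F (q, v + s • w, t) (0, w, 0) :=
    funext fun s ↦ (hF.hasDerivAt_ray hq v w t s).deriv
  rw [h1, (hF.hasDerivAt_deriv_ray hq v w t 0).deriv] at h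
  simpa using h

variable [FiniteDimensional ℝ E]

/-- `F` is `C²`, so `F` and its derivative are locally Lipschitz, hence Lipschitz on the compact
product set even if that set is not convex. One constant, at least `1`, serves for all later
estimates. -/
theorem exists_lipschitz_bound {K : Set E} (hK : IsCompact K) (hKU : K ⊆ U) (R T₀ T₁ : ℝ) :
    ∃ c : ℝ, 1 ≤ c ∧
      (∀ q ∈ K, ∀ u ∈ Metric.closedBall (0 : E) R, ∀ t ∈ Icc T₀ T₁, |F (q, u, t)| ≤ c) ∧
      (∀ q ∈ K, ∀ u ∈ Metric.closedBall (0 : E) R, ∀ t ∈ Icc T₀ T₁,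
        ‖fderiv ℝ F (q, u, t)‖ ≤ c) ∧
      (∀ q ∈ K, ∀ u ∈ Metric.closedBall (0 : E) R, ∀ t ∈ Icc T₀ T₁,
        ∀ q' ∈ K, ∀ u' ∈ Metric.closedBall (0 : E) R, ∀ t' ∈ Icc T₀ T₁,
        |F (q, u, t) - F (q', u', t')| ≤ c * (‖q - q'‖ + ‖u - u'‖ + |t - t'|)) ∧
      (∀ q ∈ K, ∀ u ∈ Metric.closedBall (0 : E) R, ∀ t ∈ Icc T₀ T₁,
        ∀ q' ∈ K, ∀ u' ∈ Metric.closedBall (0 : E) R, ∀ t' ∈ Icc T₀ T₁,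
        ‖fderiv ℝ F (q, u, t) - fderiv ℝ F (q', u', t')‖ ≤
          c * (‖q - q'‖ + ‖u - u'‖ + |t - t'|)) := by
  have : ProperSpace E := FiniteDimensional.proper ℝ E
  set S : Set (E × E × ℝ) := K ×ˢ (Metric.closedBall (0 : E) R ×ˢ Icc T₀ T₁) with hS
  have hSc : IsCompact S := hK.prod ((isCompact_closedBall _ _).prod isCompact_Icc)
  have hSU : S ⊆ U ×ˢ univ := fun z hz ↦ ⟨hKU hz.1, mem_univ _⟩
  obtain ⟨c₁, h₁⟩ := hSc.exists_bound_of_continuousOn (hF.contDiffOn.continuousOn.mono hSU)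
  obtain ⟨c₂, h₂⟩ := hSc.exists_bound_of_continuousOn (hF.continuousOn_fderiv.mono hSU)
  have l₁ : LocallyLipschitzOn S F := fun z hz ↦ by
    obtain ⟨c, t, ht, h⟩ := ((hF.contDiffAt (hKU hz.1) z.2.1 z.2.2).of_le
      (m := 1) (by norm_num)).exists_lipschitzOnWith
    exact ⟨c, t, mem_nhdsWithin_of_mem_nhds ht, h⟩
  have l₂ : LocallyLipschitzOn S (fderiv ℝ F) := fun z hz ↦ by
    obtain ⟨c, t, ht, h⟩ := (hF.contDiffAt_fderiv (hKU hz.1) z.2.1 z.2.2).exists_lipschitzOnWith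
    exact ⟨c, t, mem_nhdsWithin_of_mem_nhds ht, h⟩
  obtain ⟨c₃, h₃⟩ := l₁.exists_lipschitzOnWith_of_compact hSc
  obtain ⟨c₄, h₄⟩ := l₂.exists_lipschitzOnWith_of_compact hSc
  have hd : ∀ (q u : E) (t : ℝ) (q' u' : E) (t' : ℝ),
      dist (q, u, t) (q', u', t') ≤ ‖q - q'‖ + ‖u - u'‖ + |t - t'| := fun q u t q' u' t' ↦ by
    simp only [Prod.dist_eq, ← dist_eq_norm, ← Real.dist_eq]
    refine max_le ?_ (max_le ?_ ?_) <;>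
      linarith [dist_nonneg (x := q) (y := q'), dist_nonneg (x := u) (y := u'),
        dist_nonneg (x := t) (y := t')]
  have hc : ∀ x ∈ ({|c₁|, |c₂|, (c₃ : ℝ), (c₄ : ℝ)} : Set ℝ),
      x ≤ 1 + |c₁| + |c₂| + c₃ + c₄ := by
    intro x hx
    have := abs_nonneg c₁
    have := abs_nonneg c₂
    have := c₃.2
    have := c₄.2
    simp only [mem_insert_iff, mem_singleton_iff] at hx
    rcases hx with rfl | rfl | rfl | rfl <;> simp only [NNReal.val_eq_coe] at * <;> linarith
  refine ⟨1 + |c₁| + |c₂| + c₃ + c₄, by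
    linarith [abs_nonneg c₁, abs_nonneg c₂, c₃.coe_nonneg, c₄.coe_nonneg], ?_, ?_, ?_, ?_⟩
  · intro q hq u hu t ht
    exact (h₁ (q, u, t) ⟨hq, hu, ht⟩).trans ((le_abs_self _).trans (hc _ (by simp)))
  · intro q hq u hu t ht
    exact (h₂ (q, u, t) ⟨hq, hu, ht⟩).trans ((le_abs_self _).trans (hc _ (by simp)))
  · intro q hq u hu t ht q' hq' u' hu' t' ht'
    have := h₃.dist_le_mul (q, u, t) ⟨hq, hu, ht⟩ (q', u', t') ⟨hq', hu', ht'⟩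
    rw [Real.dist_eq] at this
    exact this.trans (mul_le_mul (hc _ (by simp)) (hd _ _ _ _ _ _) dist_nonneg
      (c₃.2.trans (hc _ (by simp))))
  · intro q hq u hu t ht q' hq' u' hu' t' ht'
    have := h₄.dist_le_mul (q, u, t) ⟨hq, hu, ht⟩ (q', u', t') ⟨hq', hu', ht'⟩
    rw [dist_eq_norm] at this
    exact this.trans (mul_le_mul (hc _ (by simp)) (hd _ _ _ _ _ _) dist_nonneg
      (c₃.2.trans (hc _ (by simp))))

/-- The point of tangency `w` is bounded but `v` is arbitrary. For bounded `v`, the fibre Hessian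
has a positive minimum by compactness; for large `v`, quadratic growth of `F` beats the tangent
function plus a small quadratic term. -/
theorem exists_uniform_convexity {K : Set E} (hK : IsCompact K) (hKU : K ⊆ U) (R T₀ T₁ : ℝ) :
    ∃ m : ℝ, 0 < m ∧ ∀ q ∈ K, ∀ w ∈ Metric.closedBall (0 : E) R, ∀ t ∈ Icc T₀ T₁, ∀ v : E,
      F (q, w, t) + fderiv ℝ F (q, w, t) (0, v - w, 0) + m * ‖v - w‖ ^ 2 ≤ F (q, v, t) := by
  have : ProperSpace E := FiniteDimensional.proper ℝ E
  obtain ⟨c, hc1, hc2, hc3, -, -⟩ := hF.exists_lipschitz_bound hK hKU R T₀ T₁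
  have hC := hF.growth_pos
  -- Beyond this radius `‖w‖ ≤ ‖v‖`, `1 ≤ ‖v‖` and `6 * c ≤ C * ‖v‖`. The tangent part is then at
  -- most `c + 2c‖v‖ ≤ 3c‖v‖ ≤ C‖v‖²/2`, and the quadratic term with coefficient `C / 8` takes at
  -- most the other half.
  set R' : ℝ := |R| + 1 + 6 * c / C with hR'
  have hq6 : 0 < 6 * c / C := by positivity
  set S : Set ((E × E × ℝ) × E) :=
    (K ×ˢ (Metric.closedBall (0 : E) R' ×ˢ Icc T₀ T₁)) ×ˢ Metric.sphere (0 : E) 1 with hS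
  have hSc : IsCompact S :=
    (hK.prod ((isCompact_closedBall _ _).prod isCompact_Icc)).prod (isCompact_sphere _ _)
  have hcont : ContinuousOn (fun z : (E × E × ℝ) × E ↦
      fderiv ℝ (fderiv ℝ F) z.1 (0, z.2, 0) (0, z.2, 0)) S := by
    intro z hz
    have h1 : ContinuousAt (fderiv ℝ (fderiv ℝ F)) z.1 :=
      ((hF.contDiffAt_fderiv (hKU hz.1.1) z.1.2.1 z.1.2.2).fderiv_right
        (m := 0) (by norm_num)).continuousAt
    have h2 : ContinuousAt (fun z : (E × E × ℝ) × E ↦ fderiv ℝ (fderiv ℝ F) z.1) z :=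
      ContinuousAt.comp (f := Prod.fst) h1 continuousAt_fst
    have h3 : ContinuousAt (fun z : (E × E × ℝ) × E ↦ ((0, z.2, 0) : E × E × ℝ)) z := by
      fun_prop
    exact ((h2.clm_apply h3).clm_apply h3).continuousWithinAt
  obtain ⟨m₀, hm₀, hm⟩ := hSc.exists_forall_le' hcont (a := 0) fun z hz ↦ by
    have hne : z.2 ≠ 0 := fun h ↦ by
      have := hz.2
      simp [h] at this
    exact hF.second_fderiv_pos (hKU hz.1.1) z.1.2.1 hne z.1.2.2
  refine ⟨min (m₀ / 2) (C / 8), by positivity, fun q hq w hw t ht v ↦ ?_⟩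
  have hwR : ‖w‖ ≤ R := by simpa using hw
  have hRR : R ≤ |R| := le_abs_self R
  by_cases hv : ‖v‖ ≤ R'
  · have hmv : min (m₀ / 2) (C / 8) * ‖v - w‖ ^ 2 ≤ m₀ / 2 * ‖v - w‖ ^ 2 :=
      mul_le_mul_of_nonneg_right (min_le_left _ _) (by positivity)
    have h1 := add_le_of_second_deriv_ge (k := m₀ / 2 * ‖v - w‖ ^ 2)
      (fun s _ ↦ hF.hasDerivAt_ray (hKU hq) w (v - w) t s)
      (fun s _ ↦ hF.hasDerivAt_deriv_ray (hKU hq) w (v - w) t s) ?_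
    · simp only [zero_smul, add_zero, one_smul, add_sub_cancel] at h1
      linarith
    · intro s hs
      by_cases h0 : v - w = 0
      · simp [h0, Prod.mk_zero_zero]
      have hn : ‖v - w‖ ≠ 0 := norm_ne_zero_iff.2 h0
      have hmem : ‖w + s • (v - w)‖ ≤ R' := by
        have hseg : w + s • (v - w) ∈ Metric.closedBall (0 : E) R' :=
          (convex_closedBall (0 : E) R').add_smul_sub_mem
            (by simpa using hwR.trans (by linarith)) (by simpa using hv) hs
        simpa using hseg
      have h2 := hm ((q, w + s • (v - w), t), ‖v - w‖⁻¹ • (v - w))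
        ⟨⟨hq, by simpa using hmem, ht⟩, by simp [norm_smul, hn]⟩
      have h3 : ((0, ‖v - w‖⁻¹ • (v - w), 0) : E × E × ℝ) = ‖v - w‖⁻¹ • (0, v - w, 0) := by
        simp
      simp only [h3, map_smul, smul_apply, smul_eq_mul] at h2
      have h4 := mul_le_mul_of_nonneg_left h2 (sq_nonneg ‖v - w‖)
      have h5 : ∀ x : ℝ, ‖v - w‖ ^ 2 * (‖v - w‖⁻¹ * (‖v - w‖⁻¹ * x)) = x := fun x ↦ by
        field_simp
      rw [h5] at h4
      linarith
  · push Not at hv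
    have hmv : min (m₀ / 2) (C / 8) * ‖v - w‖ ^ 2 ≤ C / 8 * ‖v - w‖ ^ 2 :=
      mul_le_mul_of_nonneg_right (min_le_right _ _) (by positivity)
    have h1 := hF.growth q (hKU hq) v t
    have h2 := (le_abs_self _).trans (hc2 q hq w hw t ht)
    have h3 : fderiv ℝ F (q, w, t) (0, v - w, 0) ≤ c * ‖v - w‖ := by
      refine (Real.le_norm_self _).trans ((ContinuousLinearMap.le_opNorm _ _).trans ?_)
      have : ‖((0, v - w, 0) : E × E × ℝ)‖ = ‖v - w‖ := by simp [Prod.norm_def]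
      rw [this]
      exact mul_le_mul_of_nonneg_right (hc3 q hq w hw t ht) (norm_nonneg _)
    have h4 : ‖v - w‖ ≤ 2 * ‖v‖ := (norm_sub_le v w).trans (by linarith)
    have h5 : ‖v - w‖ ^ 2 ≤ 4 * ‖v‖ ^ 2 := by
      have := pow_le_pow_left₀ (norm_nonneg (v - w)) h4 2
      linarith
    have h6 : 6 * c ≤ C * ‖v‖ := by
      have : 6 * c / C ≤ ‖v‖ := by linarith [abs_nonneg R]
      rwa [div_le_iff₀' hC] at this
    have h7 : 1 ≤ ‖v‖ := by linarith [abs_nonneg R]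
    have h8 : c * ‖v - w‖ ≤ c * (2 * ‖v‖) := mul_le_mul_of_nonneg_left h4 (by linarith)
    have h9 : 6 * c * ‖v‖ ≤ C * ‖v‖ ^ 2 := by nlinarith
    have h10 : C / 8 * ‖v - w‖ ^ 2 ≤ C / 8 * (4 * ‖v‖ ^ 2) :=
      mul_le_mul_of_nonneg_left h5 (by positivity)
    nlinarith

end IsTonelliOn

end Lagrangian



/-! ### Cauchy–Schwarz and the excess estimate for minimizers -/

theorem MeasureTheory.sq_integral_le {α : Type*} [MeasurableSpace α] {μ : Measure α}
    [IsFiniteMeasure μ] {g : α → ℝ} (hg : Integrable g μ) (hg2 : Integrable (fun x ↦ g x ^ 2) μ) :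
    (∫ x, g x ∂μ) ^ 2 ≤ μ.real univ * ∫ x, g x ^ 2 ∂μ := by
  set a := ∫ x, g x ∂μ
  set h := μ.real univ
  have h0 : 0 ≤ h := measureReal_nonneg
  -- The right-hand side is `∫ (h g - a)²`. Dividing by `h` requires the zero measure to be treated
  -- separately.
  have key : 0 ≤ h * (h * ∫ x, g x ^ 2 ∂μ - a ^ 2) := by
    have h1 : 0 ≤ ∫ x, (h * g x - a) ^ 2 ∂μ := integral_nonneg fun x ↦ sq_nonneg _
    have h2 : ∫ x, (h * g x - a) ^ 2 ∂μ = ∫ x, (h ^ 2 * g x ^ 2 - 2 * h * a * g x + a ^ 2) ∂μ := by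
      congr 1; ext x; ring
    have i1 : Integrable (fun x ↦ h ^ 2 * g x ^ 2 - 2 * h * a * g x) μ :=
      (hg2.const_mul _).sub (hg.const_mul _)
    rw [h2, integral_add i1 (integrable_const _),
      integral_sub (hg2.const_mul _) (hg.const_mul _), integral_const_mul, integral_const_mul,
      integral_const] at h1
    simp only [smul_eq_mul] at h1
    change 0 ≤ h ^ 2 * _ - 2 * h * a * a + h * a ^ 2 at h1
    linarith
  rcases h0.eq_or_lt with h0 | h0
  · have : μ = 0 := by
      rw [← Measure.measure_univ_eq_zero]
      exact (measureReal_eq_zero_iff (measure_ne_top _ _)).1 h0.symm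
    simp [a, this]
  · have := nonneg_of_mul_nonneg_right key h0
    linarith

namespace Lagrangian

section Excess

variable {n : ℕ}

local notation "𝔼" => EuclideanSpace ℝ (Fin n)

/-- `q` minimizes the action of `F` on `[s, t]` among the `C¹` curves in `K` with the same
endpoints. -/
def IsMinimizerIn (F : 𝔼 × 𝔼 × ℝ → ℝ) (K : Set 𝔼) (q : ℝ → 𝔼) (s t : ℝ) : Prop :=
  ∀ β : ℝ → 𝔼, ContDiffOn ℝ 1 β (Icc s t) → MapsTo β (Icc s t) K → β s = q s → β t = q t →
    ∫⁻ τ in Icc s t, ENNReal.ofReal (F (q τ, deriv q τ, τ)) ≤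
      ∫⁻ τ in Icc s t, ENNReal.ofReal (F (β τ, derivWithin β (Icc s t) τ, τ))

theorem IsTonelliOn.aestronglyMeasurable {F : 𝔼 × 𝔼 × ℝ → ℝ} {U : Set 𝔼} {C : ℝ}
    (hF : IsTonelliOn F U C) {q : ℝ → 𝔼} {s t : ℝ} (hq : ContinuousOn q (Icc s t))
    (hqU : MapsTo q (Icc s t) U) :
    AEStronglyMeasurable (fun τ ↦ F (q τ, deriv q τ, τ)) (volume.restrict (Icc s t)) := by
  classical
  have h1 : Measurable ((U ×ˢ (univ : Set (𝔼 × ℝ))).piecewise F (fun _ ↦ 0)) :=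
    hF.contDiffOn.continuousOn.measurable_piecewise continuousOn_const
      hF.isOpen_prod.measurableSet
  have h2 : AEMeasurable (fun τ ↦ (q τ, deriv q τ, τ)) (volume.restrict (Icc s t)) :=
    (hq.aemeasurable measurableSet_Icc).prodMk
      ((measurable_deriv q).aemeasurable.prodMk aemeasurable_id)
  refine ((h1.comp_aemeasurable h2).congr ?_).aestronglyMeasurable
  filter_upwards [ae_restrict_mem measurableSet_Icc] with τ hτ
  simp [piecewise, hqU hτ]

/-- With `h = t - s`, `w` the slope, `I = ∫ ‖q' - w‖` and `Q = ∫ ‖q' - w‖²`, compare `q` with the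
affine curve `β`. Uniform convexity gains `m Q`. The linear term vanishes up to errors because `q' -
w` has mean zero, and the errors are `O(h I)` because `q` and `β` differ by at most `I`. So `m Q ≤
c' h I`, and `I² ≤ h Q` gives `I ≤ c' h² / m`. -/
theorem IsTonelliOn.excess_le {F : 𝔼 × 𝔼 × ℝ → ℝ} {U : Set 𝔼} {C : ℝ}
    (hF : IsTonelliOn F U C) {x₀ : 𝔼} {r : ℝ} (hr : Metric.closedBall x₀ r ⊆ U) (R T₀ T₁ : ℝ) :
    ∃ c : ℝ, 0 ≤ c ∧ ∀ (q : ℝ → 𝔼) (s t : ℝ), s < t → t - s ≤ 1 → T₀ ≤ s → t ≤ T₁ →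
      AbsolutelyContinuousOnInterval q s t → MapsTo q (Icc s t) (Metric.closedBall x₀ r) →
      IsMinimizerIn F (Metric.closedBall x₀ r) q s t → ‖q t - q s‖ ≤ R * (t - s) →
      ∫ τ in Icc s t, ‖deriv q τ - (t - s)⁻¹ • (q t - q s)‖ ≤ c * (t - s) ^ 2 := by
  set K := Metric.closedBall x₀ r
  obtain ⟨c, hc1, hcF, -, hcL, hcD⟩ :=
    hF.exists_lipschitz_bound (isCompact_closedBall x₀ r) hr R T₀ T₁
  obtain ⟨m, hm, hconv⟩ := hF.exists_uniform_convexity (isCompact_closedBall x₀ r) hr R T₀ T₁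
  have hC := hF.growth_pos
  -- The a priori bound `I ≤ e * h`: the action of `q` is at most that of the affine curve, hence at
  -- most `c * h`, and growth turns this into an `L²` bound on the velocity.
  set e := √(c / C) + |R| with he
  have he0 : 0 ≤ e := by positivity
  refine ⟨c * (e + |R| + 2) / m, by positivity, ?_⟩
  intro q s t hst hst1 hs ht hac hqK hmin hslope
  set h := t - s with hh
  have hh0 : 0 < h := by linarith
  set w := h⁻¹ • (q t - q s) with hw
  have hwR : ‖w‖ ≤ R := by
    rw [hw, norm_smul, norm_inv, Real.norm_of_nonneg hh0.le, inv_mul_le_iff₀ hh0]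
    linarith
  have hR0 : 0 ≤ R := (norm_nonneg _).trans hwR
  rw [abs_of_nonneg hR0] at he ⊢
  have hwmem : w ∈ Metric.closedBall (0 : 𝔼) R := by simpa using hwR
  set μ := volume.restrict (Icc s t) with hμ
  have hμh : μ.real univ = h := by
    simp [hμ, hh, hst.le]
  have hqc : ContinuousOn q (Icc s t) := by simpa [uIcc_of_le hst.le] using hac.continuousOn
  have hint : ∀ τ ∈ Icc s t, IntervalIntegrable (deriv q) volume s τ ∧
      ∫ τ' in s..τ, deriv q τ' = q τ - q s := fun τ hτ ↦ by
    have : AbsolutelyContinuousOnInterval q s τ := hac.mono (by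
      rw [uIcc_of_le hst.le, uIcc_of_le hτ.1]
      exact Icc_subset_Icc_right hτ.2)
    exact ⟨this.intervalIntegrable_deriv_euclidean, this.integral_deriv_euclidean⟩
  have hti : t ∈ Icc s t := ⟨hst.le, le_rfl⟩
  have hvint : Integrable (deriv q) μ := by
    have := (hint t hti).1
    rwa [intervalIntegrable_iff_integrableOn_Icc_of_le hst.le] at this
  have hvw : Integrable (fun τ ↦ deriv q τ - w) μ := hvint.sub (integrable_const w)
  set I := ∫ τ, ‖deriv q τ - w‖ ∂μ with hI
  have hI0 : 0 ≤ I := integral_nonneg fun _ ↦ norm_nonneg _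
  have hzero : ∫ τ, (deriv q τ - w) ∂μ = 0 := by
    rw [integral_sub hvint (integrable_const _), integral_const, hμh, hμ,
      integral_Icc_eq_integral_Ioc, ← intervalIntegral.integral_of_le hst.le, (hint t hti).2, hw,
      smul_inv_smul₀ hh0.ne', sub_self]
  set β : ℝ → 𝔼 := fun τ ↦ q s + (τ - s) • w with hβ
  have hβs : β s = q s := by simp [hβ]
  have hβt : β t = q t := by
    simp only [hβ, hw]
    rw [← hh, smul_inv_smul₀ hh0.ne']
    abel
  have hβd : ∀ τ, HasDerivAt β w τ := fun τ ↦ by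
    simpa [hβ] using (((hasDerivAt_id τ).sub_const s).smul_const w).const_add (q s)
  have hdiff : ∀ τ ∈ Icc s t, ‖q τ - β τ‖ ≤ I := fun τ hτ ↦ by
    have h1 : q τ - β τ = ∫ τ' in s..τ, (deriv q τ' - w) := by
      rw [intervalIntegral.integral_sub (hint τ hτ).1 (by simp), (hint τ hτ).2,
        intervalIntegral.integral_const, hβ, sub_sub]
    rw [h1]
    refine (intervalIntegral.norm_integral_le_integral_norm hτ.1).trans ?_
    rw [intervalIntegral.integral_of_le hτ.1, hI, hμ]
    exact setIntegral_mono_set hvw.norm (Eventually.of_forall fun _ ↦ norm_nonneg _)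
      (LE.le.eventuallyLE (Ioc_subset_Icc_self.trans (Icc_subset_Icc_right hτ.2)))
  have hβK : MapsTo β (Icc s t) K := fun τ hτ ↦ by
    have h1 : β τ = q s + ((τ - s) / h) • (q t - q s) := by
      simp only [hβ, hw, smul_smul, div_eq_mul_inv]
    rw [h1]
    exact (convex_closedBall x₀ r).add_smul_sub_mem (hqK ⟨le_rfl, hst.le⟩) (hqK hti)
      ⟨div_nonneg (by linarith [hτ.1]) hh0.le, (div_le_one hh0).2 (by linarith [hτ.2])⟩
  have hT : ∀ τ ∈ Icc s t, τ ∈ Icc T₀ T₁ := fun τ hτ ↦ ⟨hs.trans hτ.1, hτ.2.trans ht⟩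
  -- comparison with the affine curve
  have hβc : ContDiff ℝ 1 β := by simp only [hβ]; fun_prop
  have hFβ : IntegrableOn (fun τ ↦ F (β τ, w, τ)) (Icc s t) := by
    refine ContinuousOn.integrableOn_Icc ?_
    refine hF.contDiffOn.continuousOn.comp (t := U ×ˢ univ) ?_ fun τ hτ ↦ ⟨hr (hβK hτ), mem_univ _⟩
    have := hβc.continuous
    fun_prop
  have hFβ0 : ∀ τ ∈ Icc s t, 0 ≤ F (β τ, w, τ) := fun τ hτ ↦
    (by positivity : (0 : ℝ) ≤ C * ‖w‖ ^ 2).trans (hF.growth _ (hr (hβK hτ)) _ _)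
  have hFq0 : ∀ᵐ τ ∂μ, 0 ≤ F (q τ, deriv q τ, τ) := by
    filter_upwards [ae_restrict_mem measurableSet_Icc] with τ hτ
    exact (by positivity : (0 : ℝ) ≤ C * ‖deriv q τ‖ ^ 2).trans (hF.growth _ (hr (hqK hτ)) _ _)
  have hle : ∫⁻ τ, ENNReal.ofReal (F (q τ, deriv q τ, τ)) ∂μ ≤
      ENNReal.ofReal (∫ τ, F (β τ, w, τ) ∂μ) := by
    refine (hmin β hβc.contDiffOn hβK hβs hβt).trans_eq ?_
    rw [ofReal_integral_eq_lintegral_ofReal hFβ]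
    · refine setLIntegral_congr_fun measurableSet_Icc fun τ hτ ↦ ?_
      beta_reduce
      rw [((hβd τ).hasDerivWithinAt).derivWithin (uniqueDiffOn_Icc hst τ hτ)]
    · filter_upwards [ae_restrict_mem measurableSet_Icc] with τ hτ using hFβ0 τ hτ
  have hFq : Integrable (fun τ ↦ F (q τ, deriv q τ, τ)) μ :=
    ⟨hF.aestronglyMeasurable hqc fun τ hτ ↦ hr (hqK hτ),
      (hasFiniteIntegral_iff_ofReal hFq0).2 (hle.trans_lt ENNReal.ofReal_lt_top)⟩
  have hle' : ∫ τ, F (q τ, deriv q τ, τ) ∂μ ≤ ∫ τ, F (β τ, w, τ) ∂μ := by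
    rw [← ofReal_integral_eq_lintegral_ofReal hFq hFq0] at hle
    refine (ENNReal.ofReal_le_ofReal_iff (setIntegral_nonneg measurableSet_Icc hFβ0)).1 hle
  have hFβc : ∫ τ, F (β τ, w, τ) ∂μ ≤ c * h := by
    have : ∫ τ, F (β τ, w, τ) ∂μ ≤ ∫ _, c ∂μ :=
      setIntegral_mono_on hFβ (integrable_const _) measurableSet_Icc fun τ hτ ↦
        (le_abs_self _).trans (hcF _ (hβK hτ) _ hwmem _ (hT τ hτ))
    rwa [integral_const, hμh, smul_eq_mul, mul_comm] at this
  -- square integrability of the velocity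
  have hv2 : Integrable (fun τ ↦ ‖deriv q τ‖ ^ 2) μ := by
    refine (hFq.const_mul C⁻¹).mono' (hvint.1.norm.pow 2) ?_
    filter_upwards [ae_restrict_mem measurableSet_Icc] with τ hτ
    rw [Real.norm_of_nonneg (by positivity), le_inv_mul_iff₀ hC]
    exact hF.growth _ (hr (hqK hτ)) _ _
  have hvw2 : Integrable (fun τ ↦ ‖deriv q τ - w‖ ^ 2) μ :=
    (((memLp_two_iff_integrable_sq_norm hvint.1).2 hv2).sub (memLp_const w)).integrable_norm_pow
      two_ne_zero
  set Q := ∫ τ, ‖deriv q τ - w‖ ^ 2 ∂μ with hQ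
  have hIQ : I ^ 2 ≤ h * Q := by
    have := sq_integral_le hvw.norm hvw2
    rwa [hμh] at this
  have hIe : I ≤ e * h := by
    have h1 : C * ∫ τ, ‖deriv q τ‖ ^ 2 ∂μ ≤ c * h := by
      rw [← integral_const_mul]
      refine (setIntegral_mono_on (hv2.const_mul C) hFq measurableSet_Icc fun τ hτ ↦ ?_).trans
        (hle'.trans hFβc)
      exact hF.growth _ (hr (hqK hτ)) _ _
    have h2 : (∫ τ, ‖deriv q τ‖ ∂μ) ^ 2 ≤ h * ∫ τ, ‖deriv q τ‖ ^ 2 ∂μ := by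
      have := sq_integral_le hvint.norm hv2
      rwa [hμh] at this
    have h3 : (∫ τ, ‖deriv q τ‖ ∂μ) ≤ √(c / C) * h := by
      refine abs_le_of_sq_le_sq' ?_ (by positivity) |>.2
      rw [mul_pow, Real.sq_sqrt (by positivity)]
      have h4 : ∫ τ, ‖deriv q τ‖ ^ 2 ∂μ ≤ c / C * h := by
        rw [div_mul_eq_mul_div, le_div_iff₀' hC]; exact h1
      nlinarith
    have h5 : I ≤ ∫ τ, (‖deriv q τ‖ + R) ∂μ :=
      integral_mono hvw.norm (hvint.norm.add (integrable_const _)) fun τ ↦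
        (norm_sub_le _ _).trans (by simpa using hwR)
    rw [integral_add hvint.norm (integrable_const _), integral_const, hμh, smul_eq_mul] at h5
    rw [he]
    linarith
  -- the main inequality
  set D := fderiv ℝ F (q s, w, s) with hD
  set k := I + (R + 1) * h with hk
  -- The momentum is frozen at the initial point, so that its pairing with `q' - w` integrates to
  -- zero. The true momentum at time `τ` differs from it by at most `c * k`, since `k` bounds `‖q s
  -- - q τ‖ + |s - τ|`.
  set ℓ : 𝔼 →L[ℝ] ℝ := D.comp ((ContinuousLinearMap.inr ℝ 𝔼 (𝔼 × ℝ)).comp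
    (ContinuousLinearMap.inl ℝ 𝔼 ℝ)) with hℓ
  have hℓa : ∀ u, ℓ u = D (0, u, 0) := fun u ↦ by simp [hℓ]
  have hpt : ∀ τ ∈ Icc s t, F (β τ, w, τ) - c * I + ℓ (deriv q τ - w)
      - c * k * ‖deriv q τ - w‖ + m * ‖deriv q τ - w‖ ^ 2 ≤ F (q τ, deriv q τ, τ) := by
    intro τ hτ
    have h1 := hconv (q τ) (hqK hτ) w hwmem τ (hT τ hτ) (deriv q τ)
    have h2 : F (β τ, w, τ) - F (q τ, w, τ) ≤ c * I := by
      refine (le_abs_self _).trans ((hcL _ (hβK hτ) w hwmem τ (hT τ hτ) _ (hqK hτ) w hwmem τ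
        (hT τ hτ)).trans ?_)
      simp only [sub_self, norm_zero, abs_zero, add_zero]
      rw [norm_sub_rev]
      exact mul_le_mul_of_nonneg_left (hdiff τ hτ) (by linarith)
    have h3 : ‖D - fderiv ℝ F (q τ, w, τ)‖ ≤ c * k := by
      refine (hcD _ (hqK ⟨le_rfl, hst.le⟩) w hwmem s (hT s ⟨le_rfl, hst.le⟩) _ (hqK hτ) w hwmem τ
        (hT τ hτ)).trans ?_
      refine mul_le_mul_of_nonneg_left ?_ (by linarith)
      have h4 : ‖q s - q τ‖ ≤ I + R * h := by
        have h5 : q s - q τ = -(q τ - β τ) - (τ - s) • w := by simp only [hβ]; abel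
        rw [h5]
        refine (norm_sub_le _ _).trans (add_le_add (by rw [norm_neg]; exact hdiff τ hτ) ?_)
        rw [norm_smul, Real.norm_of_nonneg (by linarith [hτ.1]), mul_comm]
        exact mul_le_mul hwR (by linarith [hτ.2]) (by linarith [hτ.1]) hR0
      have h6 : |s - τ| ≤ h := by
        rw [abs_sub_comm, abs_of_nonneg (by linarith [hτ.1])]; linarith [hτ.2]
      simp only [sub_self, norm_zero, add_zero, hk]
      linarith
    have h7 : ℓ (deriv q τ - w) - fderiv ℝ F (q τ, w, τ) (0, deriv q τ - w, 0) ≤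
        c * k * ‖deriv q τ - w‖ := by
      rw [hℓa]
      have h8 := (D - fderiv ℝ F (q τ, w, τ)).le_opNorm (0, deriv q τ - w, 0)
      have h9 : ‖((0, deriv q τ - w, 0) : 𝔼 × 𝔼 × ℝ)‖ = ‖deriv q τ - w‖ := by
        simp [Prod.norm_def]
      rw [h9] at h8
      exact (Real.le_norm_self _).trans (h8.trans
        (mul_le_mul_of_nonneg_right h3 (norm_nonneg _)))
    linarith
  have i1 : Integrable (fun τ ↦ F (β τ, w, τ) - c * I) μ := Integrable.sub hFβ (integrable_const _)
  have i2 : Integrable (fun τ ↦ ℓ (deriv q τ - w)) μ := ℓ.integrable_comp hvw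
  have i3 : Integrable (fun τ ↦ c * k * ‖deriv q τ - w‖) μ := hvw.norm.const_mul _
  have i4 : Integrable (fun τ ↦ m * ‖deriv q τ - w‖ ^ 2) μ := hvw2.const_mul _
  have hmain : (∫ τ, F (β τ, w, τ) ∂μ) - h * (c * I) + 0 - c * k * I + m * Q ≤
      ∫ τ, F (q τ, deriv q τ, τ) ∂μ := by
    have j1 : Integrable (fun τ ↦ F (β τ, w, τ) - c * I + ℓ (deriv q τ - w)) μ := i1.add i2
    have j2 : Integrable (fun τ ↦ F (β τ, w, τ) - c * I + ℓ (deriv q τ - w)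
      - c * k * ‖deriv q τ - w‖) μ := j1.sub i3
    have j3 : Integrable (fun τ ↦ F (β τ, w, τ) - c * I + ℓ (deriv q τ - w)
      - c * k * ‖deriv q τ - w‖ + m * ‖deriv q τ - w‖ ^ 2) μ := j2.add i4
    refine le_trans (le_of_eq ?_) (setIntegral_mono_on j3 hFq measurableSet_Icc hpt)
    rw [integral_add j2 i4, integral_sub j1 i3, integral_add i1 i2,
      integral_sub hFβ (integrable_const _), integral_const, hμh, integral_const_mul,
      integral_const_mul, ℓ.integral_comp_comm hvw, hzero, map_zero, smul_eq_mul]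
  have hmQ : m * Q ≤ c * (e + R + 2) * h * I := by
    have h1 : m * Q ≤ h * (c * I) + c * k * I := by linarith
    have h2 : c * k * I ≤ c * ((e + R + 1) * h) * I := by
      refine mul_le_mul_of_nonneg_right (mul_le_mul_of_nonneg_left ?_ (by linarith)) hI0
      rw [hk]; linarith
    nlinarith
  rcases hI0.eq_or_lt with h0 | h0
  · rw [← h0]; positivity
  · have h1 : m * I ^ 2 ≤ c * (e + R + 2) * h ^ 2 * I := by
      have := mul_le_mul_of_nonneg_left hIQ hm.le
      have := mul_le_mul_of_nonneg_left hmQ hh0.le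
      nlinarith
    rw [div_mul_eq_mul_div, le_div_iff₀' hm]
    have h2 : m * I * I ≤ c * (e + R + 2) * h ^ 2 * I := by linarith [h1, sq I]
    exact le_of_mul_le_mul_right h2 h0

end Excess

end Lagrangian



/-! ### From control of slopes to continuous differentiability -/

namespace Lagrangian

section Slopes

variable {E : Type*} [NormedAddCommGroup E] [NormedSpace ℝ E]

/-- The slopes of bounded size of `q` vary by at most `c` times the length when the interval shrinks
by a factor at most `2`. -/
def SlopeControl (q : ℝ → E) (a b R c : ℝ) : Prop :=
  ∀ s t, a ≤ s → s < t → t ≤ b → ‖slope q s t‖ ≤ R → ∀ s' t', s ≤ s' → s' < t' → t' ≤ t →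
    (t - s) / 2 ≤ t' - s' → ‖slope q s' t' - slope q s t‖ ≤ c * (t - s)

variable {q : ℝ → E} {a b R c : ℝ}

/-- Each halving costs `c` times the current length; the geometric series sums to `2 * c * (t - s)`.
The slack in the hypothesis on `R` keeps the intermediate slopes in the range where the control
applies. -/
theorem SlopeControl.dyadic (h : SlopeControl q a b R c) (hc : 0 ≤ c) (k : ℕ) :
    ∀ s t, a ≤ s → s < t → t ≤ b → ‖slope q s t‖ + 2 * c * (t - s) ≤ R →
      ∀ s' t', s ≤ s' → s' < t' → t' ≤ t → (t - s) / 2 ^ k ≤ t' - s' →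
        ‖slope q s' t' - slope q s t‖ ≤ 2 * c * (t - s) := by
  induction k with
  | zero =>
    intro s t _ hst _ _ s' t' hs' _ ht' hl
    have h1 : s' = s := by simp at hl; linarith
    have h2 : t' = t := by simp at hl; linarith
    rw [h1, h2, sub_self, norm_zero]
    have : 0 ≤ t - s := by linarith
    positivity
  | succ k ih =>
    intro s t hs hst ht hR s' t' hs' hst' ht' hl
    have hts : 0 ≤ c * (t - s) := mul_nonneg hc (by linarith)
    by_cases hh : (t - s) / 2 ≤ t' - s'
    · have := h s t hs hst ht (by linarith) s' t' hs' hst' ht' hh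
      linarith
    push Not at hh
    -- `[σ, σ + (t - s) / 2]` is an interval of half the length lying between `[s', t']` and `[s,
    -- t]`.
    set σ := max s (t' - (t - s) / 2) with hσ
    have h1 : s ≤ σ := le_max_left _ _
    have h2 : t' - (t - s) / 2 ≤ σ := le_max_right _ _
    have h3 : σ ≤ s' := max_le hs' (by linarith)
    have h4 : σ + (t - s) / 2 ≤ t := by
      rw [← le_sub_iff_add_le]
      exact max_le (by linarith) (by linarith)
    have k1 := h s t hs hst ht (by linarith) σ (σ + (t - s) / 2) h1 (by linarith) h4 (by linarith)
    have k2 := ih σ (σ + (t - s) / 2) (hs.trans h1) (by linarith) (h4.trans ht) (by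
      have := norm_le_norm_add_norm_sub' (slope q σ (σ + (t - s) / 2)) (slope q s t)
      linarith) s' t' h3 hst' (by linarith) (by
      rw [pow_succ] at hl
      rw [add_sub_cancel_left, div_div, mul_comm 2]
      exact hl)
    have := norm_sub_le_norm_sub_add_norm_sub (slope q s' t') (slope q σ (σ + (t - s) / 2))
      (slope q s t)
    linarith

theorem SlopeControl.norm_slope_sub_le (h : SlopeControl q a b R c) (hc : 0 ≤ c) {s t : ℝ}
    (hs : a ≤ s) (hst : s < t) (ht : t ≤ b) (hR : ‖slope q s t‖ + 2 * c * (t - s) ≤ R) {s' t' : ℝ}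
    (hs' : s ≤ s') (hst' : s' < t') (ht' : t' ≤ t) :
    ‖slope q s' t' - slope q s t‖ ≤ 2 * c * (t - s) := by
  obtain ⟨k, hk⟩ := exists_pow_lt_of_lt_one (div_pos (sub_pos.2 hst') (sub_pos.2 hst))
    (by norm_num : (1 / 2 : ℝ) < 1)
  refine h.dyadic hc k s t hs hst ht hR s' t' hs' hst' ht' ?_
  rw [lt_div_iff₀ (sub_pos.2 hst), one_div, inv_pow, inv_mul_eq_div] at hk
  exact hk.le

theorem HasDerivWithinAt.norm_slope_sub_le {v : E} {s : Set ℝ} {t : ℝ}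
    (hd : HasDerivWithinAt q v s t) {ε : ℝ} (hε : 0 < ε) :
    ∃ δ > 0, ∀ x ∈ s, ∀ y ∈ s, x ≤ t → t ≤ y → x < y → y - x < δ → ‖slope q x y - v‖ ≤ ε := by
  have h1 := (hasDerivWithinAt_iff_isLittleO.1 hd).def hε
  obtain ⟨δ, hδ, h2⟩ := Metric.mem_nhdsWithin_iff.1 h1
  refine ⟨δ, hδ, fun x hx y hy hxt hty hxy hxyδ ↦ ?_⟩
  have hX := h2 ⟨by rw [Metric.mem_ball, Real.dist_eq, abs_lt]; constructor <;> linarith, hx⟩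
  have hY := h2 ⟨by rw [Metric.mem_ball, Real.dist_eq, abs_lt]; constructor <;> linarith, hy⟩
  simp only [mem_ofPred_eq, Real.norm_eq_abs] at hX hY
  rw [abs_of_nonpos (by linarith)] at hX
  rw [abs_of_nonneg (by linarith)] at hY
  have hyx : 0 < y - x := by linarith
  have h3 : slope q x y - v =
      (y - x)⁻¹ • ((q y - q t - (y - t) • v) - (q x - q t - (x - t) • v)) := by
    have : (y - x)⁻¹ • ((y - x) • v) = v := inv_smul_smul₀ hyx.ne' v
    rw [slope_def_module]
    nth_rw 1 [← this]
    rw [← smul_sub]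
    congr 1
    module
  rw [h3, norm_smul, norm_inv, Real.norm_of_nonneg hyx.le, inv_mul_le_iff₀ hyx]
  refine (norm_sub_le _ _).trans ?_
  linarith

/-- A continuity argument removes the a priori bound on the slope. Shrink `[a, b]` homothetically to
`t₁`: the slopes tend to `v`. If the full slope exceeded `R₀ + 1`, some intermediate slope would
have norm exactly `R₀ + 1`. Control applies there and keeps all smaller slopes within `2 * c * (b -
a) < 1` of it, so that `‖v‖ > R₀`. -/
theorem SlopeControl.norm_slope_le (h : SlopeControl q a b R c) (hc : 0 ≤ c) (hab : a < b)
    (hq : ContinuousOn q (Icc a b)) {t₁ : ℝ} (ht₁ : t₁ ∈ Icc a b) {v : E}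
    (hd : HasDerivWithinAt q v (Icc a b) t₁) {R₀ : ℝ} (hv : ‖v‖ ≤ R₀)
    (hδ : 2 * c * (b - a) < 1) (hR : R₀ + 2 ≤ R) : ‖slope q a b‖ ≤ R₀ + 1 := by
  by_contra! hcon
  set A : ℝ → ℝ := fun θ ↦ t₁ + θ * (a - t₁) with hA
  set B : ℝ → ℝ := fun θ ↦ t₁ + θ * (b - t₁) with hB
  have hAB : ∀ θ, B θ - A θ = θ * (b - a) := fun θ ↦ by simp only [hA, hB]; ring
  have hAt : ∀ θ, 0 ≤ θ → A θ ≤ t₁ := fun θ hθ ↦ by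
    simp only [hA]; nlinarith [ht₁.1]
  have hBt : ∀ θ, 0 ≤ θ → t₁ ≤ B θ := fun θ hθ ↦ by
    simp only [hB]; nlinarith [ht₁.2]
  have hmonoA : ∀ θ θ', θ ≤ θ' → A θ' ≤ A θ := fun θ θ' hθ ↦ by
    simp only [hA]; nlinarith [ht₁.1]
  have hmonoB : ∀ θ θ', θ ≤ θ' → B θ ≤ B θ' := fun θ θ' hθ ↦ by
    simp only [hB]; nlinarith [ht₁.2]
  have hA1 : A 1 = a := by simp [hA]
  have hB1 : B 1 = b := by simp [hB]
  have hlt : ∀ θ, 0 < θ → A θ < B θ := fun θ hθ ↦ by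
    have := hAB θ
    have := mul_pos hθ (sub_pos.2 hab)
    linarith
  have hAmem : ∀ θ ∈ Icc (0 : ℝ) 1, A θ ∈ Icc a b := fun θ hθ ↦
    ⟨hA1 ▸ hmonoA θ 1 hθ.2, (hAt θ hθ.1).trans ht₁.2⟩
  have hBmem : ∀ θ ∈ Icc (0 : ℝ) 1, B θ ∈ Icc a b := fun θ hθ ↦
    ⟨ht₁.1.trans (hBt θ hθ.1), hB1 ▸ hmonoB θ 1 hθ.2⟩
  have key : ∀ ε > 0, ∃ θ₁ ∈ Ioo (0 : ℝ) 1, ∀ θ ∈ Ioc 0 θ₁,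
      ‖slope q (A θ) (B θ) - v‖ ≤ ε := by
    intro ε hε
    obtain ⟨δ, hδ0, hδ⟩ := HasDerivWithinAt.norm_slope_sub_le hd hε
    refine ⟨min (1 / 2) (δ / (2 * (b - a))), ⟨?_, ?_⟩, fun θ hθ ↦ ?_⟩
    · have : 0 < b - a := by linarith
      positivity
    · exact (min_le_left _ _).trans_lt (by norm_num)
    · have h01 : θ ∈ Icc (0 : ℝ) 1 :=
        ⟨hθ.1.le, hθ.2.trans ((min_le_left _ _).trans (by norm_num))⟩
      refine hδ _ (hAmem θ h01) _ (hBmem θ h01) (hAt θ hθ.1.le) (hBt θ hθ.1.le) (hlt θ hθ.1) ?_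
      rw [hAB]
      have h2 := hθ.2.trans (min_le_right _ _)
      have hba : 0 < b - a := by linarith
      rw [le_div_iff₀ (by positivity)] at h2
      nlinarith
  obtain ⟨θ₁, hθ₁, h1⟩ := key (1 / 2) (by norm_num)
  have hf : ContinuousOn (fun θ ↦ ‖slope q (A θ) (B θ)‖) (Icc θ₁ 1) := by
    have hsub : Icc θ₁ 1 ⊆ Icc (0 : ℝ) 1 := Icc_subset_Icc_left hθ₁.1.le
    have hcA : ContinuousOn (fun θ ↦ q (A θ)) (Icc θ₁ 1) :=
      hq.comp (by simp only [hA]; fun_prop) fun θ hθ ↦ hAmem θ (hsub hθ)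
    have hcB : ContinuousOn (fun θ ↦ q (B θ)) (Icc θ₁ 1) :=
      hq.comp (by simp only [hB]; fun_prop) fun θ hθ ↦ hBmem θ (hsub hθ)
    simp only [slope_def_module, hAB]
    refine (ContinuousOn.smul (ContinuousOn.inv₀ (by fun_prop) fun θ hθ ↦ ?_) (hcB.sub hcA)).norm
    exact mul_ne_zero (hθ₁.1.trans_le hθ.1).ne' (by linarith)
  obtain ⟨θ₀, hθ₀, h0⟩ : R₀ + 1 ∈ (fun θ ↦ ‖slope q (A θ) (B θ)‖) '' Icc θ₁ 1 := by
    refine intermediate_value_Icc hθ₁.2.le hf ⟨?_, ?_⟩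
    · have := h1 θ₁ ⟨hθ₁.1, le_rfl⟩
      have := norm_le_norm_add_norm_sub' (slope q (A θ₁) (B θ₁)) v
      linarith
    · simp only [hA1, hB1]; exact hcon.le
  have hθ₀0 : 0 < θ₀ := hθ₁.1.trans_le hθ₀.1
  have hlen : 2 * c * (B θ₀ - A θ₀) ≤ 2 * c * (b - a) := by
    rw [hAB]
    refine mul_le_mul_of_nonneg_left ?_ (by positivity)
    nlinarith [hθ₀.2]
  obtain ⟨θ₂, hθ₂, h2⟩ := key ((1 - 2 * c * (b - a)) / 2) (by linarith)
  have hm : min θ₂ θ₀ ∈ Ioc 0 θ₂ := ⟨lt_min hθ₂.1 hθ₀0, min_le_left _ _⟩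
  have h3 := h2 _ hm
  have h01 : θ₀ ∈ Icc (0 : ℝ) 1 := ⟨hθ₀0.le, hθ₀.2⟩
  have h0' : ‖slope q (A θ₀) (B θ₀)‖ = R₀ + 1 := h0
  have h4 := h.norm_slope_sub_le hc (hAmem θ₀ h01).1 (hlt θ₀ hθ₀0) (hBmem θ₀ h01).2
    (by linarith) (hmonoA _ _ (min_le_right θ₂ θ₀)) (hlt _ hm.1)
    (hmonoB _ _ (min_le_right θ₂ θ₀))
  have h5 := norm_le_norm_add_norm_sub (slope q (A (min θ₂ θ₀)) (B (min θ₂ θ₀)))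
    (slope q (A θ₀) (B θ₀))
  have h6 := norm_le_norm_add_norm_sub' (slope q (A (min θ₂ θ₀)) (B (min θ₂ θ₀))) v
  linarith

/-- Slope control and the derivative at one point give differentiability on a short interval. -/
theorem SlopeControl.exists_hasDerivWithinAt [CompleteSpace E] (h : SlopeControl q a b R c)
    (hc : 0 ≤ c) (hab : a < b) (hq : ContinuousOn q (Icc a b)) {t₁ : ℝ} (ht₁ : t₁ ∈ Icc a b)
    {v : E} (hd : HasDerivWithinAt q v (Icc a b) t₁) {R₀ : ℝ} (hv : ‖v‖ ≤ R₀)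
    (hδ : 2 * c * (b - a) < 1) (hR : R₀ + 3 ≤ R) :
    ∃ g : ℝ → E, (∀ t ∈ Icc a b, HasDerivWithinAt q (g t) (Icc a b) t) ∧
      (∀ t ∈ Icc a b, ‖g t‖ ≤ R₀ + 2) ∧ ContinuousOn g (Icc a b) := by
  have hab0 : 0 ≤ c * (b - a) := mul_nonneg hc (by linarith)
  have h0 := h.norm_slope_le hc hab hq ht₁ hd hv hδ (by linarith)
  have h1 : ∀ s t, a ≤ s → s < t → t ≤ b → ‖slope q s t‖ + 2 * c * (t - s) ≤ R := by
    intro s t hs hst ht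
    have k1 := h.norm_slope_sub_le hc le_rfl hab le_rfl (by linarith) hs hst ht
    have k2 := norm_le_norm_add_norm_sub' (slope q s t) (slope q a b)
    have k3 : c * (t - s) ≤ c * (b - a) := mul_le_mul_of_nonneg_left (by linarith) hc
    linarith
  have h2 : ∀ s t, a ≤ s → s < t → t ≤ b → ∀ x ∈ Icc s t, ∀ y ∈ Icc s t, x ≠ y →
      ‖slope q x y - slope q s t‖ ≤ 2 * c * (t - s) := by
    intro s t hs hst ht x hx y hy hxy
    rcases hxy.lt_or_gt with hlt | hlt
    · exact h.norm_slope_sub_le hc hs hst ht (h1 s t hs hst ht) hx.1 hlt hy.2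
    · rw [slope_comm]
      exact h.norm_slope_sub_le hc hs hst ht (h1 s t hs hst ht) hy.1 hlt hx.2
  have hex : ∀ t ∈ Icc a b, ∃ g : E, HasDerivWithinAt q g (Icc a b) t := by
    intro t ht
    have hne : (𝓝[Icc a b \ {t}] t).NeBot :=
      accPt_principal_iff_nhdsWithin.1 ((uniqueDiffOn_Icc hab).uniqueDiffWithinAt ht).accPt
    suffices hCauchy : Cauchy (map (slope q t) (𝓝[Icc a b \ {t}] t)) by
      obtain ⟨g, hg⟩ := CompleteSpace.complete hCauchy
      exact ⟨g, hasDerivWithinAt_iff_tendsto_slope.2 hg⟩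
    rw [Metric.cauchy_iff]
    refine ⟨hne.map _, fun ε hε ↦ ?_⟩
    -- Two slopes from `t` inside a window of length at most `2 * η` are each within `4 * c * η` of
    -- the slope of the window, hence within `8 * c * η < ε` of each other.
    set η := ε / (8 * c + 1) with hη
    have hη0 : 0 < η := by positivity
    refine ⟨slope q t '' ((Icc a b \ {t}) ∩ Metric.ball t η),
      image_mem_map (inter_mem self_mem_nhdsWithin
        (mem_nhdsWithin_of_mem_nhds (Metric.ball_mem_nhds _ hη0))), ?_⟩
    rintro _ ⟨x, ⟨⟨hx, hxt⟩, hxη⟩, rfl⟩ _ ⟨y, ⟨⟨hy, hyt⟩, hyη⟩, rfl⟩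
    rw [Metric.mem_ball, Real.dist_eq, abs_lt] at hxη hyη
    set s' := max a (t - η) with hs'
    set t' := min b (t + η) with ht'
    have e1 : a ≤ s' := le_max_left _ _
    have e2 : t' ≤ b := min_le_left _ _
    have e3 : t - η ≤ s' := le_max_right _ _
    have e4 : t' ≤ t + η := min_le_right _ _
    have e5 : s' < t' := max_lt (lt_min hab (by linarith [ht.1])) (lt_min (by linarith [ht.2])
      (by linarith))
    have m : ∀ z ∈ Icc a b, -η < z - t → z - t < η → z ∈ Icc s' t' := fun z hz k1 k2 ↦
      ⟨max_le hz.1 (by linarith), le_min hz.2 (by linarith)⟩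
    have mt := m t ht (by linarith) (by linarith)
    have k1 := h2 s' t' e1 e5 e2 t mt x (m x hx hxη.1 hxη.2) (fun h ↦ hxt h.symm)
    have k2 := h2 s' t' e1 e5 e2 t mt y (m y hy hyη.1 hyη.2) (fun h ↦ hyt h.symm)
    rw [dist_eq_norm]
    have k3 := norm_sub_le_norm_sub_add_norm_sub (slope q t x) (slope q s' t') (slope q t y)
    rw [norm_sub_rev (slope q s' t')] at k3
    have k4 : c * (t' - s') ≤ c * (2 * η) := mul_le_mul_of_nonneg_left (by linarith) hc
    have k5 : (8 * c + 1) * η = ε := mul_div_cancel₀ _ (by positivity)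
    linarith
  choose! g hg using hex
  have h3 : ∀ s t, a ≤ s → s < t → t ≤ b → ∀ x ∈ Icc s t,
      ‖g x - slope q s t‖ ≤ 2 * c * (t - s) := by
    intro s t hs hst ht x hx
    have hgx := (hg x ⟨hs.trans hx.1, hx.2.trans ht⟩).mono (Icc_subset_Icc hs ht)
    have hne : (𝓝[Icc s t \ {x}] x).NeBot :=
      accPt_principal_iff_nhdsWithin.1 ((uniqueDiffOn_Icc hst).uniqueDiffWithinAt hx).accPt
    refine le_of_tendsto ((hasDerivWithinAt_iff_tendsto_slope.1 hgx).sub_const _).norm ?_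
    filter_upwards [self_mem_nhdsWithin] with y hy
    exact h2 s t hs hst ht x hx y hy.1 (fun h ↦ hy.2 h.symm)
  refine ⟨g, hg, fun t ht ↦ ?_, ?_⟩
  · have k1 := h3 a b le_rfl hab le_rfl t ht
    have k2 := norm_le_norm_add_norm_sub' (g t) (slope q a b)
    linarith
  · have hl : LipschitzOnWith (4 * c).toNNReal g (Icc a b) := by
      have hwlog : ∀ x ∈ Icc a b, ∀ y ∈ Icc a b, x < y → ‖g x - g y‖ ≤ 4 * c * (y - x) := by
        intro x hx y hy hxy
        have k1 := h3 x y hx.1 hxy hy.2 x ⟨le_rfl, hxy.le⟩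
        have k2 := h3 x y hx.1 hxy hy.2 y ⟨hxy.le, le_rfl⟩
        have k3 := norm_sub_le_norm_sub_add_norm_sub (g x) (slope q x y) (g y)
        rw [norm_sub_rev (slope q x y)] at k3
        linarith
      refine LipschitzOnWith.of_dist_le_mul fun x hx y hy ↦ ?_
      rw [Real.coe_toNNReal _ (by positivity), dist_eq_norm, Real.dist_eq]
      rcases lt_trichotomy x y with hlt | rfl | hlt
      · rw [abs_sub_comm, abs_of_pos (by linarith)]
        exact hwlog x hx y hy hlt
      · simp
      · rw [norm_sub_rev, abs_of_pos (by linarith)]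
        exact hwlog y hy x hx hlt
    exact hl.continuousOn

end Slopes

end Lagrangian



/-! ### The first variation of a `C¹` minimizer and the du Bois-Reymond lemma -/

namespace Lagrangian

section EulerLagrange

variable {n : ℕ}

local notation "𝔼" => EuclideanSpace ℝ (Fin n)

/-- The difference of the slopes is the mean of `q' - slope q s t` over `[s', t']`. The excess
bounds its integral by `c * (t - s) ^ 2`, and division by `t' - s' ≥ (t - s) / 2` gives the factor
`2`. -/
theorem slopeControl_of_excess_le {q : ℝ → 𝔼} {a b R c : ℝ}
    (hac : AbsolutelyContinuousOnInterval q a b) (hab : a ≤ b) (hc : 0 ≤ c)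
    (h : ∀ s t, a ≤ s → s < t → t ≤ b → ‖q t - q s‖ ≤ R * (t - s) →
      ∫ τ in Icc s t, ‖deriv q τ - (t - s)⁻¹ • (q t - q s)‖ ≤ c * (t - s) ^ 2) :
    SlopeControl q a b R (2 * c) := by
  intro s t hs hst ht hslope s' t' hs' hst' ht' hl
  have h0 : 0 < t - s := by linarith
  have h0' : 0 < t' - s' := by linarith
  have h1 := h s t hs hst ht (by
    rwa [slope_def_module, norm_smul, norm_inv, Real.norm_of_nonneg h0.le,
      inv_mul_le_iff₀ h0, mul_comm] at hslope)
  have hw : (t - s)⁻¹ • (q t - q s) = slope q s t := (slope_def_module q s t).symm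
  rw [hw] at h1
  have hac' : AbsolutelyContinuousOnInterval q s' t' := hac.mono (by
    rw [uIcc_of_le hab, uIcc_of_le hst'.le]
    exact Icc_subset_Icc (hs.trans hs') (ht'.trans ht))
  have hac'' : AbsolutelyContinuousOnInterval q s t := hac.mono (by
    rw [uIcc_of_le hab, uIcc_of_le hst.le]
    exact Icc_subset_Icc hs ht)
  have hint : IntegrableOn (fun τ ↦ deriv q τ - slope q s t) (Icc s t) := by
    have := hac''.intervalIntegrable_deriv_euclidean
    rw [intervalIntegrable_iff_integrableOn_Icc_of_le hst.le] at this
    exact Integrable.sub this (integrable_const _)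
  have h2 : slope q s' t' - slope q s t =
      (t' - s')⁻¹ • ∫ τ in s'..t', (deriv q τ - slope q s t) := by
    rw [intervalIntegral.integral_sub hac'.intervalIntegrable_deriv_euclidean (by simp),
      hac'.integral_deriv_euclidean, intervalIntegral.integral_const, smul_sub,
      inv_smul_smul₀ h0'.ne', slope_def_module q s' t']
  rw [h2, norm_smul, norm_inv, Real.norm_of_nonneg h0'.le, inv_mul_le_iff₀ h0']
  have h3 : ‖∫ τ in s'..t', (deriv q τ - slope q s t)‖ ≤ c * (t - s) ^ 2 := by
    refine ((intervalIntegral.norm_integral_le_integral_norm hst'.le).trans ?_).trans h1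
    rw [intervalIntegral.integral_of_le hst'.le]
    exact setIntegral_mono_set hint.norm (Eventually.of_forall fun _ ↦ norm_nonneg _)
      (LE.le.eventuallyLE (Ioc_subset_Icc_self.trans (Icc_subset_Icc hs' ht')))
  refine h3.trans ?_
  have : c * (t - s) * (t - s) ≤ c * (t - s) * (2 * (t' - s')) :=
    mul_le_mul_of_nonneg_left (by linarith) (by positivity)
  nlinarith

/-- The momentum `∂F/∂u`. -/
noncomputable def momentum (F : 𝔼 × 𝔼 × ℝ → ℝ) (z : 𝔼 × 𝔼 × ℝ) : 𝔼 →L[ℝ] ℝ :=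
  (fderiv ℝ F z).comp ((ContinuousLinearMap.inr ℝ 𝔼 (𝔼 × ℝ)).comp
    (ContinuousLinearMap.inl ℝ 𝔼 ℝ))

/-- The force `∂F/∂q`. -/
noncomputable def force (F : 𝔼 × 𝔼 × ℝ → ℝ) (z : 𝔼 × 𝔼 × ℝ) : 𝔼 →L[ℝ] ℝ :=
  (fderiv ℝ F z).comp (ContinuousLinearMap.inl ℝ 𝔼 (𝔼 × ℝ))

theorem momentum_apply (F : 𝔼 × 𝔼 × ℝ → ℝ) (z : 𝔼 × 𝔼 × ℝ) (e : 𝔼) :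
    momentum F z e = fderiv ℝ F z (0, e, 0) := by simp [momentum]

theorem force_apply (F : 𝔼 × 𝔼 × ℝ → ℝ) (z : 𝔼 × 𝔼 × ℝ) (e : 𝔼) :
    force F z e = fderiv ℝ F z (e, 0, 0) := by
  simp [force]
  rfl

theorem norm_momentum_sub_le (F : 𝔼 × 𝔼 × ℝ → ℝ) (z z' : 𝔼 × 𝔼 × ℝ) :
    ‖momentum F z - momentum F z'‖ ≤ ‖fderiv ℝ F z - fderiv ℝ F z'‖ := by
  refine ContinuousLinearMap.opNorm_le_bound _ (norm_nonneg _) fun e ↦ ?_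
  rw [sub_apply, momentum_apply, momentum_apply, ← sub_apply]
  refine (ContinuousLinearMap.le_opNorm _ _).trans_eq ?_
  simp [Prod.norm_def]

theorem norm_force_sub_le (F : 𝔼 × 𝔼 × ℝ → ℝ) (z z' : 𝔼 × 𝔼 × ℝ) :
    ‖force F z - force F z'‖ ≤ ‖fderiv ℝ F z - fderiv ℝ F z'‖ := by
  refine ContinuousLinearMap.opNorm_le_bound _ (norm_nonneg _) fun e ↦ ?_
  rw [sub_apply, force_apply, force_apply, ← sub_apply]
  refine (ContinuousLinearMap.le_opNorm _ _).trans_eq ?_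
  simp [Prod.norm_def]

variable {F : EuclideanSpace ℝ (Fin n) × EuclideanSpace ℝ (Fin n) × ℝ → ℝ}
  {U : Set (EuclideanSpace ℝ (Fin n))} {C : ℝ}

theorem IsTonelliOn.continuousOn_fderiv_comp (hF : IsTonelliOn F U C) {q g : ℝ → 𝔼} {s : Set ℝ}
    (hq : ContinuousOn q s) (hg : ContinuousOn g s) (hqU : MapsTo q s U) :
    ContinuousOn (fun t ↦ fderiv ℝ F (q t, g t, t)) s :=
  hF.continuousOn_fderiv.comp (t := U ×ˢ univ) (by fun_prop) fun t ht ↦ ⟨hqU ht, mem_univ _⟩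

theorem IsTonelliOn.continuousOn_comp (hF : IsTonelliOn F U C) {q g : ℝ → 𝔼} {s : Set ℝ}
    (hq : ContinuousOn q s) (hg : ContinuousOn g s) (hqU : MapsTo q s U) :
    ContinuousOn (fun t ↦ F (q t, g t, t)) s :=
  hF.contDiffOn.continuousOn.comp (t := U ×ˢ univ) (by fun_prop) fun t ht ↦ ⟨hqU ht, mem_univ _⟩

theorem IsTonelliOn.continuousOn_momentum (hF : IsTonelliOn F U C) {q g : ℝ → 𝔼} {s : Set ℝ}
    (hq : ContinuousOn q s) (hg : ContinuousOn g s) (hqU : MapsTo q s U) :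
    ContinuousOn (fun t ↦ momentum F (q t, g t, t)) s :=
  (hF.continuousOn_fderiv_comp hq hg hqU).clm_comp continuousOn_const

theorem IsTonelliOn.continuousOn_force (hF : IsTonelliOn F U C) {q g : ℝ → 𝔼} {s : Set ℝ}
    (hq : ContinuousOn q s) (hg : ContinuousOn g s) (hqU : MapsTo q s U) :
    ContinuousOn (fun t ↦ force F (q t, g t, t)) s :=
  (hF.continuousOn_fderiv_comp hq hg hqU).clm_comp continuousOn_const

/-- The **du Bois-Reymond lemma** in the form needed for the Euler-Lagrange equation. -/
theorem duBoisReymond {a b : ℝ} (hab : a < b) {f G : ℝ → ℝ} (hf : Continuous f)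
    (hG : Continuous G) (h : ∀ ψ ψ' : ℝ → ℝ, (∀ t, HasDerivAt ψ (ψ' t) t) → Continuous ψ' →
      ψ a = 0 → ψ b = 0 → ∫ t in a..b, (f t * ψ t + G t * ψ' t) = 0) :
    ∀ t ∈ Icc a b, HasDerivWithinAt G (f t) (Icc a b) t := by
  set P : ℝ → ℝ := fun t ↦ ∫ τ in a..t, f τ with hP
  have hPd : ∀ t, HasDerivAt P (f t) t := fun t ↦ hf.integral_hasStrictDerivAt a t |>.hasDerivAt
  have hPc : Continuous P := continuous_iff_continuousAt.2 fun t ↦ (hPd t).continuousAt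
  -- The mean of `G - P`: subtracting it makes the primitive `ψ` of `H` vanish at both ends, hence
  -- admissible. Testing with `ψ` yields `∫ H² = 0`.
  set k := (b - a)⁻¹ * ∫ τ in a..b, (G τ - P τ) with hk
  set H : ℝ → ℝ := fun t ↦ G t - P t - k with hH
  have hHc : Continuous H := by simp only [hH]; fun_prop
  set ψ : ℝ → ℝ := fun t ↦ ∫ τ in a..t, H τ with hψ
  have hψd : ∀ t, HasDerivAt ψ (H t) t := fun t ↦ hHc.integral_hasStrictDerivAt a t |>.hasDerivAt
  have hψa : ψ a = 0 := by simp [hψ]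
  have hψb : ψ b = 0 := by
    simp only [hψ, hH]
    have i1 : IntervalIntegrable (fun t ↦ G t - P t) volume a b :=
      (hG.sub hPc).intervalIntegrable _ _
    rw [intervalIntegral.integral_sub i1 intervalIntegrable_const,
      intervalIntegral.integral_const, hk, smul_eq_mul, mul_inv_cancel_left₀ (by linarith),
      sub_self]
  have hψc : Continuous ψ := continuous_iff_continuousAt.2 fun t ↦ (hψd t).continuousAt
  have h1 := h ψ H hψd hHc hψa hψb
  have h2 : ∫ t in a..b, (f t * ψ t + P t * H t) = P b * ψ b - P a * ψ a :=
    intervalIntegral.integral_eq_sub_of_hasDerivAt (fun t _ ↦ (hPd t).mul (hψd t))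
      (Continuous.intervalIntegrable (by fun_prop) _ _)
  have h3 : ∫ t in a..b, H t * H t = 0 := by
    have h4 : ∀ t, H t * H t = (f t * ψ t + G t * H t) - (f t * ψ t + P t * H t) - k * H t :=
      fun t ↦ by simp only [hH]; ring
    simp only [h4]
    rw [intervalIntegral.integral_sub, intervalIntegral.integral_sub, h1, h2, hψa, hψb,
      intervalIntegral.integral_const_mul]
    · change 0 - (P b * 0 - P a * 0) - k * ψ b = 0
      rw [hψb]; ring
    all_goals exact Continuous.intervalIntegrable (by fun_prop) _ _
  have h5 : ∀ t ∈ Icc a b, H t = 0 := by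
    intro t ht
    by_contra hne
    have : 0 < ∫ t in a..b, H t * H t :=
      intervalIntegral.integral_pos hab (by fun_prop) (fun x _ ↦ mul_self_nonneg _)
        ⟨t, ht, mul_self_pos.2 hne⟩
    linarith
  intro t ht
  refine HasDerivWithinAt.congr (((hPd t).hasDerivWithinAt).add_const k) (fun x hx ↦ ?_) ?_
  · have := h5 x hx; simp only [hH] at this; linarith
  · have := h5 t ht; simp only [hH] at this; linarith

/-- Minimality against `q + ε φ` gives `0 ≤ ε J + O(ε²)` for both signs of `ε`. The remainder is
quadratic because the derivative of `F` is Lipschitz on compact sets; the gap between radius `r / 2`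
and `r` leaves room for the variation. -/
theorem IsTonelliOn.integral_variation_eq_zero (hF : IsTonelliOn F U C) {x₀ : 𝔼} {r : ℝ}
    (hr0 : 0 < r) (hr : Metric.closedBall x₀ r ⊆ U) {q g : ℝ → 𝔼} {a b : ℝ} (hab : a < b)
    (hq : MapsTo q (Icc a b) (Metric.closedBall x₀ (r / 2)))
    (hd : ∀ t ∈ Icc a b, HasDerivWithinAt q (g t) (Icc a b) t) (hg : ContinuousOn g (Icc a b))
    (hmin : IsMinimizerIn F (Metric.closedBall x₀ r) q a b) {φ φ' : ℝ → 𝔼}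
    (hφ : ∀ t, HasDerivAt φ (φ' t) t) (hφ' : Continuous φ') (ha : φ a = 0) (hb : φ b = 0) :
    ∫ t in a..b, (force F (q t, g t, t) (φ t) + momentum F (q t, g t, t) (φ' t)) = 0 := by
  have hqc : ContinuousOn q (Icc a b) := fun t ht ↦ (hd t ht).continuousWithinAt
  have hφc : Continuous φ := continuous_iff_continuousAt.2 fun t ↦ (hφ t).continuousAt
  have hqU : MapsTo q (Icc a b) U := fun t ht ↦
    hr (Metric.closedBall_subset_closedBall (by linarith) (hq ht))
  obtain ⟨N, hN⟩ := isCompact_Icc.exists_bound_of_continuousOn (hφc.continuousOn (s := Icc a b))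
  obtain ⟨N', hN'⟩ := isCompact_Icc.exists_bound_of_continuousOn (hφ'.continuousOn (s := Icc a b))
  obtain ⟨Ng, hNg⟩ := isCompact_Icc.exists_bound_of_continuousOn hg
  have ham : a ∈ Icc a b := ⟨le_rfl, hab.le⟩
  have hN0 : 0 ≤ N := (norm_nonneg _).trans (hN a ham)
  have hN'0 : 0 ≤ N' := (norm_nonneg _).trans (hN' a ham)
  obtain ⟨c, hc1, -, -, -, hcD⟩ :=
    hF.exists_lipschitz_bound (isCompact_closedBall x₀ r) hr (Ng + N') a b
  set ℓ : ℝ → ℝ := fun t ↦ force F (q t, g t, t) (φ t) + momentum F (q t, g t, t) (φ' t) with hℓ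
  have hℓc : ContinuousOn ℓ (Icc a b) :=
    ((hF.continuousOn_force hqc hg hqU).clm_apply hφc.continuousOn).add
      ((hF.continuousOn_momentum hqc hg hqU).clm_apply hφ'.continuousOn)
  set ε₀ := min 1 (r / (2 * (N + 1))) with hε₀
  have hε₀0 : 0 < ε₀ := by positivity
  set k := c * (N + N') * (N + N') with hk
  have hk0 : 0 ≤ k := by positivity
  have key : ∀ ε : ℝ, |ε| ≤ ε₀ → 0 ≤ ε * (∫ t in a..b, ℓ t) + k * ε ^ 2 * (b - a) := by
    intro ε hε
    have hε1 : |ε| ≤ 1 := hε.trans (min_le_left _ _)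
    set β : ℝ → 𝔼 := fun t ↦ q t + ε • φ t with hβ
    have hβd : ∀ t ∈ Icc a b, HasDerivWithinAt β (g t + ε • φ' t) (Icc a b) t := fun t ht ↦
      (hd t ht).add ((hφ t).hasDerivWithinAt.const_smul ε)
    have hβdw : ∀ t ∈ Icc a b, derivWithin β (Icc a b) t = g t + ε • φ' t := fun t ht ↦
      (hβd t ht).derivWithin (uniqueDiffOn_Icc hab t ht)
    have hβ'c : ContinuousOn (fun t ↦ g t + ε • φ' t) (Icc a b) := by fun_prop
    have hβc : ContDiffOn ℝ 1 β (Icc a b) := by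
      rw [contDiffOn_one_iff_derivWithin (uniqueDiffOn_Icc hab)]
      exact ⟨fun t ht ↦ (hβd t ht).differentiableWithinAt, hβ'c.congr hβdw⟩
    have hεφ : ∀ t ∈ Icc a b, ‖ε • φ t‖ ≤ r / 2 := fun t ht ↦ by
      rw [norm_smul, Real.norm_eq_abs]
      have h1 : |ε| ≤ r / (2 * (N + 1)) := hε.trans (min_le_right _ _)
      rw [le_div_iff₀ (by positivity)] at h1
      have h2 := mul_le_mul_of_nonneg_left (hN t ht) (abs_nonneg ε)
      have := abs_nonneg ε
      linarith
    have hsegball : ∀ t ∈ Icc a b, ∀ θ ∈ Icc (0 : ℝ) 1,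
        q t + θ • ε • φ t ∈ Metric.closedBall x₀ r := fun t ht θ hθ ↦ by
      have h1 := hq ht
      have h2 := hεφ t ht
      rw [mem_closedBall_iff_norm] at h1 ⊢
      have h3 : ‖θ • ε • φ t‖ ≤ ‖ε • φ t‖ := by
        rw [norm_smul, Real.norm_of_nonneg hθ.1]
        exact mul_le_of_le_one_left (norm_nonneg _) hθ.2
      have h4 : q t + θ • ε • φ t - x₀ = (q t - x₀) + θ • ε • φ t := by abel
      rw [h4]
      exact (norm_add_le _ _).trans (by linarith)
    have hβK : MapsTo β (Icc a b) (Metric.closedBall x₀ r) := fun t ht ↦ by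
      simpa using hsegball t ht 1 ⟨zero_le_one, le_rfl⟩
    have hle := hmin β hβc hβK (by simp [hβ, ha]) (by simp [hβ, hb])
    have hβU : MapsTo β (Icc a b) U := fun t ht ↦ hr (hβK ht)
    have hi1 : IntegrableOn (fun t ↦ F (q t, g t, t)) (Icc a b) :=
      (hF.continuousOn_comp hqc hg hqU).integrableOn_Icc
    have hi2 : IntegrableOn (fun t ↦ F (β t, g t + ε • φ' t, t)) (Icc a b) :=
      (hF.continuousOn_comp hβc.continuousOn hβ'c hβU).integrableOn_Icc
    have hpos : ∀ x u t, x ∈ U → 0 ≤ F (x, u, t) := fun x u t hx ↦ by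
      have := hF.growth_pos
      exact (by positivity : 0 ≤ C * ‖u‖ ^ 2).trans (hF.growth x hx u t)
    have hle2 : ∫ t in Icc a b, F (q t, g t, t) ≤ ∫ t in Icc a b, F (β t, g t + ε • φ' t, t) := by
      rw [← ENNReal.ofReal_le_ofReal_iff
        (setIntegral_nonneg measurableSet_Icc fun t ht ↦ hpos _ _ _ (hβU ht)),
        ofReal_integral_eq_lintegral_ofReal hi1, ofReal_integral_eq_lintegral_ofReal hi2]
      · refine le_of_eq_of_le ?_ (hle.trans_eq ?_)
        · refine setLIntegral_congr (Ioo_ae_eq_Icc).symm |>.trans ?_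
          refine Eq.trans ?_ (setLIntegral_congr (Ioo_ae_eq_Icc))
          refine setLIntegral_congr_fun measurableSet_Ioo fun t ht ↦ ?_
          beta_reduce
          rw [((hd t (Ioo_subset_Icc_self ht)).hasDerivAt (Icc_mem_nhds ht.1 ht.2)).deriv]
        · refine setLIntegral_congr_fun measurableSet_Icc fun t ht ↦ ?_
          beta_reduce
          rw [hβdw t ht]
      · filter_upwards [ae_restrict_mem measurableSet_Icc] with t ht using hpos _ _ _ (hβU ht)
      · filter_upwards [ae_restrict_mem measurableSet_Icc] with t ht using hpos _ _ _ (hqU ht)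
    have htaylor : ∀ t ∈ Icc a b,
        F (β t, g t + ε • φ' t, t) ≤ F (q t, g t, t) + ε * ℓ t + k * ε ^ 2 := by
      intro t ht
      set z : 𝔼 × 𝔼 × ℝ := (q t, g t, t) with hz
      set d : 𝔼 × 𝔼 × ℝ := (ε • φ t, ε • φ' t, 0) with hdd
      have hzd : ((β t, g t + ε • φ' t, t) : 𝔼 × 𝔼 × ℝ) = z + d := by simp [hz, hdd, hβ]
      have hdn : ‖d‖ ≤ |ε| * (N + N') := by
        simp only [hdd, Prod.norm_def, norm_smul, Real.norm_eq_abs, abs_zero]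
        have e1 := mul_le_mul_of_nonneg_left (hN t ht) (abs_nonneg ε)
        have e2 := mul_le_mul_of_nonneg_left (hN' t ht) (abs_nonneg ε)
        have e3 := mul_nonneg (abs_nonneg ε) hN0
        have e4 := mul_nonneg (abs_nonneg ε) hN'0
        refine max_le (by linarith) (max_le (by linarith) (by linarith))
      have hseg : ∀ y ∈ segment ℝ z (z + d), ∃ θ ∈ Icc (0 : ℝ) 1, y = z + θ • d := fun y hy ↦ by
        rw [segment_eq_image'] at hy
        obtain ⟨θ, hθ, rfl⟩ := hy
        exact ⟨θ, hθ, by simp⟩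
      have hgm : ∀ θ ∈ Icc (0 : ℝ) 1, g t + θ • ε • φ' t ∈ Metric.closedBall (0 : 𝔼) (Ng + N') :=
        fun θ hθ ↦ by
        rw [mem_closedBall_zero_iff, smul_smul]
        refine (norm_add_le _ _).trans (add_le_add (hNg t ht) ?_)
        rw [norm_smul, Real.norm_eq_abs, abs_mul, abs_of_nonneg hθ.1]
        refine (mul_le_of_le_one_left (norm_nonneg _) ?_).trans (hN' t ht)
        exact mul_le_one₀ hθ.2 (abs_nonneg _) hε1
      have h1 := (convex_segment z (z + d)).norm_image_sub_le_of_norm_hasFDerivWithin_le'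
        (f := F) (f' := fderiv ℝ F) (φ := fderiv ℝ F z) (C := c * (|ε| * (N + N'))) (x := z)
        (y := z + d) (fun y hy ↦ by
          obtain ⟨θ, hθ, rfl⟩ := hseg y hy
          exact (hF.hasFDerivAt (hr (hsegball t ht θ hθ)) _ _).hasFDerivWithinAt) (fun y hy ↦ by
          obtain ⟨θ, hθ, rfl⟩ := hseg y hy
          have h2 := hcD _ (hsegball t ht θ hθ) _ (hgm θ hθ) t ht (q t)
            (by simpa using hsegball t ht 0 ⟨le_rfl, zero_le_one⟩) (g t)
            (by simpa using hgm 0 ⟨le_rfl, zero_le_one⟩) t ht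
          have h3 : z + θ • d = (q t + θ • ε • φ t, g t + θ • ε • φ' t, t) := by
            simp [hz, hdd]
          rw [h3]
          refine h2.trans (mul_le_mul_of_nonneg_left ?_ (by linarith))
          rw [add_sub_cancel_left, add_sub_cancel_left, sub_self, abs_zero, add_zero, norm_smul,
            norm_smul, norm_smul, norm_smul, Real.norm_of_nonneg hθ.1, Real.norm_eq_abs, ← mul_add,
            ← mul_add]
          refine (mul_le_of_le_one_left (by positivity) hθ.2).trans ?_
          exact mul_le_mul_of_nonneg_left (add_le_add (hN t ht) (hN' t ht)) (abs_nonneg _))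
        (left_mem_segment _ _ _) (right_mem_segment _ _ _)
      rw [add_sub_cancel_left] at h1
      have h4 : fderiv ℝ F z d = ε * ℓ t := by
        simp only [hℓ, force_apply, momentum_apply]
        rw [← map_add, ← smul_eq_mul, ← map_smul]
        congr 1
        simp [hdd]
      rw [h4] at h1
      rw [hzd]
      have h5 : c * (|ε| * (N + N')) * ‖d‖ ≤ c * (|ε| * (N + N')) * (|ε| * (N + N')) :=
        mul_le_mul_of_nonneg_left hdn (by positivity)
      have h6 : c * (|ε| * (N + N')) * (|ε| * (N + N')) = k * ε ^ 2 := by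
        rw [hk, ← sq_abs ε]; ring
      have h7 := (Real.le_norm_self _).trans h1
      linarith
    have hiℓ : IntegrableOn ℓ (Icc a b) := hℓc.integrableOn_Icc
    have h8 : ∫ t in Icc a b, F (β t, g t + ε • φ' t, t) ≤
        ∫ t in Icc a b, (F (q t, g t, t) + ε * ℓ t + k * ε ^ 2) :=
      setIntegral_mono_on hi2 ((Integrable.add hi1 (hiℓ.const_mul ε)).add (integrable_const _))
        measurableSet_Icc htaylor
    have j1 : IntegrableOn (fun t ↦ F (q t, g t, t) + ε * ℓ t) (Icc a b) :=
      Integrable.add hi1 (hiℓ.const_mul ε)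
    rw [integral_add j1 (integrable_const _), integral_add hi1 (hiℓ.const_mul ε),
      integral_const_mul, integral_const] at h8
    rw [intervalIntegral.integral_of_le hab.le, ← integral_Icc_eq_integral_Ioc]
    have h9 : (volume.restrict (Icc a b)).real univ = b - a := by simp [hab.le]
    rw [h9, smul_eq_mul] at h8
    linarith
  set J := ∫ t in a..b, ℓ t with hJ
  by_contra hne
  have hJ0 : 0 < |J| := abs_pos.2 hne
  have hba : 0 < b - a := by linarith
  -- With `ε = -sign J * θ`, the linear term `-θ * |J|` is at least twice `(k * (b - a) + 1) * θ ^
  -- 2` in size, so it dominates the quadratic remainder.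
  set θ := min ε₀ (|J| / (2 * (k * (b - a) + 1))) with hθ
  have hθ0 : 0 < θ := by positivity
  have hθJ : θ * (2 * (k * (b - a) + 1)) ≤ |J| := by
    rw [← le_div_iff₀ (by positivity)]; exact min_le_right _ _
  have k1 := key (-(SignType.sign J : ℝ) * θ) (by
    rw [abs_mul, abs_neg, abs_of_pos hθ0]
    rcases lt_or_gt_of_ne hne with h | h
    · rw [show SignType.sign J = -1 from sign_neg h]; simp [hθ]
    · rw [show SignType.sign J = 1 from sign_pos h]; simp [hθ])
  have k2 : -(SignType.sign J : ℝ) * θ * J = -(θ * |J|) := by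
    rw [← sign_mul_self J]; ring
  have k3 : (-(SignType.sign J : ℝ) * θ) ^ 2 = θ ^ 2 := by
    rw [mul_pow]
    rcases lt_or_gt_of_ne hne with h | h
    · rw [show SignType.sign J = -1 from sign_neg h]; simp
    · rw [show SignType.sign J = 1 from sign_pos h]; simp
  rw [k2, k3] at k1
  have k4 : θ * (θ * (2 * (k * (b - a) + 1))) ≤ θ * |J| := mul_le_mul_of_nonneg_left hθJ hθ0.le
  have k5 : 0 ≤ k * (b - a) * θ ^ 2 := by positivity
  have k6 : 0 < θ ^ 2 := by positivity
  nlinarith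

end EulerLagrange

end Lagrangian



/-! ### Propagation of `C¹`-closeness between a minimizer and a solution, in a chart -/

namespace Lagrangian

section Propagation

variable {n : ℕ}

local notation "𝔼" => EuclideanSpace ℝ (Fin n)

variable {F : EuclideanSpace ℝ (Fin n) × EuclideanSpace ℝ (Fin n) × ℝ → ℝ}
  {U : Set (EuclideanSpace ℝ (Fin n))} {C : ℝ}

/-- A `C¹` minimizer satisfies the Euler-Lagrange equation. -/
theorem IsTonelliOn.hasDerivWithinAt_momentum (hF : IsTonelliOn F U C) {x₀ : 𝔼} {r : ℝ}
    (hr0 : 0 < r) (hr : Metric.closedBall x₀ r ⊆ U) {q g : ℝ → 𝔼} {a b : ℝ} (hab : a < b)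
    (hq : MapsTo q (Icc a b) (Metric.closedBall x₀ (r / 2)))
    (hd : ∀ t ∈ Icc a b, HasDerivWithinAt q (g t) (Icc a b) t) (hg : ContinuousOn g (Icc a b))
    (hmin : IsMinimizerIn F (Metric.closedBall x₀ r) q a b) (e : 𝔼) :
    ∀ t ∈ Icc a b, HasDerivWithinAt (fun s ↦ momentum F (q s, g s, s) e)
      (force F (q t, g t, t) e) (Icc a b) t := by
  have hqc : ContinuousOn q (Icc a b) := fun t ht ↦ (hd t ht).continuousWithinAt
  have hqU : MapsTo q (Icc a b) U := fun t ht ↦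
    hr (Metric.closedBall_subset_closedBall (by linarith) (hq ht))
  have hfc : ContinuousOn (fun s ↦ force F (q s, g s, s) e) (Icc a b) :=
    (hF.continuousOn_force hqc hg hqU).clm_apply continuousOn_const
  have hGc : ContinuousOn (fun s ↦ momentum F (q s, g s, s) e) (Icc a b) :=
    (hF.continuousOn_momentum hqc hg hqU).clm_apply continuousOn_const
  set f := IccExtend hab.le ((Icc a b).domRestrict fun s ↦ force F (q s, g s, s) e) with hf
  set G := IccExtend hab.le ((Icc a b).domRestrict fun s ↦ momentum F (q s, g s, s) e) with hG
  have hfe : ∀ t ∈ Icc a b, f t = force F (q t, g t, t) e := fun t ht ↦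
    IccExtend_of_mem _ _ ht
  have hGe : ∀ t ∈ Icc a b, G t = momentum F (q t, g t, t) e := fun t ht ↦
    IccExtend_of_mem _ _ ht
  have key := duBoisReymond hab (f := f) (G := G) hfc.domRestrict.Icc_extend'
    hGc.domRestrict.Icc_extend' (fun ψ ψ' hψ hψ' ha hb ↦ by
      have h1 := hF.integral_variation_eq_zero hr0 hr hab hq hd hg hmin
        (φ := fun t ↦ ψ t • e) (φ' := fun t ↦ ψ' t • e) (fun t ↦ (hψ t).smul_const e)
        (by fun_prop) (by simp [ha]) (by simp [hb])
      rw [← h1]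
      refine intervalIntegral.integral_congr fun t ht ↦ ?_
      rw [uIcc_of_le hab.le] at ht
      simp only [hfe t ht, hGe t ht, map_smul, smul_eq_mul]
      ring)
  intro t ht
  have := key t ht
  rw [hfe t ht] at this
  exact this.congr (fun x hx ↦ (hGe x hx).symm) (hGe t ht).symm

/-- The Legendre transform has a Lipschitz inverse on bounded sets: adding the two uniform convexity
inequalities shows that the momentum is strongly monotone in the velocity, and moving the base point
costs `c * ‖q - q'‖`. So velocities can be estimated from positions and momenta, the quantities with
controlled time derivative. -/
theorem IsTonelliOn.exists_norm_sub_le (hF : IsTonelliOn F U C) {K : Set 𝔼} (hK : IsCompact K)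
    (hKU : K ⊆ U) (R T₀ T₁ : ℝ) :
    ∃ κ : ℝ, 0 ≤ κ ∧ ∀ q ∈ K, ∀ q' ∈ K, ∀ u ∈ Metric.closedBall (0 : 𝔼) R,
      ∀ u' ∈ Metric.closedBall (0 : 𝔼) R, ∀ t ∈ Icc T₀ T₁,
        ‖u - u'‖ ≤ κ * (‖q - q'‖ + ‖momentum F (q, u, t) - momentum F (q', u', t)‖) := by
  obtain ⟨c, hc1, -, -, -, hcD⟩ := hF.exists_lipschitz_bound hK hKU R T₀ T₁
  obtain ⟨m, hm, hconv⟩ := hF.exists_uniform_convexity hK hKU R T₀ T₁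
  refine ⟨c / (2 * m), by positivity, fun q hq q' hq' u hu u' hu' t ht ↦ ?_⟩
  set V := ‖u - u'‖ with hV
  set Y := ‖momentum F (q, u, t) - momentum F (q', u', t)‖ with hY
  have h1 := hconv q hq u hu t ht u'
  have h2 := hconv q hq u' hu' t ht u
  rw [norm_sub_rev u' u, ← hV] at h1
  rw [← hV] at h2
  rw [← momentum_apply] at h1 h2
  have h3 : 2 * m * V ^ 2 ≤ (momentum F (q, u, t) - momentum F (q, u', t)) (u - u') := by
    rw [sub_apply]
    have : momentum F (q, u, t) (u' - u) = - momentum F (q, u, t) (u - u') := by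
      rw [← map_neg, neg_sub]
    linarith
  have h4 : ‖momentum F (q, u, t) - momentum F (q, u', t)‖ ≤ Y + c * ‖q - q'‖ := by
    have e1 := hcD q' hq' u' hu' t ht q hq u' hu' t ht
    have e2 := norm_momentum_sub_le F (q', u', t) (q, u', t)
    have e3 := norm_sub_le_norm_sub_add_norm_sub (momentum F (q, u, t))
      (momentum F (q', u', t)) (momentum F (q, u', t))
    simp only [sub_self, norm_zero, abs_zero, add_zero] at e1
    rw [norm_sub_rev q'] at e1
    linarith
  have h5 := (Real.le_norm_self _).trans
    ((momentum F (q, u, t) - momentum F (q, u', t)).le_opNorm (u - u'))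
  rw [← hV] at h5
  have hY0 : 0 ≤ Y := norm_nonneg _
  have h6 : 2 * m * V ≤ Y + c * ‖q - q'‖ := by
    rcases (norm_nonneg (u - u')).eq_or_lt with h0 | h0
    · rw [hV, ← h0, mul_zero]
      positivity
    · refine le_of_mul_le_mul_right ?_ h0
      have := mul_le_mul_of_nonneg_right h4 h0.le
      rw [← hV] at this ⊢
      nlinarith
  rw [div_mul_eq_mul_div, le_div_iff₀ (by positivity)]
  have h7 : Y ≤ c * Y := le_mul_of_one_le_left hY0 hc1
  linarith

/-- Propagation of closeness: on short intervals, a minimizer with bounded velocity at one time is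
`C¹` and stays `C¹`-close to a solution of the Euler-Lagrange equation. -/
theorem IsTonelliOn.exists_propagation (hF : IsTonelliOn F U C) {x₀ : 𝔼} {r : ℝ}
    (hr0 : 0 < r) (hr : Metric.closedBall x₀ r ⊆ U) (R₀ T₀ T₁ : ℝ) :
    ∃ δ : ℝ, 0 < δ ∧ ∃ c : ℝ, 0 ≤ c ∧ ∀ (q : ℝ → 𝔼) (a b : ℝ), a < b → b - a ≤ δ → T₀ ≤ a →
      b ≤ T₁ → AbsolutelyContinuousOnInterval q a b →
      MapsTo q (Icc a b) (Metric.closedBall x₀ (r / 2)) →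
      (∀ s t, a ≤ s → s < t → t ≤ b → IsMinimizerIn F (Metric.closedBall x₀ r) q s t) →
      ∀ t₁ ∈ Icc a b, ∀ v, HasDerivWithinAt q v (Icc a b) t₁ → ‖v‖ ≤ R₀ →
      ∀ qη gη : ℝ → 𝔼, (∀ t ∈ Icc a b, HasDerivWithinAt qη (gη t) (Icc a b) t) →
      ContinuousOn gη (Icc a b) → MapsTo qη (Icc a b) (Metric.closedBall x₀ r) →
      (∀ t ∈ Icc a b, ‖gη t‖ ≤ R₀) →
      (∀ e, ∀ t ∈ Icc a b, HasDerivWithinAt (fun s ↦ momentum F (qη s, gη s, s) e)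
        (force F (qη t, gη t, t) e) (Icc a b) t) →
      ∃ g : ℝ → 𝔼, (∀ t ∈ Icc a b, HasDerivWithinAt q (g t) (Icc a b) t) ∧
        ∀ t ∈ Icc a b, ‖q t - qη t‖ + ‖g t - gη t‖ ≤ c * (‖q t₁ - qη t₁‖ + ‖v - gη t₁‖) := by
  set R := |R₀| + 3 with hR
  have hRR : R₀ ≤ |R₀| := le_abs_self _
  obtain ⟨c₁, hc₁, hexc⟩ := hF.excess_le hr R T₀ T₁
  obtain ⟨c, hc1, -, -, -, hcD⟩ :=
    hF.exists_lipschitz_bound (isCompact_closedBall x₀ r) hr R T₀ T₁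
  obtain ⟨κ, hκ, hmono⟩ := hF.exists_norm_sub_le (isCompact_closedBall x₀ r) hr R T₀ T₁
  set A := κ + c * (1 + κ) with hA
  have hA0 : 0 ≤ A := by positivity
  -- The three bounds on the length serve respectively the excess estimate, the slope argument (`2 *
  -- (2 * c₁) * (b - a) < 1`) and the absorption `(b - a) * A ≤ 1 / 2`.
  refine ⟨min 1 (min (1 / (4 * c₁ + 1) / 2) (1 / (2 * (A + 1)))), by positivity,
    (1 + κ) * (2 * (1 + c)), by positivity, ?_⟩
  intro q a b hab hδ hT₀ hT₁ hac hqK hmin t₁ ht₁ v hd hv qη gη hdη hgη hqηK hgηR hEL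
  have hδ1 : b - a ≤ 1 := hδ.trans (min_le_left _ _)
  have hδ2 : 2 * (2 * c₁) * (b - a) < 1 := by
    have h := hδ.trans ((min_le_right _ _).trans (min_le_left _ _))
    have h0 : 0 < 4 * c₁ + 1 := by positivity
    rw [div_div, le_div_iff₀ (by positivity)] at h
    nlinarith
  have hδ3 : (b - a) * A ≤ 1 / 2 := by
    have h := hδ.trans ((min_le_right _ _).trans (min_le_right _ _))
    rw [le_div_iff₀ (by positivity)] at h
    nlinarith
  have hqc : ContinuousOn q (Icc a b) := by simpa [uIcc_of_le hab.le] using hac.continuousOn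
  have hqK' : MapsTo q (Icc a b) (Metric.closedBall x₀ r) := fun t ht ↦
    Metric.closedBall_subset_closedBall (by linarith) (hqK ht)
  have hslope : SlopeControl q a b R (2 * c₁) := by
    refine slopeControl_of_excess_le hac hab.le hc₁ fun s t hs hst ht hsl ↦ ?_
    refine hexc q s t hst (by linarith) (hT₀.trans hs) (ht.trans hT₁) (hac.mono ?_)
      (hqK'.mono_left (Icc_subset_Icc hs ht)) (hmin s t hs hst ht) hsl
    rw [uIcc_of_le hab.le, uIcc_of_le hst.le]
    exact Icc_subset_Icc hs ht
  obtain ⟨g, hg, hgR, hgc⟩ := hslope.exists_hasDerivWithinAt (by positivity) hab hqc ht₁ hd hv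
    hδ2 (by linarith)
  have hgv : g t₁ = v := (uniqueDiffOn_Icc hab t₁ ht₁).eq_deriv _ (hg t₁ ht₁) hd
  refine ⟨g, hg, ?_⟩
  have hELq := hF.hasDerivWithinAt_momentum hr0 hr hab hqK hg hgc (hmin a b le_rfl hab le_rfl)
  have hgB : ∀ t ∈ Icc a b, g t ∈ Metric.closedBall (0 : 𝔼) R := fun t ht ↦ by
    rw [mem_closedBall_zero_iff]; linarith [hgR t ht]
  have hgηB : ∀ t ∈ Icc a b, gη t ∈ Metric.closedBall (0 : 𝔼) R := fun t ht ↦ by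
    rw [mem_closedBall_zero_iff]; linarith [hgηR t ht]
  have hT : ∀ t ∈ Icc a b, t ∈ Icc T₀ T₁ := fun t ht ↦ ⟨hT₀.trans ht.1, ht.2.trans hT₁⟩
  have hqηc : ContinuousOn qη (Icc a b) := fun t ht ↦ (hdη t ht).continuousWithinAt
  set Y : ℝ → 𝔼 →L[ℝ] ℝ := fun t ↦ momentum F (q t, g t, t) - momentum F (qη t, gη t, t) with hY
  have hYc : ContinuousOn Y (Icc a b) :=
    (hF.continuousOn_momentum hqc hgc fun t ht ↦ hr (hqK' ht)).sub
      (hF.continuousOn_momentum hqηc hgη fun t ht ↦ hr (hqηK ht))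
  have hVle : ∀ t ∈ Icc a b, ‖g t - gη t‖ ≤ κ * (‖q t - qη t‖ + ‖Y t‖) := fun t ht ↦
    hmono _ (hqK' ht) _ (hqηK ht) _ (hgB t ht) _ (hgηB t ht) t (hT t ht)
  -- In place of Gronwall: with `S` the maximum of the distance in position plus momentum, both
  -- derivatives are bounded by multiples of `S`. The mean value inequality from `t₁` gives `S ≤
  -- (value at t₁) + (b - a) * A * S`, and the last term is absorbed.
  obtain ⟨t₀, ht₀, hmax⟩ := isCompact_Icc.exists_isMaxOn ⟨a, left_mem_Icc.2 hab.le⟩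
    ((hqc.sub hqηc).norm.add hYc.norm)
  set S := ‖q t₀ - qη t₀‖ + ‖Y t₀‖ with hS
  have hS' : ∀ t ∈ Icc a b, ‖q t - qη t‖ + ‖Y t‖ ≤ S := fun t ht ↦ hmax ht
  have hS0 : 0 ≤ S := by positivity
  have hVS : ∀ t ∈ Icc a b, ‖g t - gη t‖ ≤ κ * S := fun t ht ↦
    (hVle t ht).trans (mul_le_mul_of_nonneg_left (hS' t ht) hκ)
  have hlen : ∀ t ∈ Icc a b, ‖t - t₁‖ ≤ b - a := fun t ht ↦ by
    rw [Real.norm_eq_abs, abs_le]; constructor <;> linarith [ht.1, ht.2, ht₁.1, ht₁.2]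
  have h1 : ‖q t₀ - qη t₀‖ ≤ ‖q t₁ - qη t₁‖ + κ * S * (b - a) := by
    have e1 := (convex_Icc a b).norm_image_sub_le_of_norm_hasDerivWithin_le
      (f := fun t ↦ q t - qη t) (f' := fun t ↦ g t - gη t)
      (fun t ht ↦ (hg t ht).sub (hdη t ht)) hVS ht₁ ht₀
    have e2 := norm_le_norm_add_norm_sub' (q t₀ - qη t₀) (q t₁ - qη t₁)
    have e3 := mul_le_mul_of_nonneg_left (hlen t₀ ht₀) (by positivity : 0 ≤ κ * S)
    linarith
  have h2 : ‖Y t₀‖ ≤ ‖Y t₁‖ + c * (1 + κ) * S * (b - a) := by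
    have e2 := norm_le_norm_add_norm_sub' (Y t₀) (Y t₁)
    have e3 : ‖Y t₀ - Y t₁‖ ≤ c * (1 + κ) * S * (b - a) := by
      have hba : 0 ≤ b - a := by linarith
      refine ContinuousLinearMap.opNorm_le_bound _ (by positivity) fun e ↦ ?_
      have e4 := (convex_Icc a b).norm_image_sub_le_of_norm_hasDerivWithin_le
        (f := fun t ↦ momentum F (q t, g t, t) e - momentum F (qη t, gη t, t) e)
        (f' := fun t ↦ force F (q t, g t, t) e - force F (qη t, gη t, t) e)
        (C := c * ((1 + κ) * S) * ‖e‖)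
        (fun t ht ↦ (hELq e t ht).sub (hEL e t ht)) (fun t ht ↦ by
          have k1 := hcD _ (hqK' ht) _ (hgB t ht) t (hT t ht) _ (hqηK ht) _ (hgηB t ht) t (hT t ht)
          have k2 := norm_force_sub_le F (q t, g t, t) (qη t, gη t, t)
          have k3 := (force F (q t, g t, t) - force F (qη t, gη t, t)).le_opNorm e
          have k4 := hS' t ht
          have k5 := hVS t ht
          have k6 := norm_nonneg (Y t)
          rw [sub_self, abs_zero, add_zero] at k1
          have k7 : c * (‖q t - qη t‖ + ‖g t - gη t‖) ≤ c * ((1 + κ) * S) :=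
            mul_le_mul_of_nonneg_left (by linarith) (by linarith)
          rw [sub_apply] at k3
          exact k3.trans (mul_le_mul_of_nonneg_right (by linarith) (norm_nonneg _))) ht₁ ht₀
      have e5 : (Y t₀ - Y t₁) e = (momentum F (q t₀, g t₀, t₀) e - momentum F (qη t₀, gη t₀, t₀) e)
          - (momentum F (q t₁, g t₁, t₁) e - momentum F (qη t₁, gη t₁, t₁) e) := by
        simp [hY]
      rw [e5]
      refine e4.trans ?_
      have := mul_le_mul_of_nonneg_left (hlen t₀ ht₀)
        (by positivity : 0 ≤ c * ((1 + κ) * S) * ‖e‖)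
      refine this.trans_eq (by ring)
    linarith
  have h3 : S ≤ 2 * (‖q t₁ - qη t₁‖ + ‖Y t₁‖) := by
    have e1 : κ * S * (b - a) + c * (1 + κ) * S * (b - a) = (b - a) * A * S := by
      rw [hA]; ring
    have e2 := mul_le_mul_of_nonneg_right hδ3 hS0
    linarith
  have h4 : ‖Y t₁‖ ≤ c * (‖q t₁ - qη t₁‖ + ‖v - gη t₁‖) := by
    have k1 := hcD _ (hqK' ht₁) _ (hgB t₁ ht₁) t₁ (hT t₁ ht₁) _ (hqηK ht₁) _ (hgηB t₁ ht₁) t₁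
      (hT t₁ ht₁)
    rw [sub_self, abs_zero, add_zero] at k1
    rw [← hgv]
    exact (norm_momentum_sub_le F _ _).trans k1
  intro t ht
  have h5 := hS' t ht
  have h6 := hVS t ht
  have h7 := norm_nonneg (Y t)
  have h8 : S ≤ 2 * (1 + c) * (‖q t₁ - qη t₁‖ + ‖v - gη t₁‖) := by
    have := norm_nonneg (v - gη t₁)
    linarith
  calc ‖q t - qη t‖ + ‖g t - gη t‖ ≤ (1 + κ) * S := by linarith
    _ ≤ (1 + κ) * (2 * (1 + c) * (‖q t₁ - qη t₁‖ + ‖v - gη t₁‖)) :=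
        mul_le_mul_of_nonneg_left h8 (by positivity)
    _ = _ := by ring

end Propagation

end Lagrangian



/-! ### The exchange argument for minimizing chains -/

namespace Lagrangian

section Discrete

/-- A chain `x 0, …, x N` of points that is minimizing for a subadditive potential `H`, with `σ i j`
the action of the part of the chain between `i` and `j`. -/
structure IsMinimizingChain {X : Type*} [MetricSpace X] (H : ℕ → X → X → ℝ≥0∞) (A : ℝ → ℝ) (C : ℝ)
    (N : ℕ) (x : ℕ → X) (σ : ℕ → ℕ → ℝ) : Prop where
  subadd : ∀ k l x y z, H (k + l) x z ≤ H k x y + H l y z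
  le_of_dist_le : ∀ (V : ℝ) (k : ℕ) (x y : X), 0 < k → dist x y ≤ V * k → H k x y ≤ ENNReal.ofReal (A V * k)
  nonneg_bound : ∀ V, 0 ≤ A V
  pos : 0 < C
  nonneg : ∀ i j, 0 ≤ σ i j
  add : ∀ i j k, i ≤ j → j ≤ k → k ≤ N → σ i k = σ i j + σ j k
  min : ENNReal.ofReal (σ 0 N) ≤ H N (x 0) (x N)
  le : ∀ i j, i ≤ j → j ≤ N → H (j - i) (x i) (x j) ≤ ENNReal.ofReal (σ i j)
  dist_sq_le : ∀ i j, i ≤ j → j ≤ N → C * dist (x i) (x j) ^ 2 ≤ (j - i : ℕ) * σ i j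

theorem le_of_sq_le {C Q r : ℝ} (hC : 0 < C) (hQ : 0 ≤ Q) (h : C * r ^ 2 ≤ Q * (r + 2)) :
    r ≤ 2 + 2 * Q / C := by
  by_contra! hr
  have h0 : 0 ≤ 2 * Q / C := by positivity
  have h1 : 2 * Q / C < r := by linarith
  rw [div_lt_iff₀ hC] at h1
  nlinarith

namespace IsMinimizingChain

variable {X : Type*} [MetricSpace X] {H : ℕ → X → X → ℝ≥0∞} {A : ℝ → ℝ} {C : ℝ}
    {N : ℕ} {x : ℕ → X} {σ : ℕ → ℕ → ℝ} (h : IsMinimizingChain H A C N x σ)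
include h

theorem mono {i j k l : ℕ} (hij : i ≤ j) (hjk : j ≤ k) (hkl : k ≤ l) (hl : l ≤ N) :
    σ j k ≤ σ i l := by
  rw [h.add i j l hij (hjk.trans hkl) hl, h.add j k l hjk hkl hl]
  linarith [h.nonneg i j, h.nonneg k l]

/-- Pigeonhole over `q = ⌊(j' - j) / (2 * m)⌋ ≥ 1` consecutive blocks. Since `j' - j < 2 * m * (q +
1) ≤ 4 * m * q`, if all blocks cost more than `12 * B * m` the total would exceed `3 * B * (j' -
j)`. -/
theorem exists_slow_block {j j' m : ℕ} (hm : 0 < m) (hjj : j + 2 * m ≤ j') (hj' : j' ≤ N) {B : ℝ}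
    (hB : 0 ≤ B) (hσ : σ j j' ≤ 3 * B * (j' - j : ℕ)) :
    ∃ e, j ≤ e ∧ e + 2 * m ≤ j' ∧ σ e (e + 2 * m) ≤ 12 * B * m := by
  by_contra! hcon
  set q := (j' - j) / (2 * m) with hq
  have hq1 : 1 ≤ q := (Nat.one_le_div_iff (by positivity)).2 (by omega)
  have hqle : 2 * m * q ≤ j' - j := Nat.mul_div_le _ _
  have hqlt : j' - j < 2 * m * (q + 1) := Nat.lt_mul_div_succ _ (by positivity)
  have hstep : ∀ k, k + 1 ≤ q → σ j (j + 2 * m * (k + 1)) =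
      σ j (j + 2 * m * k) + σ (j + 2 * m * k) (j + 2 * m * k + 2 * m) ∧
      12 * B * m < σ (j + 2 * m * k) (j + 2 * m * k + 2 * m) := by
    intro k hk
    have h1 : 2 * m * (k + 1) ≤ 2 * m * q := Nat.mul_le_mul_left _ hk
    have h2 : 2 * m * (k + 1) = 2 * m * k + 2 * m := by ring
    refine ⟨?_, hcon _ (by omega) (by omega)⟩
    rw [h2, ← add_assoc]
    exact h.add _ _ _ (by omega) (by omega) (by omega)
  have hind : ∀ k, k ≤ q → 12 * B * m * k ≤ σ j (j + 2 * m * k) := by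
    intro k
    induction k with
    | zero => intro _; simpa using h.nonneg j j
    | succ k ih =>
      intro hk
      obtain ⟨h1, h2⟩ := hstep k hk
      have := ih (by omega)
      rw [h1]
      push_cast
      linarith
  obtain ⟨p, hp⟩ : ∃ p, q = p + 1 := ⟨q - 1, by omega⟩
  have h1 := hind p (by omega)
  obtain ⟨h2, h3⟩ := hstep p hp.ge
  have h4 : σ j (j + 2 * m * q) ≤ σ j j' := h.mono le_rfl (by omega) (by omega) hj'
  rw [hp, h2] at h4
  have h5 : ((j' - j : ℕ) : ℝ) ≤ 2 * m * (q + 1) := by exact_mod_cast hqlt.le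
  have h6 : (q : ℝ) = p + 1 := by exact_mod_cast hp
  have h7 : 3 * B * ((j' - j : ℕ) : ℝ) ≤ 3 * B * (2 * m * (q + 1)) :=
    mul_le_mul_of_nonneg_left h5 (by positivity)
  have h8 : 0 ≤ B * m * p := by positivity
  rw [h6] at h7
  nlinarith

/-- The competitor spends `m + 1` units on the step `i` and `m` units on the block of `2 * m` steps,
so its total time is still `N`. All other pieces keep their duration and are merely shifted, and
their action cancels in the comparison. -/
theorem exchange {i e m : ℕ} (hi : i < N) (he : e + 2 * m ≤ N) (hd : e + 2 * m ≤ i ∨ i + 1 ≤ e)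
    {P Q : ℝ} (hP : 0 ≤ P) (hQ : 0 ≤ Q) (h1 : H (m + 1) (x i) (x (i + 1)) ≤ ENNReal.ofReal P)
    (h2 : H m (x e) (x (e + 2 * m)) ≤ ENNReal.ofReal Q) :
    σ i (i + 1) + σ e (e + 2 * m) ≤ P + Q := by
  have key : ∀ a b c d k₁ k₂ : ℕ, ∀ P₁ P₂ : ℝ, 0 ≤ P₁ → 0 ≤ P₂ → a ≤ b → b ≤ c → c ≤ d → d ≤ N →
      H k₁ (x a) (x b) ≤ ENNReal.ofReal P₁ → H k₂ (x c) (x d) ≤ ENNReal.ofReal P₂ →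
      a + (k₁ + ((c - b) + (k₂ + (N - d)))) = N → σ a b + σ c d ≤ P₁ + P₂ := by
    intro a b c d k₁ k₂ P₁ P₂ hP₁ hP₂ hab hbc hcd hdN e1 e2 hsum
    have s1 := h.subadd a (k₁ + ((c - b) + (k₂ + (N - d)))) (x 0) (x a) (x N)
    have s2 := h.subadd k₁ ((c - b) + (k₂ + (N - d))) (x a) (x b) (x N)
    have s3 := h.subadd (c - b) (k₂ + (N - d)) (x b) (x c) (x N)
    have s4 := h.subadd k₂ (N - d) (x c) (x d) (x N)
    rw [hsum] at s1
    have l1 := h.le 0 a (by omega) (by omega)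
    have l2 := h.le b c hbc (by omega)
    have l3 := h.le d N hdN le_rfl
    rw [Nat.sub_zero] at l1
    have tot : ENNReal.ofReal (σ 0 N) ≤
        ENNReal.ofReal (σ 0 a + (P₁ + (σ b c + (P₂ + σ d N)))) := by
      have n1 := h.nonneg 0 a
      have n2 := h.nonneg b c
      have n3 := h.nonneg d N
      rw [ENNReal.ofReal_add n1 (by positivity), ENNReal.ofReal_add hP₁ (by positivity),
        ENNReal.ofReal_add n2 (by positivity), ENNReal.ofReal_add hP₂ n3]
      refine h.min.trans (s1.trans (add_le_add l1 (s2.trans (add_le_add e1 (s3.trans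
        (add_le_add l2 (s4.trans (add_le_add e2 l3))))))))
    have n1 := h.nonneg 0 a
    have n2 := h.nonneg b c
    have n3 := h.nonneg d N
    rw [ENNReal.ofReal_le_ofReal_iff (by positivity)] at tot
    have a1 := h.add 0 a N (by omega) (by omega) le_rfl
    have a2 := h.add a b N hab (by omega) le_rfl
    have a3 := h.add b c N hbc (by omega) le_rfl
    have a4 := h.add c d N hcd hdN le_rfl
    linarith
  rcases hd with hd | hd
  · have := key e (e + 2 * m) i (i + 1) m (m + 1) Q P hQ hP (by omega) hd (by omega) (by omega)
      h2 h1 (by omega)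
    linarith
  · exact key i (i + 1) e (e + 2 * m) (m + 1) m P Q hP hQ (by omega) hd (by omega) he h1 h2
      (by omega)

/-- If some long block of the chain has bounded average action, then no step is long: otherwise one
could save time on the block and spend it on that step. -/
theorem sq_dist_le_of_slow {i j j' : ℕ} (hi : i < N) (hj' : j' ≤ N) {B : ℝ}
    (hB : 0 ≤ B) (hσ : σ j j' ≤ B * (j' - j : ℕ))
    (hlen : 4 * dist (x i) (x (i + 1)) + 7 ≤ (j' - j : ℕ)) :
    C * dist (x i) (x (i + 1)) ^ 2 ≤
      (A 1 + A √(24 * B / C)) * (dist (x i) (x (i + 1)) + 2) := by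
  have hC := h.pos
  set r := dist (x i) (x (i + 1)) with hr
  have hr0 : 0 ≤ r := dist_nonneg
  have hA1 := h.nonneg_bound 1
  have hA2 := h.nonneg_bound √(24 * B / C)
  rcases hr0.eq_or_lt with h0 | h0
  · rw [← h0]
    simp only [ne_eq, OfNat.ofNat_ne_zero, not_false_eq_true, zero_pow, mul_zero]
    positivity
  set m := ⌈r⌉₊ with hm
  have hm0 : 0 < m := Nat.ceil_pos.2 h0
  have hrm : r ≤ m := Nat.le_ceil r
  have hmr : (m : ℝ) < r + 1 := Nat.ceil_lt_add_one hr0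
  have hlenm : 4 * m + 3 ≤ j' - j := by
    have : (4 * m + 3 : ℝ) ≤ (j' - j : ℕ) := by linarith
    exact_mod_cast this
  -- The block to be shortened must avoid the step `i`. If the step lies in `[j, j']`, keep the
  -- longer of the two remaining sides; it has about half the length, so the average action grows by
  -- a factor of at most `3`.
  obtain ⟨p, p', hjp, hpp, hpj, hdisj, hl⟩ : ∃ p p', j ≤ p ∧ p ≤ p' ∧ p' ≤ j' ∧
      (p' ≤ i ∨ i + 1 ≤ p) ∧ j' - j ≤ 2 * (p' - p) + 1 := by
    by_cases c1 : i + 1 ≤ j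
    · exact ⟨j, j', le_rfl, by omega, le_rfl, Or.inr c1, by omega⟩
    by_cases c2 : j' ≤ i
    · exact ⟨j, j', le_rfl, by omega, le_rfl, Or.inl c2, by omega⟩
    by_cases c3 : j' - (i + 1) ≤ i - j
    · exact ⟨j, i, le_rfl, by omega, by omega, Or.inl le_rfl, by omega⟩
    · exact ⟨i + 1, j', by omega, by omega, le_rfl, Or.inr le_rfl, by omega⟩
  have hσ' : σ p p' ≤ 3 * B * (p' - p : ℕ) := by
    have h1 := h.mono hjp hpp hpj hj'
    have h2 : ((j' - j : ℕ) : ℝ) ≤ 3 * (p' - p : ℕ) := by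
      have : j' - j ≤ 3 * (p' - p) := by omega
      exact_mod_cast this
    have := mul_le_mul_of_nonneg_left h2 hB
    linarith
  obtain ⟨e, hpe, hep, hσe⟩ := h.exists_slow_block hm0 (by omega) (hpj.trans hj') hB hσ'
  -- By `dist_sq_le`, `C * dist² ≤ 2m * 12Bm`; so crossing the block in time `m` has bounded average
  -- displacement.
  have hde : dist (x e) (x (e + 2 * m)) ≤ √(24 * B / C) * m := by
    have h1 := h.dist_sq_le e (e + 2 * m) (by omega) (by omega)
    rw [Nat.add_sub_cancel_left] at h1
    refine abs_le_of_sq_le_sq' ?_ (by positivity) |>.2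
    rw [mul_pow, Real.sq_sqrt (by positivity), div_mul_eq_mul_div, le_div_iff₀' hC]
    refine h1.trans ?_
    push_cast
    have := mul_le_mul_of_nonneg_left hσe (by positivity : (0 : ℝ) ≤ 2 * m)
    nlinarith
  have h1 := h.exchange hi (by omega) (e := e) (m := m) (by omega)
    (P := A 1 * (m + 1 : ℕ)) (Q := A √(24 * B / C) * m) (by positivity) (by positivity)
    (h.le_of_dist_le 1 (m + 1) _ _ (by omega) (by rw [one_mul]; push_cast; linarith))
    (h.le_of_dist_le _ m _ _ hm0 hde)
  have h2 := h.dist_sq_le i (i + 1) (by omega) (by omega)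
  have h3 := h.nonneg e (e + 2 * m)
  rw [Nat.add_sub_cancel_left, Nat.cast_one, one_mul] at h2
  push_cast at h1
  have h4 : A 1 * (m + 1) ≤ A 1 * (r + 2) := mul_le_mul_of_nonneg_left (by linarith) hA1
  have h5 : A √(24 * B / C) * m ≤ A √(24 * B / C) * (r + 2) :=
    mul_le_mul_of_nonneg_left (by linarith) hA2
  linarith

/-- If the chain is long compared with the step, the whole chain is the slow stretch. If `N < 4 * r
+ 7`, the step costs at most the total action, which is itself linear in `r`; this accounts for the
term `4 * B`. -/
theorem dist_step_le {B : ℝ} (hB : 0 ≤ B) (hσ : σ 0 N ≤ B * N) {i : ℕ} (hi : i < N) :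
    dist (x i) (x (i + 1)) ≤ 2 + 2 * (A 1 + A √(24 * B / C) + 4 * B) / C := by
  have hA1 := h.nonneg_bound 1
  have hA2 := h.nonneg_bound √(24 * B / C)
  set r := dist (x i) (x (i + 1)) with hr
  have hr0 : 0 ≤ r := dist_nonneg
  refine le_of_sq_le h.pos (by positivity) ?_
  by_cases hN : 4 * r + 7 ≤ N
  · have := h.sq_dist_le_of_slow hi le_rfl hB (j := 0) (by simpa using hσ) (by simpa using hN)
    have h2 : 0 ≤ 4 * B * (r + 2) := by positivity
    rw [← hr] at this
    linarith
  · push Not at hN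
    have h2 := h.dist_sq_le i (i + 1) (by omega) (by omega)
    rw [Nat.add_sub_cancel_left, Nat.cast_one, one_mul] at h2
    have h3 := h.mono (Nat.zero_le i) (Nat.le_succ i) (show i + 1 ≤ N by omega) le_rfl
    have h4 : B * N ≤ B * (4 * r + 7) := mul_le_mul_of_nonneg_left hN.le hB
    have h5 : 0 ≤ (A 1 + A √(24 * B / C)) * (r + 2) := by positivity
    rw [← hr] at h2
    linarith

theorem dist_step_le_of_slow {B : ℝ} (hB : 0 ≤ B) {i j j' : ℕ} (hi : i < N) (hj' : j' ≤ N)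
    (hσ : σ j j' ≤ B * (j' - j : ℕ))
    (hlen : 4 * dist (x i) (x (i + 1)) + 7 ≤ (j' - j : ℕ)) :
    dist (x i) (x (i + 1)) ≤ 2 + 2 * (A 1 + A √(24 * B / C)) / C := by
  have hA1 := h.nonneg_bound 1
  have hA2 := h.nonneg_bound √(24 * B / C)
  exact le_of_sq_le h.pos (by positivity) (h.sq_dist_le_of_slow hi hj' hB hσ hlen)

end IsMinimizingChain

end Discrete

end Lagrangian


/-! ### Tangent vectors and velocities in charts -/

namespace Lagrangian

section TangentChart

variable {n : ℕ} {M : Type*} [TopologicalSpace M] [ChartedSpace (EuclideanSpace ℝ (Fin n)) M]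

local notation "𝔼" => EuclideanSpace ℝ (Fin n)

/-- The derivative of the inverse of the chart at `x₀`. -/
noncomputable def chartDeriv (x₀ : M) (q : EuclideanSpace ℝ (Fin n)) :
    EuclideanSpace ℝ (Fin n) →L[ℝ] TangentSpace (𝓡 n) ((chartAt 𝔼 x₀).symm q) :=
  mfderiv (𝓡 n) (𝓡 n) (chartAt 𝔼 x₀).symm q

/-- The tangent vector with coordinates `(q, u)` in the chart at `x₀`. -/
noncomputable def chartVector (x₀ : M) (q u : EuclideanSpace ℝ (Fin n)) : TangentBundle (𝓡 n) M :=
  ⟨(chartAt 𝔼 x₀).symm q, chartDeriv x₀ q u⟩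

variable [IsManifold (𝓡 n) ∞ M]

theorem chartVector_eq (x₀ : M) {q : 𝔼} (hq : q ∈ (chartAt 𝔼 x₀).target) (u : 𝔼) :
    chartVector x₀ q u = (extChartAt (𝓡 n).tangent (⟨x₀, 0⟩ : TangentBundle (𝓡 n) M)).symm (q, u) :=
  tangentMap_chart_symm (I := 𝓡 n) (p := (⟨x₀, 0⟩ : TangentBundle (𝓡 n) M))
    (q := (⟨q, u⟩ : TangentBundle (𝓡 n) 𝔼)) hq

theorem contMDiffOn_chartVector (x₀ : M) :
    ContMDiffOn 𝓘(ℝ, 𝔼 × 𝔼) (𝓡 n).tangent ∞ (fun z : 𝔼 × 𝔼 ↦ chartVector x₀ z.1 z.2)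
      ((chartAt 𝔼 x₀).target ×ˢ univ) := by
  have h := contMDiffOn_extChartAt_symm (I := (𝓡 n).tangent) (n := ∞)
    (⟨x₀, 0⟩ : TangentBundle (𝓡 n) M)
  refine (h.mono ?_).congr fun z hz ↦ chartVector_eq x₀ hz.1 z.2
  intro z hz
  rw [extChartAt_target]
  refine ⟨?_, ?_⟩
  · rw [mem_preimage, TangentBundle.mem_chart_target_iff]
    exact hz.1
  · rw [ModelWithCorners.range_eq_univ]; trivial

theorem continuousOn_chartVector (x₀ : M) :
    ContinuousOn (fun z : 𝔼 × 𝔼 ↦ chartVector x₀ z.1 z.2) ((chartAt 𝔼 x₀).target ×ˢ univ) :=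
  (contMDiffOn_chartVector x₀).continuousOn

theorem hasMFDerivAt_chart_symm (x₀ : M) {q : 𝔼} (hq : q ∈ (chartAt 𝔼 x₀).target) :
    HasMFDerivAt (𝓡 n) (𝓡 n) (chartAt 𝔼 x₀).symm q
      (mfderiv (𝓡 n) (𝓡 n) (chartAt 𝔼 x₀).symm q) :=
  (mdifferentiableAt_atlas_symm (chart_mem_atlas 𝔼 x₀) hq).hasMFDerivAt

theorem hasMFDerivAt_chart (x₀ : M) {y : M} (hy : y ∈ (chartAt 𝔼 x₀).source) :
    HasMFDerivAt (𝓡 n) (𝓡 n) (chartAt 𝔼 x₀) y (mfderiv (𝓡 n) (𝓡 n) (chartAt 𝔼 x₀) y) :=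
  (mdifferentiableAt_atlas (chart_mem_atlas 𝔼 x₀) hy).hasMFDerivAt

theorem mfderiv_chart_symm_injective (x₀ : M) {q : 𝔼} (hq : q ∈ (chartAt 𝔼 x₀).target) {u : 𝔼}
    (h : chartDeriv x₀ q u = 0) : u = 0 := by
  have h2 := congrArg (fun A : 𝔼 →L[ℝ] 𝔼 ↦ A u)
    ((mdifferentiable_chart (I := 𝓡 n) x₀).comp_symm_deriv hq)
  change (mfderiv (𝓡 n) (𝓡 n) (chartAt 𝔼 x₀) ((chartAt 𝔼 x₀).symm q)) (chartDeriv x₀ q u) = u at h2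
  rw [← h2, h, map_zero]
  rfl

theorem exists_chartVector_eq (x₀ : M) (z : TangentBundle (𝓡 n) M)
    (hz : z.1 ∈ (chartAt 𝔼 x₀).source) :
    ∃ u : 𝔼, chartVector x₀ (chartAt 𝔼 x₀ z.1) u = z := by
  obtain ⟨y, v⟩ := z
  refine ⟨mfderiv (𝓡 n) (𝓡 n) (chartAt 𝔼 x₀) y v, ?_⟩
  have h1 := (mdifferentiable_chart (I := 𝓡 n) x₀).symm_comp_deriv hz
  have h2 := congrArg (fun A : 𝔼 →L[ℝ] 𝔼 ↦ A v) h1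
  have h3 := (chartAt 𝔼 x₀).left_inv hz
  refine Bundle.TotalSpace.ext h3 ?_
  exact heq_of_eq h2

/-- The velocity of a curve at time `t` relative to a set `s` of times. -/
noncomputable def velocityWithin (γ : ℝ → M) (s : Set ℝ) (t : ℝ) : TangentBundle (𝓡 n) M :=
  ⟨γ t, mfderivWithin 𝓘(ℝ, ℝ) (𝓡 n) γ s t (1 : ℝ)⟩

/-- Chain rule for `φ.symm ∘ (φ ∘ γ)`. The velocity is identified in the total space because the
fibres over `γ t` and `φ.symm (φ (γ t))` are fibres over points that are only propositionally equal.
-/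
theorem hasMFDerivWithinAt_of_chart (x₀ : M) {γ : ℝ → M} {s : Set ℝ} {t : ℝ}
    (hγ : ContinuousWithinAt γ s t) (ht : γ t ∈ (chartAt 𝔼 x₀).source) {u : 𝔼}
    (hu : HasDerivWithinAt (fun τ ↦ chartAt 𝔼 x₀ (γ τ)) u s t) :
    ∃ A : ℝ →L[ℝ] 𝔼, HasMFDerivWithinAt 𝓘(ℝ, ℝ) (𝓡 n) γ s t A ∧
      (⟨γ t, A 1⟩ : TangentBundle (𝓡 n) M) = chartVector x₀ (chartAt 𝔼 x₀ (γ t)) u := by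
  set φ := chartAt 𝔼 x₀
  have hf : HasMFDerivWithinAt 𝓘(ℝ, ℝ) (𝓡 n) (fun τ ↦ φ (γ τ)) s t
      (ContinuousLinearMap.toSpanSingleton ℝ u) :=
    hasMFDerivWithinAt_iff_hasFDerivWithinAt.2 hu.hasFDerivWithinAt
  have hg := hasMFDerivAt_chart_symm x₀ (φ.map_source ht)
  have hc := hg.comp_hasMFDerivWithinAt t hf
  have hev : γ =ᶠ[𝓝[s] t] φ.symm ∘ fun τ ↦ φ (γ τ) := by
    filter_upwards [hγ (φ.open_source.mem_nhds ht)] with τ hτ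
    exact (φ.left_inv hτ).symm
  have heq : γ t = φ.symm (φ (γ t)) := (φ.left_inv ht).symm
  refine ⟨_, hc.congr_of_eventuallyEq hev heq, ?_⟩
  refine Bundle.TotalSpace.ext heq ?_
  apply heq_of_eq
  change (mfderiv (𝓡 n) (𝓡 n) φ.symm (φ (γ t)))
    ((ContinuousLinearMap.toSpanSingleton ℝ u) (1 : ℝ)) = _
  rw [ContinuousLinearMap.toSpanSingleton_apply, one_smul]
  rfl

theorem velocityWithin_eq_chartVector (x₀ : M) {γ : ℝ → M} {s : Set ℝ} {t : ℝ}
    (hs : UniqueDiffWithinAt ℝ s t)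
    (hγ : ContinuousWithinAt γ s t) (ht : γ t ∈ (chartAt 𝔼 x₀).source) {u : 𝔼}
    (hu : HasDerivWithinAt (fun τ ↦ chartAt 𝔼 x₀ (γ τ)) u s t) :
    MDifferentiableWithinAt 𝓘(ℝ, ℝ) (𝓡 n) γ s t ∧
    velocityWithin γ s t = chartVector x₀ (chartAt 𝔼 x₀ (γ t)) u := by
  obtain ⟨A, hA, h⟩ := hasMFDerivWithinAt_of_chart x₀ hγ ht hu
  refine ⟨hA.mdifferentiableWithinAt, ?_⟩
  rw [← h, velocityWithin, hA.mfderivWithin hs.uniqueMDiffWithinAt]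
  rfl

theorem hasDerivWithinAt_chart (x₀ : M) {γ : ℝ → M} {s : Set ℝ} {t : ℝ}
    (hγ : MDifferentiableWithinAt 𝓘(ℝ, ℝ) (𝓡 n) γ s t) (ht : γ t ∈ (chartAt 𝔼 x₀).source) :
    ∃ u : 𝔼, HasDerivWithinAt (fun τ ↦ chartAt 𝔼 x₀ (γ τ)) u s t := by
  have hc := (hasMFDerivAt_chart x₀ ht).comp_hasMFDerivWithinAt t hγ.hasMFDerivWithinAt
  exact ⟨_, HasFDerivWithinAt.hasDerivWithinAt (F := 𝔼)
    (hasMFDerivWithinAt_iff_hasFDerivWithinAt.1 hc)⟩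

theorem two_le_infty : (2 : WithTop ℕ∞) ≤ ((⊤ : ℕ∞) : WithTop ℕ∞) := by
  exact WithTop.coe_le_coe.2 (le_top : (2 : ℕ∞) ≤ ⊤)

theorem contDiffOn_inChart {L : TangentBundle (𝓡 n) M → ℝ → ℝ}
    (hL : ContMDiff ((𝓡 n).tangent.prod 𝓘(ℝ, ℝ)) 𝓘(ℝ, ℝ) 2
      (fun z : TangentBundle (𝓡 n) M × ℝ => L z.1 z.2)) (x₀ : M) :
    ContDiffOn ℝ 2 (fun z : 𝔼 × 𝔼 × ℝ ↦ inChart L x₀ z.1 z.2.1 z.2.2)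
      ((chartAt 𝔼 x₀).target ×ˢ univ) := by
  rw [← contMDiffOn_iff_contDiffOn]
  have h1 : ContMDiffOn 𝓘(ℝ, 𝔼 × 𝔼 × ℝ) (𝓡 n).tangent 2
      (fun z : 𝔼 × 𝔼 × ℝ ↦ chartVector x₀ z.1 z.2.1) ((chartAt 𝔼 x₀).target ×ˢ univ) := by
    have h2 : ContMDiff 𝓘(ℝ, 𝔼 × 𝔼 × ℝ) 𝓘(ℝ, 𝔼 × 𝔼) 2
        (fun z : 𝔼 × 𝔼 × ℝ ↦ (z.1, z.2.1)) := by
      rw [contMDiff_iff_contDiff]; fun_prop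
    exact ((contMDiffOn_chartVector x₀).of_le two_le_infty).comp h2.contMDiffOn
      (fun z hz ↦ ⟨hz.1, trivial⟩)
  have h3 : ContMDiffOn 𝓘(ℝ, 𝔼 × 𝔼 × ℝ) 𝓘(ℝ, ℝ) 2
      (fun z : 𝔼 × 𝔼 × ℝ ↦ z.2.2) ((chartAt 𝔼 x₀).target ×ˢ univ) := by
    rw [contMDiffOn_iff_contDiffOn]; fun_prop
  exact hL.comp_contMDiffOn (h1.prodMk h3)

end TangentChart

/-! ### Comparison of the Riemannian norm with the norm in a chart -/

section Norm

variable {n : ℕ} {M : Type*} [TopologicalSpace M] [ChartedSpace (EuclideanSpace ℝ (Fin n)) M]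
  [IsManifold (𝓡 n) ∞ M]
  [Bundle.RiemannianBundle (fun x : M => TangentSpace (𝓡 n) x)]
  [IsContinuousRiemannianBundle (EuclideanSpace ℝ (Fin n)) (fun x : M => TangentSpace (𝓡 n) x)]

local notation "𝔼" => EuclideanSpace ℝ (Fin n)

theorem continuous_norm_snd : Continuous (fun z : TangentBundle (𝓡 n) M ↦ ‖z.2‖) := by
  have h : Continuous (fun z : TangentBundle (𝓡 n) M ↦ inner ℝ z.2 z.2) :=
    Continuous.inner_bundle (F := 𝔼) (E := fun x : M => TangentSpace (𝓡 n) x)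
      (b := fun z : TangentBundle (𝓡 n) M ↦ z.1) (v := fun z ↦ z.2) (w := fun z ↦ z.2)
      continuous_id continuous_id
  have h2 : (fun z : TangentBundle (𝓡 n) M ↦ ‖z.2‖) = fun z ↦ √(inner ℝ z.2 z.2) := by
    ext z; rw [norm_eq_sqrt_real_inner]
  rw [h2]
  exact h.sqrt

omit [IsManifold (𝓡 n) ∞ M] [IsContinuousRiemannianBundle 𝔼 (fun x : M => TangentSpace (𝓡 n) x)] in
theorem norm_chartVector_smul (x₀ : M) (q u : 𝔼) (c : ℝ) :
    ‖(chartVector x₀ q (c • u)).2‖ = |c| * ‖(chartVector x₀ q u).2‖ := by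
  unfold chartVector
  rw [map_smul, norm_smul, Real.norm_eq_abs]

/-- The Riemannian norm is continuous and positive on the compact set of unit coordinate vectors
over `k`; homogeneity gives the rest. -/
theorem exists_norm_chartVector_bounds (x₀ : M) {k : Set 𝔼} (hk : IsCompact k)
    (hk' : k ⊆ (chartAt 𝔼 x₀).target) :
    ∃ m : ℝ, 0 < m ∧ ∃ c : ℝ, 0 < c ∧ ∀ q ∈ k, ∀ u : 𝔼,
      m * ‖u‖ ≤ ‖(chartVector x₀ q u).2‖ ∧ ‖(chartVector x₀ q u).2‖ ≤ c * ‖u‖ := by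
  have hcont : ContinuousOn (fun z : 𝔼 × 𝔼 ↦ ‖(chartVector x₀ z.1 z.2).2‖)
      (k ×ˢ Metric.sphere (0 : 𝔼) 1) :=
    continuous_norm_snd.comp_continuousOn
      ((continuousOn_chartVector x₀).mono (prod_mono hk' (subset_univ _)))
  have hc : IsCompact (k ×ˢ Metric.sphere (0 : 𝔼) 1) := hk.prod (isCompact_sphere _ _)
  obtain ⟨c, hc1⟩ := hc.bddAbove_image hcont
  obtain ⟨m, hm0, hm⟩ : ∃ m : ℝ, 0 < m ∧ ∀ z ∈ k ×ˢ Metric.sphere (0 : 𝔼) 1,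
      m ≤ ‖(chartVector x₀ z.1 z.2).2‖ := by
    rcases (k ×ˢ Metric.sphere (0 : 𝔼) 1).eq_empty_or_nonempty with he | hne
    · exact ⟨1, one_pos, fun z hz ↦ by simp [he] at hz⟩
    · obtain ⟨z, hz, hmin⟩ := hc.exists_isMinOn hne hcont
      refine ⟨_, ?_, fun w hw ↦ hmin hw⟩
      rw [norm_pos_iff]
      intro h0
      have := mfderiv_chart_symm_injective x₀ (hk' hz.1) (u := z.2) h0
      have h1 : ‖z.2‖ = 1 := by simpa using hz.2
      rw [this, norm_zero] at h1
      exact zero_ne_one h1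
  refine ⟨m, hm0, max c 1, by positivity, fun q hq u ↦ ?_⟩
  rcases eq_or_ne u 0 with rfl | hu
  · have := norm_chartVector_smul x₀ q (0 : 𝔼) 0
    rw [smul_zero, abs_zero, zero_mul] at this
    rw [this, norm_zero]; simp
  have hu' : 0 < ‖u‖ := norm_pos_iff.2 hu
  have hsph : ((q, ‖u‖⁻¹ • u) : 𝔼 × 𝔼) ∈ k ×ˢ Metric.sphere (0 : 𝔼) 1 := by
    refine ⟨hq, ?_⟩
    simp [norm_smul, hu'.ne']
  have h1 := hm _ hsph
  have h2 := hc1 (mem_image_of_mem _ hsph)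
  simp only at h1 h2
  have h3 : ‖(chartVector x₀ q u).2‖ = ‖u‖ * ‖(chartVector x₀ q (‖u‖⁻¹ • u)).2‖ := by
    conv_lhs => rw [show u = ‖u‖ • (‖u‖⁻¹ • u) by rw [smul_smul, mul_inv_cancel₀ hu'.ne', one_smul]]
    rw [norm_chartVector_smul, abs_of_pos hu']
  rw [h3]
  constructor
  · rw [mul_comm]; gcongr
  · rw [mul_comm]; gcongr; exact h2.trans (le_max_left _ _)

/-- Bounded sets of tangent vectors over a compact manifold are relatively compact. -/
theorem exists_isCompact_norm_le [CompactSpace M] (V : ℝ) :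
    ∃ k : Set (TangentBundle (𝓡 n) M), IsCompact k ∧ {z | ‖z.2‖ ≤ V} ⊆ k := by
  have hloc : ∀ x₀ : M, ∃ W ∈ 𝓝 x₀, ∃ k : Set (TangentBundle (𝓡 n) M), IsCompact k ∧
      ∀ z : TangentBundle (𝓡 n) M, z.1 ∈ W → ‖z.2‖ ≤ V → z ∈ k := by
    intro x₀
    obtain ⟨r, hr0, hr⟩ : ∃ r > 0, Metric.closedBall (chartAt 𝔼 x₀ x₀) r ⊆ (chartAt 𝔼 x₀).target :=
      Metric.nhds_basis_closedBall.mem_iff.1 (chart_target_mem_nhds 𝔼 x₀)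
    have hk := isCompact_closedBall (chartAt 𝔼 x₀ x₀) r
    obtain ⟨m, hm0, c, -, hb⟩ := exists_norm_chartVector_bounds x₀ hk hr
    refine ⟨(chartAt 𝔼 x₀).source ∩ (chartAt 𝔼 x₀) ⁻¹' Metric.closedBall (chartAt 𝔼 x₀ x₀) r, ?_,
      (fun z : 𝔼 × 𝔼 ↦ chartVector x₀ z.1 z.2) ''
        (Metric.closedBall (chartAt 𝔼 x₀ x₀) r ×ˢ Metric.closedBall 0 (V / m)), ?_, ?_⟩
    · exact inter_mem (chart_source_mem_nhds 𝔼 x₀)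
        ((chartAt 𝔼 x₀).continuousAt (mem_chart_source 𝔼 x₀)
          (Metric.closedBall_mem_nhds _ hr0))
    · exact (hk.prod (isCompact_closedBall _ _)).image_of_continuousOn
        ((continuousOn_chartVector x₀).mono (prod_mono hr (subset_univ _)))
    · intro z hz hV
      obtain ⟨u, hu⟩ := exists_chartVector_eq x₀ z hz.1
      refine ⟨(_, u), ⟨hz.2, ?_⟩, hu⟩
      have := (hb _ hz.2 u).1
      rw [hu] at this
      rw [mem_closedBall_zero_iff, le_div_iff₀' hm0]
      exact this.trans hV
  choose W hW k hk hWk using hloc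
  obtain ⟨s, hs⟩ := CompactSpace.elim_nhds_subcover W hW
  refine ⟨⋃ x ∈ s, k x, s.isCompact_biUnion fun x _ ↦ hk x, fun z hz ↦ ?_⟩
  have : z.1 ∈ ⋃ x ∈ s, W x := by rw [hs]; trivial
  simp only [mem_iUnion] at this ⊢
  obtain ⟨x, hx, hzx⟩ := this
  exact ⟨x, hx, hWk x z hzx hz⟩

end Norm

end Lagrangian


/-! ### Continuity, velocities and lengths of curves -/

namespace AbsolutelyContinuousOnInterval

variable {X : Type*} [PseudoMetricSpace X] {γ : ℝ → X} {a b : ℝ}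

theorem dist_left (hγ : AbsolutelyContinuousOnInterval γ a b) (x : X) :
    AbsolutelyContinuousOnInterval (fun t ↦ dist x (γ t)) a b :=
  hγ.of_dist_le (K := 1) fun s _ t _ ↦ by
    rw [one_mul, dist_comm x, dist_comm x]
    exact dist_dist_dist_le_left _ _ _

theorem continuousOn_metric (hγ : AbsolutelyContinuousOnInterval γ a b) :
    ContinuousOn γ (uIcc a b) := fun t ht ↦ by
  have h := (hγ.dist_left (γ t)).continuousOn t ht
  rw [ContinuousWithinAt, dist_self] at h
  rw [ContinuousWithinAt, tendsto_iff_dist_tendsto_zero]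
  simpa only [dist_comm] using h

end AbsolutelyContinuousOnInterval

namespace Lagrangian

section Velocity

variable {n : ℕ} {M : Type*} [TopologicalSpace M] [ChartedSpace (EuclideanSpace ℝ (Fin n)) M]
  [IsManifold (𝓡 n) ∞ M]

local notation "𝔼" => EuclideanSpace ℝ (Fin n)

theorem continuousOn_velocityWithin {γ : ℝ → M} {a b : ℝ} (hab : a < b)
    (hγ : ContMDiffOn 𝓘(ℝ, ℝ) (𝓡 n) 1 γ (Icc a b)) :
    ContinuousOn (velocityWithin (n := n) γ (Icc a b)) (Icc a b) := by
  have h := hγ.continuousOn_tangentMapWithin le_rfl (uniqueDiffOn_Icc hab).uniqueMDiffOn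
  have h2 : Continuous (fun t : ℝ ↦ (⟨t, (1 : ℝ)⟩ : TangentBundle 𝓘(ℝ, ℝ) ℝ)) :=
    (tangentBundleModelSpaceHomeomorph 𝓘(ℝ, ℝ)).symm.continuous.comp
      (Continuous.prodMk continuous_id (continuous_const (y := (1 : ℝ))))
  exact h.comp h2.continuousOn fun t ht ↦ ht

omit [IsManifold (𝓡 n) ∞ M] in
theorem velocityWithin_Icc_eq {γ : ℝ → M} {a b t : ℝ} (hab : a < b) (ht : t ∈ Icc a b)
    (hγ : MDifferentiableAt 𝓘(ℝ, ℝ) (𝓡 n) γ t) :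
    velocityWithin (n := n) γ (Icc a b) t = ⟨γ t, velocity γ t⟩ := by
  rw [velocityWithin, mfderivWithin_eq_mfderiv (uniqueDiffOn_Icc hab t ht).uniqueMDiffWithinAt hγ]
  rfl

omit [IsManifold (𝓡 n) ∞ M] in
theorem velocityWithin_of_mem_nhds {γ : ℝ → M} {s : Set ℝ} {t : ℝ} (ht : s ∈ 𝓝 t) :
    velocityWithin (n := n) γ s t = ⟨γ t, velocity γ t⟩ := by
  rw [velocityWithin, mfderivWithin_of_mem_nhds ht]
  rfl

theorem hasDerivWithinAt_chart_velocity (x₀ : M) {γ : ℝ → M} {s : Set ℝ} {t : ℝ}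
    (hs : UniqueDiffWithinAt ℝ s t)
    (hγ : MDifferentiableWithinAt 𝓘(ℝ, ℝ) (𝓡 n) γ s t) (ht : γ t ∈ (chartAt 𝔼 x₀).source) :
    ∃ u : 𝔼, HasDerivWithinAt (fun τ ↦ chartAt 𝔼 x₀ (γ τ)) u s t ∧
      velocityWithin γ s t = chartVector x₀ (chartAt 𝔼 x₀ (γ t)) u := by
  obtain ⟨u, hu⟩ := hasDerivWithinAt_chart x₀ hγ ht
  exact ⟨u, hu, (velocityWithin_eq_chartVector x₀ hs hγ.continuousWithinAt ht hu).2⟩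

theorem contMDiffOn_chart_one (x₀ : M) :
    ContMDiffOn (𝓡 n) 𝓘(ℝ, 𝔼) 1 (chartAt 𝔼 x₀) (chartAt 𝔼 x₀).source :=
  contMDiffOn_chart (I := 𝓡 n) (n := 1) (x := x₀)

theorem contMDiffOn_chart_symm_one (x₀ : M) :
    ContMDiffOn 𝓘(ℝ, 𝔼) (𝓡 n) 1 (chartAt 𝔼 x₀).symm (chartAt 𝔼 x₀).target :=
  contMDiffOn_chart_symm (I := 𝓡 n) (n := 1) (x := x₀)

end Velocity

section Length

variable {n : ℕ} {M : Type*} [TopologicalSpace M] [ChartedSpace (EuclideanSpace ℝ (Fin n)) M]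
  [IsManifold (𝓡 n) ∞ M]
  [Bundle.RiemannianBundle (fun x : M => TangentSpace (𝓡 n) x)]

local notation "𝔼" => EuclideanSpace ℝ (Fin n)

omit [IsManifold (𝓡 n) ∞ M] in
theorem pathELength_eq_velocityWithin (γ : ℝ → M) (a b : ℝ) :
    Manifold.pathELength (𝓡 n) γ a b =
      ∫⁻ t in Icc a b, ENNReal.ofReal ‖(velocityWithin (n := n) γ (Icc a b) t).2‖ := by
  rw [Manifold.pathELength_eq_lintegral_mfderivWithin_Icc]
  exact lintegral_congr fun t ↦ (ofReal_norm _).symm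

variable [IsContinuousRiemannianBundle (EuclideanSpace ℝ (Fin n))
    (fun x : M => TangentSpace (𝓡 n) x)]

theorem exists_norm_velocityWithin_le {γ : ℝ → M} {a b : ℝ} (hab : a < b)
    (hγ : ContMDiffOn 𝓘(ℝ, ℝ) (𝓡 n) 1 γ (Icc a b)) :
    ∃ V : ℝ, 0 ≤ V ∧ ∀ t ∈ Icc a b, ‖(velocityWithin (n := n) γ (Icc a b) t).2‖ ≤ V := by
  have h := continuous_norm_snd.comp_continuousOn (continuousOn_velocityWithin hab hγ)
  obtain ⟨V, hV⟩ := isCompact_Icc.bddAbove_image h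
  exact ⟨max V 0, le_max_right _ _, fun t ht ↦
    (hV (mem_image_of_mem _ ht)).trans (le_max_left _ _)⟩

end Length

/-! ### Riemannian distance, Lipschitz charts and almost everywhere differentiability -/

section Distance

variable {n : ℕ} {X : Type*} [MetricSpace X] [ChartedSpace (EuclideanSpace ℝ (Fin n)) X]
  [IsManifold (𝓡 n) ∞ X]
  [Bundle.RiemannianBundle (fun x : X => TangentSpace (𝓡 n) x)]
  [IsContinuousRiemannianBundle (EuclideanSpace ℝ (Fin n)) (fun x : X => TangentSpace (𝓡 n) x)]
  [IsRiemannianManifold (𝓡 n) X]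

local notation "𝔼" => EuclideanSpace ℝ (Fin n)

omit [IsManifold (𝓡 n) ∞ X]
  [IsContinuousRiemannianBundle 𝔼 (fun x : X => TangentSpace (𝓡 n) x)] in
theorem dist_le_of_norm_velocity_le {γ : ℝ → X} {a b V : ℝ} (hV : 0 ≤ V)
    (hγ : ContMDiffOn 𝓘(ℝ, ℝ) (𝓡 n) 1 γ (Icc a b))
    (hv : ∀ t ∈ Ioo a b, ‖velocity (n := n) γ t‖ ≤ V)
    {s t : ℝ} (hs : s ∈ Icc a b) (ht : t ∈ Icc a b) : dist (γ s) (γ t) ≤ V * dist s t := by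
  wlog hst : s ≤ t generalizing s t
  · rw [dist_comm, dist_comm s]; exact this ht hs (not_le.1 hst).le
  have h1 : edist (γ s) (γ t) ≤ Manifold.pathELength (𝓡 n) γ s t := by
    rw [IsRiemannianManifold.out (I := 𝓡 n) (γ s) (γ t)]
    exact Manifold.riemannianEDist_le_pathELength (hγ.mono (Icc_subset_Icc hs.1 ht.2)) rfl rfl hst
  have h2 : Manifold.pathELength (𝓡 n) γ s t ≤ ENNReal.ofReal (V * (t - s)) := by
    rw [Manifold.pathELength_eq_lintegral_mfderiv_Ioo]
    calc _ ≤ ∫⁻ _ in Ioo s t, ENNReal.ofReal V := by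
          refine setLIntegral_mono' measurableSet_Ioo fun τ hτ ↦ ?_
          rw [← ofReal_norm]
          exact ENNReal.ofReal_le_ofReal (hv τ ⟨hs.1.trans_lt hτ.1, hτ.2.trans_le ht.2⟩)
      _ = ENNReal.ofReal (V * (t - s)) := by
          rw [setLIntegral_const, Real.volume_Ioo, ENNReal.ofReal_mul hV]
  rw [Real.dist_eq, abs_sub_comm, abs_of_nonneg (sub_nonneg.2 hst)]
  have := h1.trans h2
  rw [edist_dist] at this
  exact (ENNReal.ofReal_le_ofReal_iff (mul_nonneg hV (sub_nonneg.2 hst))).1 this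

theorem exists_lipschitzOnWith_of_contMDiffOn {γ : ℝ → X} {a b : ℝ} (hab : a < b)
    (hγ : ContMDiffOn 𝓘(ℝ, ℝ) (𝓡 n) 1 γ (Icc a b)) :
    ∃ K : ℝ≥0, LipschitzOnWith K γ (Icc a b) := by
  obtain ⟨V, hV0, hV⟩ := exists_norm_velocityWithin_le hab hγ
  refine ⟨⟨V, hV0⟩, LipschitzOnWith.of_dist_le_mul fun s hs t ht ↦ ?_⟩
  refine dist_le_of_norm_velocity_le hV0 hγ (fun τ hτ ↦ ?_) hs ht
  have := hV τ ⟨hτ.1.le, hτ.2.le⟩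
  rwa [velocityWithin_of_mem_nhds (Icc_mem_nhds hτ.1 hτ.2)] at this

theorem _root_.ContMDiffOn.absolutelyContinuousOnInterval {γ : ℝ → X} {a b : ℝ} (hab : a < b)
    (hγ : ContMDiffOn 𝓘(ℝ, ℝ) (𝓡 n) 1 γ (Icc a b)) : AbsolutelyContinuousOnInterval γ a b := by
  obtain ⟨K, hK⟩ := exists_lipschitzOnWith_of_contMDiffOn hab hγ
  rw [← uIcc_of_le hab.le] at hK
  exact hK.absolutelyContinuousOnInterval

omit [IsContinuousRiemannianBundle 𝔼 (fun x : X => TangentSpace (𝓡 n) x)] in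
/-- The chart segment between two points bounds their distance. -/
theorem dist_chart_symm_le (x₀ : X) {q₀ q₁ : 𝔼} {c : ℝ} (hc : 0 ≤ c)
    (h : ∀ q ∈ segment ℝ q₀ q₁, q ∈ (chartAt 𝔼 x₀).target ∧ ‖(chartVector x₀ q (q₁ - q₀)).2‖ ≤ c) :
    dist ((chartAt 𝔼 x₀).symm q₀) ((chartAt 𝔼 x₀).symm q₁) ≤ c := by
  set β : ℝ → 𝔼 := fun t ↦ q₀ + t • (q₁ - q₀)
  have hβd : ∀ t, HasDerivAt β (q₁ - q₀) t := fun t ↦ by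
    simpa [β] using! ((hasDerivAt_id t).smul_const (q₁ - q₀)).const_add q₀
  have hβ : ∀ t ∈ Icc (0 : ℝ) 1, β t ∈ segment ℝ q₀ q₁ := fun t ht ↦ by
    rw [segment_eq_image']; exact ⟨t, ht, rfl⟩
  have hβc : ContDiff ℝ 1 β := by fun_prop
  have hγ : ContMDiffOn 𝓘(ℝ, ℝ) (𝓡 n) 1 (fun t ↦ (chartAt 𝔼 x₀).symm (β t)) (Icc 0 1) :=
    (contMDiffOn_chart_symm_one x₀).comp (contMDiff_iff_contDiff.2 hβc).contMDiffOn
      fun t ht ↦ (h _ (hβ t ht)).1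
  have := dist_le_of_norm_velocity_le (V := c) hc hγ (fun t ht ↦ ?_)
    (left_mem_Icc.2 zero_le_one) (right_mem_Icc.2 zero_le_one)
  · simpa [β] using this
  have ht' : t ∈ Icc (0 : ℝ) 1 := ⟨ht.1.le, ht.2.le⟩
  obtain ⟨h1, h2⟩ := h _ (hβ t ht')
  have h3 : HasDerivWithinAt (fun τ ↦ chartAt 𝔼 x₀ ((chartAt 𝔼 x₀).symm (β τ))) (q₁ - q₀)
      (Icc 0 1) t :=
    (hβd t).hasDerivWithinAt.congr_of_mem
      (fun τ hτ ↦ (chartAt 𝔼 x₀).right_inv (h _ (hβ τ hτ)).1) ht'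
  have h4 := (velocityWithin_eq_chartVector x₀ (uniqueDiffOn_Icc zero_lt_one t ht')
    (hγ.continuousOn t ht') ((chartAt 𝔼 x₀).map_target h1) h3).2
  rw [velocityWithin_of_mem_nhds (Icc_mem_nhds ht.1 ht.2), (chartAt 𝔼 x₀).right_inv h1] at h4
  rw [← h4] at h2
  exact h2

/-- The metric derivative of a differentiable curve is at most the norm of its velocity. -/
theorem eventually_dist_le_of_mdifferentiableAt {γ : ℝ → X} {t : ℝ}
    (hγ : MDifferentiableAt 𝓘(ℝ, ℝ) (𝓡 n) γ t) {ε : ℝ} (hε : 0 < ε) :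
    ∀ᶠ s in 𝓝 t, dist (γ t) (γ s) ≤ (‖velocity (n := n) γ t‖ + ε) * |s - t| := by
  set x₀ := γ t
  set φ := chartAt 𝔼 x₀
  have hsrc : γ t ∈ φ.source := mem_chart_source 𝔼 x₀
  obtain ⟨u, hu, hvel⟩ := hasDerivWithinAt_chart_velocity x₀ (s := univ) (t := t)
    uniqueDiffWithinAt_univ hγ.mdifferentiableWithinAt hsrc
  rw [hasDerivWithinAt_univ] at hu
  rw [velocityWithin_of_mem_nhds univ_mem] at hvel
  set q : ℝ → 𝔼 := fun τ ↦ φ (γ τ) with hq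
  have hopen : φ.target ×ˢ (univ : Set 𝔼) ∈ 𝓝 (q t, u) :=
    (φ.open_target.prod isOpen_univ).mem_nhds ⟨φ.map_source hsrc, trivial⟩
  have hN : ContinuousAt (fun z : 𝔼 × 𝔼 ↦ ‖(chartVector x₀ z.1 z.2).2‖) (q t, u) :=
    ContinuousOn.continuousAt
      (continuous_norm_snd.comp_continuousOn (continuousOn_chartVector x₀)) hopen
  have hval : ‖(chartVector x₀ (q t) u).2‖ = ‖velocity (n := n) γ t‖ := by
    change ‖(chartVector x₀ (φ (γ t)) u).2‖ = _
    rw [← hvel]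
  have hmem : {z : 𝔼 × 𝔼 | z.1 ∈ φ.target ∧
      ‖(chartVector x₀ z.1 z.2).2‖ < ‖velocity (n := n) γ t‖ + ε} ∈ 𝓝 (q t, u) := by
    filter_upwards [hopen, hN (Iio_mem_nhds (hval.trans_lt (lt_add_of_pos_right _ hε)))] with z hz hz2
    exact ⟨hz.1, hz2⟩
  rw [nhds_prod_eq] at hmem
  obtain ⟨A, hA, B, hB, hAB⟩ := Filter.mem_prod_iff.1 hmem
  obtain ⟨r, hr0, hr⟩ := Metric.mem_nhds_iff.1 hA
  have hslope := hasDerivAt_iff_tendsto_slope.1 hu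
  have h1 : ∀ᶠ s in 𝓝[≠] t, slope q t s ∈ B := hslope hB
  have h2 : ∀ᶠ s in 𝓝 t, q s ∈ Metric.ball (q t) r :=
    hu.continuousAt (Metric.ball_mem_nhds _ hr0)
  have h3 : ∀ᶠ s in 𝓝 t, γ s ∈ φ.source :=
    hγ.continuousAt (φ.open_source.mem_nhds hsrc)
  rw [eventually_nhdsWithin_iff] at h1
  filter_upwards [h1, h2, h3] with s hs1 hs2 hs3
  rcases eq_or_ne s t with rfl | hst
  · rw [sub_self, abs_zero, mul_zero, dist_self]
  have hs1 := hs1 hst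
  have hnn : 0 ≤ ‖velocity (n := n) γ t‖ + ε := by positivity
  have hdist := dist_chart_symm_le x₀ (q₀ := q t) (q₁ := q s)
    (c := (‖velocity (n := n) γ t‖ + ε) * |s - t|) (by positivity) fun y hy ↦ ?_
  · change dist (φ.symm (φ (γ t))) (φ.symm (φ (γ s))) ≤ _ at hdist
    rwa [φ.left_inv hsrc, φ.left_inv hs3] at hdist
  have hyb : y ∈ A := hr ((convex_ball _ _).segment_subset (Metric.mem_ball_self hr0) hs2 hy)
  have hz := hAB (show (y, slope q t s) ∈ A ×ˢ B from ⟨hyb, hs1⟩)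
  refine ⟨hz.1, ?_⟩
  have hsm : q s - q t = (s - t) • slope q t s := by
    rw [slope_def_module, smul_smul, mul_inv_cancel₀ (sub_ne_zero.2 hst), one_smul]
  rw [hsm, norm_chartVector_smul, mul_comm]
  exact mul_le_mul_of_nonneg_right hz.2.le (abs_nonneg _)

/-- The distance to a point is `1`-Lipschitz, so the metric derivative of `γ` bounds that of the
scalar function. This reduces length estimates for absolutely continuous curves to the scalar case.
-/
theorem abs_deriv_dist_le {γ : ℝ → X} {t : ℝ} (x : X)
    (hγ : MDifferentiableAt 𝓘(ℝ, ℝ) (𝓡 n) γ t) {f' : ℝ}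
    (hf : HasDerivAt (fun s ↦ dist x (γ s)) f' t) : |f'| ≤ ‖velocity (n := n) γ t‖ := by
  refine le_of_forall_pos_le_add fun ε hε ↦ ?_
  have h := eventually_dist_le_of_mdifferentiableAt hγ hε
  refine hf.le_of_lip' (by positivity) ?_
  filter_upwards [h] with s hs
  rw [Real.norm_eq_abs, Real.norm_eq_abs]
  refine le_trans ?_ hs
  rw [abs_sub_le_iff]
  constructor
  · linarith [dist_triangle x (γ t) (γ s)]
  · linarith [dist_triangle x (γ s) (γ t), dist_comm (γ s) (γ t)]

/-- An almost shortest curve between two points near `x` stays where the chart distorts norms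
boundedly, so its coordinate length is at most `m⁻¹` times its Riemannian length. As the distance is
an infimum, the estimate is proved for every `d` above it, followed by a limit. -/
theorem exists_lipschitzOnWith_chart (x : X) :
    ∃ K : ℝ≥0, ∃ W ∈ 𝓝 x, LipschitzOnWith K (chartAt 𝔼 x) W := by
  set φ := chartAt 𝔼 x
  obtain ⟨r, hr0, hr⟩ : ∃ r > 0, Metric.closedBall (φ x) r ⊆ φ.target :=
    Metric.nhds_basis_closedBall.mem_iff.1 (chart_target_mem_nhds 𝔼 x)
  obtain ⟨m, hm0, c, -, hb⟩ := exists_norm_chartVector_bounds x (isCompact_closedBall (φ x) r) hr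
  have hW : φ.source ∩ φ ⁻¹' Metric.closedBall (φ x) r ∈ 𝓝 x :=
    inter_mem (chart_source_mem_nhds 𝔼 x)
      (φ.continuousAt (mem_chart_source 𝔼 x) (Metric.closedBall_mem_nhds _ hr0))
  obtain ⟨ρ, hρ0, hρ⟩ := Metric.mem_nhds_iff.1 hW
  -- Points of this ball are less than `ρ / 2` apart, and a curve of length below `ρ / 2` starting
  -- in it stays in the `ρ`-ball.
  refine ⟨⟨m⁻¹, by positivity⟩, Metric.ball x (ρ / 4), Metric.ball_mem_nhds _ (by positivity),
    LipschitzOnWith.of_dist_le_mul fun y hy z hz ↦ ?_⟩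
  change dist (φ y) (φ z) ≤ m⁻¹ * dist y z
  have hyz : dist y z < ρ / 2 := by
    have := dist_triangle_right y z x
    rw [Metric.mem_ball] at hy hz; linarith
  have key : ∀ d : ℝ, dist y z < d → d < ρ / 2 → dist (φ y) (φ z) ≤ m⁻¹ * d := by
    intro d hd hdρ
    have hd0 : 0 < d := dist_nonneg.trans_lt hd
    have hlt : Manifold.riemannianEDist (𝓡 n) y z < ENNReal.ofReal d := by
      rw [← IsRiemannianManifold.out (I := 𝓡 n) y z, edist_dist]
      exact (ENNReal.ofReal_lt_ofReal_iff hd0).2 hd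
    obtain ⟨γ, h0, h1, hγ, hlen⟩ := Manifold.exists_lt_of_riemannianEDist_lt hlt
    have hin : ∀ t ∈ Icc (0 : ℝ) 1, γ t ∈ φ.source ∩ φ ⁻¹' Metric.closedBall (φ x) r := by
      intro t ht
      apply hρ
      have h2 : edist (γ 0) (γ t) ≤ ENNReal.ofReal d := by
        rw [IsRiemannianManifold.out (I := 𝓡 n)]
        exact ((Manifold.riemannianEDist_le_pathELength (hγ.mono (Icc_subset_Icc_right ht.2))
          rfl rfl ht.1).trans (Manifold.pathELength_mono le_rfl ht.2)).trans hlen.le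
      rw [edist_dist, ENNReal.ofReal_le_ofReal_iff hd0.le, h0] at h2
      rw [Metric.mem_ball] at hy ⊢
      linarith [dist_triangle_left (γ t) x y]
    have hq : ContDiffOn ℝ 1 (fun t ↦ φ (γ t)) (Icc 0 1) := by
      rw [← contMDiffOn_iff_contDiffOn]
      exact (contMDiffOn_chart_one x).comp hγ fun t ht ↦ (hin t ht).1
    have hle := enorm_sub_le_lintegral_derivWithin_Icc_of_contDiffOn_Icc hq zero_le_one
    have hle2 : ∫⁻ t in Icc (0 : ℝ) 1, ‖derivWithin (fun t ↦ φ (γ t)) (Icc 0 1) t‖ₑ ≤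
        ENNReal.ofReal m⁻¹ * Manifold.pathELength (𝓡 n) γ 0 1 := by
      rw [pathELength_eq_velocityWithin, ← lintegral_const_mul' _ _ ENNReal.ofReal_ne_top]
      refine setLIntegral_mono' measurableSet_Icc fun t ht ↦ ?_
      have hU := uniqueDiffOn_Icc (zero_lt_one (α := ℝ)) t ht
      obtain ⟨u, hu, hv⟩ := hasDerivWithinAt_chart_velocity x hU
        (hγ.mdifferentiableOn one_ne_zero t ht) (hin t ht).1
      rw [hu.derivWithin hU, ← ENNReal.ofReal_mul (by positivity), hv, ← ofReal_norm]
      apply ENNReal.ofReal_le_ofReal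
      rw [le_inv_mul_iff₀ hm0]
      exact (hb _ (hin t ht).2 u).1
    rw [h0, h1] at hle
    have hle3 := (hle.trans hle2).trans (mul_le_mul_right hlen.le _)
    rw [← ofReal_norm, ← ENNReal.ofReal_mul (by positivity),
      ENNReal.ofReal_le_ofReal_iff (by positivity)] at hle3
    rwa [dist_comm, dist_eq_norm]
  have hlim : Tendsto (fun d ↦ m⁻¹ * d) (𝓝[>] (dist y z)) (𝓝 (m⁻¹ * dist y z)) :=
    ((continuous_const.mul continuous_id).tendsto _).mono_left nhdsWithin_le_nhds
  refine ge_of_tendsto hlim ?_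
  filter_upwards [Ioo_mem_nhdsGT hyz] with d hd using key d hd.1 hd.2

theorem locallyLipschitzOn_of_contMDiffOn {f : X → 𝔼} {O : Set X} (hO : IsOpen O)
    (hf : ContMDiffOn (𝓡 n) 𝓘(ℝ, 𝔼) 1 f O) : LocallyLipschitzOn O f := by
  intro x hx
  set φ := chartAt 𝔼 x
  obtain ⟨K, W, hW, hK⟩ := exists_lipschitzOnWith_chart (n := n) x
  have hg : ContDiffAt ℝ 1 (fun q ↦ f (φ.symm q)) (φ x) := by
    rw [← contMDiffAt_iff_contDiffAt]
    have h1 : ContMDiffAt (𝓡 n) 𝓘(ℝ, 𝔼) 1 f (φ.symm (φ x)) := by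
      rw [φ.left_inv (mem_chart_source 𝔼 x)]
      exact (hf x hx).contMDiffAt (hO.mem_nhds hx)
    exact h1.comp (φ x) ((contMDiffOn_chart_symm_one x _ (mem_chart_target 𝔼 x)).contMDiffAt
      (chart_target_mem_nhds 𝔼 x))
  obtain ⟨K', S, hS, hK'⟩ := hg.exists_lipschitzOnWith
  refine ⟨K' * K, W ∩ (φ.source ∩ φ ⁻¹' S), ?_, ?_⟩
  · apply mem_nhdsWithin_of_mem_nhds
    exact inter_mem hW (inter_mem (chart_source_mem_nhds 𝔼 x)
      (φ.continuousAt (mem_chart_source 𝔼 x) hS))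
  · have h := hK'.comp (hK.mono inter_subset_left) (s := W ∩ (φ.source ∩ φ ⁻¹' S))
      (fun y hy ↦ hy.2.2)
    intro y hy z hz
    have := h hy hz
    simp only [Function.comp_apply] at this
    rwa [φ.left_inv hy.2.1, φ.left_inv hz.2.1] at this

theorem _root_.AbsolutelyContinuousOnInterval.comp_contMDiffOn {γ : ℝ → X} {a b : ℝ}
    (hγ : AbsolutelyContinuousOnInterval γ a b) {f : X → 𝔼} {O : Set X} (hO : IsOpen O)
    (hf : ContMDiffOn (𝓡 n) 𝓘(ℝ, 𝔼) 1 f O) (hm : MapsTo γ (uIcc a b) O) :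
    AbsolutelyContinuousOnInterval (fun t ↦ f (γ t)) a b := by
  have hc : IsCompact (γ '' uIcc a b) := isCompact_uIcc.image_of_continuousOn hγ.continuousOn_metric
  obtain ⟨K, hK⟩ := LocallyLipschitzOn.exists_lipschitzOnWith_of_compact hc
    ((locallyLipschitzOn_of_contMDiffOn hO hf).mono hm.image_subset)
  exact hγ.lipschitz_comp hK

/-- An absolutely continuous curve is differentiable almost everywhere. -/
theorem ae_mdifferentiableAt {γ : ℝ → X} {a b : ℝ} (hab : a ≤ b)
    (hγ : AbsolutelyContinuousOnInterval γ a b) :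
    ∀ᵐ t, t ∈ Ioo a b → MDifferentiableAt 𝓘(ℝ, ℝ) (𝓡 n) γ t := by
  have hcont : ContinuousOn γ (Icc a b) := by
    have := hγ.continuousOn_metric; rwa [uIcc_of_le hab] at this
  rw [ae_iff]
  refine measure_null_of_locally_null _ fun t ht ↦ ?_
  have htI : t ∈ Ioo a b := by by_contra h; exact ht fun h' ↦ absurd h' h
  set φ := chartAt 𝔼 (γ t)
  have hcAt : ContinuousAt γ t := hcont.continuousAt (Icc_mem_nhds htI.1 htI.2)
  have h1 : {s | s ∈ Ioo a b ∧ γ s ∈ φ.source} ∈ 𝓝 t :=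
    inter_mem (Ioo_mem_nhds htI.1 htI.2) (hcAt (chart_source_mem_nhds 𝔼 (γ t)))
  obtain ⟨δ, hδ0, hδ⟩ := Metric.nhds_basis_closedBall.mem_iff.1 h1
  rw [Real.closedBall_eq_Icc] at hδ
  have hsub : Icc (t - δ) (t + δ) ⊆ Icc a b := fun s hs ↦ Ioo_subset_Icc_self (hδ hs).1
  have hγ' : AbsolutelyContinuousOnInterval γ (t - δ) (t + δ) :=
    hγ.mono (by rw [uIcc_of_le hab, uIcc_of_le (by linarith)]; exact hsub)
  have hq := hγ'.comp_contMDiffOn φ.open_source (contMDiffOn_chart_one (γ t)) (fun s hs ↦ by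
    rw [uIcc_of_le (by linarith)] at hs; exact (hδ hs).2)
  refine ⟨_, inter_mem_nhdsWithin _ (Ioo_mem_nhds (sub_lt_self t hδ0) (lt_add_of_pos_right t hδ0)), ?_⟩
  refine measure_mono_null ?_ (ae_iff.1 hq.ae_hasDerivAt)
  rintro s ⟨hs1, hs2⟩ hs3
  have hs2' : s ∈ Icc (t - δ) (t + δ) := ⟨hs2.1.le, hs2.2.le⟩
  apply hs1
  intro hsI
  have hd := hs3 (by rwa [uIcc_of_le (by linarith)])
  rw [← mdifferentiableWithinAt_univ]
  exact (velocityWithin_eq_chartVector (γ t) uniqueDiffWithinAt_univ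
    (hcont.continuousAt (Icc_mem_nhds hsI.1 hsI.2)).continuousWithinAt (hδ hs2').2
    hd.hasDerivWithinAt).1

end Distance

end Lagrangian


/-! ### Time shifts, reparametrization and additivity of the action -/

namespace AbsolutelyContinuousOnInterval

variable {X : Type*} [PseudoMetricSpace X]

theorem comp_add_right {γ : ℝ → X} {a b : ℝ} (m : ℝ)
    (hγ : AbsolutelyContinuousOnInterval γ (a + m) (b + m)) :
    AbsolutelyContinuousOnInterval (fun t ↦ γ (t + m)) a b := by
  have hu : ∀ t ∈ uIcc a b, t + m ∈ uIcc (a + m) (b + m) := fun t ht ↦ by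
    rw [← image_add_const_uIcc]; exact mem_image_of_mem _ ht
  rw [absolutelyContinuousOnInterval_iff] at hγ ⊢
  intro ε hε
  obtain ⟨δ, hδ, h⟩ := hγ ε hε
  refine ⟨δ, hδ, fun E hE hlen ↦ ?_⟩
  refine h (E.1, fun i ↦ ((E.2 i).1 + m, (E.2 i).2 + m)) ⟨fun i hi ↦ ?_, fun i hi j hj hij ↦ ?_⟩ ?_
  · exact ⟨hu _ (hE.1 i hi).1, hu _ (hE.1 i hi).2⟩
  · have := hE.2 hi hj hij
    have key : ∀ {x y t : ℝ}, t ∈ uIoc (x + m) (y + m) → t - m ∈ uIoc x y := fun {x y t} ht ↦ by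
      rw [mem_uIoc] at ht ⊢
      rcases ht with ht | ht
      · exact Or.inl ⟨by linarith, by linarith⟩
      · exact Or.inr ⟨by linarith, by linarith⟩
    exact disjoint_left.2 fun t h1 h2 ↦ disjoint_left.1 this (key h1) (key h2)
  · simpa using hlen

end AbsolutelyContinuousOnInterval

namespace Lagrangian

section VelocityComp

variable {n : ℕ} {M : Type*} [TopologicalSpace M] [ChartedSpace (EuclideanSpace ℝ (Fin n)) M]

theorem velocity_comp {γ : ℝ → M} {ρ : ℝ → ℝ} {ρ' t : ℝ}
    (hγ : MDifferentiableAt 𝓘(ℝ, ℝ) (𝓡 n) γ (ρ t)) (hρ : HasDerivAt ρ ρ' t) :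
    velocity (n := n) (fun s ↦ γ (ρ s)) t = ρ' • velocity (n := n) γ (ρ t) := by
  have hρ' : HasMFDerivAt 𝓘(ℝ, ℝ) 𝓘(ℝ, ℝ) ρ t (ContinuousLinearMap.toSpanSingleton ℝ ρ') :=
    hasMFDerivAt_iff_hasFDerivAt.2 hρ.hasFDerivAt
  have h := hγ.hasMFDerivAt.comp t hρ'
  have h2 : velocity (n := n) (γ ∘ ρ) t = mfderiv 𝓘(ℝ, ℝ) (𝓡 n) γ (ρ t) ρ' := by
    rw [velocity, h.mfderiv]
    change mfderiv 𝓘(ℝ, ℝ) (𝓡 n) γ (ρ t) ((ContinuousLinearMap.toSpanSingleton ℝ ρ') (1 : ℝ)) = _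
    rw [ContinuousLinearMap.toSpanSingleton_apply, one_smul]
  change velocity (n := n) (γ ∘ ρ) t = _
  rw [h2]
  have h3 : (ρ' : ℝ) = ρ' • (1 : ℝ) := by simp
  conv_lhs => rw [h3]
  exact map_smul (mfderiv 𝓘(ℝ, ℝ) (𝓡 n) γ (ρ t)) ρ' (1 : ℝ)

theorem velocity_comp_add_right (γ : ℝ → M) (m t : ℝ) :
    velocity (n := n) (fun s ↦ γ (s + m)) t = velocity (n := n) γ (t + m) := by
  by_cases h : MDifferentiableAt 𝓘(ℝ, ℝ) (𝓡 n) γ (t + m)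
  · rw [velocity_comp (ρ := fun s ↦ s + m) h ((hasDerivAt_id t).add_const m), one_smul]
  · have h' : ¬ MDifferentiableAt 𝓘(ℝ, ℝ) (𝓡 n) (fun s ↦ γ (s + m)) t := by
      intro h2
      apply h
      have h3 : MDifferentiableAt 𝓘(ℝ, ℝ) 𝓘(ℝ, ℝ) (fun s : ℝ ↦ s - m) (t + m) :=
        mdifferentiableAt_iff_differentiableAt.2 (by fun_prop)
      have h4 : MDifferentiableAt 𝓘(ℝ, ℝ) (𝓡 n) (fun s ↦ γ (s + m)) (t + m - m) := by
        simpa using h2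
      have h5 := h4.comp (t + m) h3
      simpa [Function.comp_def] using h5
    rw [velocity, velocity, mfderiv_zero_of_not_mdifferentiableAt h,
      mfderiv_zero_of_not_mdifferentiableAt h']
    rfl

end VelocityComp

section Action

variable {n : ℕ} {X : Type*} [TopologicalSpace X] [ChartedSpace (EuclideanSpace ℝ (Fin n)) X]
  {L : TangentBundle (𝓡 n) X → ℝ → ℝ} {γ γ' : ℝ → X} {a b c : ℝ}

/-- The endpoints are a null set, and inside the interval the velocity no longer refers to the
segment. Additivity, monotonicity and shift invariance of the action are read off from this form. -/
theorem action_eq_Ioo : action L γ a b =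
    ∫⁻ t in Ioo a b, ENNReal.ofReal (L ⟨γ t, velocity γ t⟩ t) := by
  rw [action, ← restrict_Ioo_eq_restrict_Icc]
  refine setLIntegral_congr_fun measurableSet_Ioo fun t ht ↦ ?_
  have := velocityWithin_of_mem_nhds (n := n) (γ := γ) (Icc_mem_nhds ht.1 ht.2)
  rw [velocityWithin] at this
  simp only [segVelocity]
  rw [this]

theorem action_eq_Icc : action L γ a b =
    ∫⁻ t in Icc a b, ENNReal.ofReal (L ⟨γ t, velocity γ t⟩ t) := by
  rw [action_eq_Ioo, restrict_Ioo_eq_restrict_Icc]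

theorem action_congr (h : EqOn γ γ' (Icc a b)) : action L γ a b = action L γ' a b := by
  rw [action_eq_Ioo, action_eq_Ioo]
  refine setLIntegral_congr_fun measurableSet_Ioo fun t ht ↦ ?_
  have h1 : γ =ᶠ[𝓝 t] γ' := by
    filter_upwards [Icc_mem_nhds ht.1 ht.2] with s hs using h hs
  have h2 : (⟨γ t, velocity γ t⟩ : TangentBundle (𝓡 n) X) = ⟨γ' t, velocity γ' t⟩ := by
    refine Bundle.TotalSpace.ext h1.eq_of_nhds ?_
    apply heq_of_eq
    exact congrArg (fun A : ℝ →L[ℝ] EuclideanSpace ℝ (Fin n) ↦ A 1)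
      (Filter.EventuallyEq.mfderiv_eq (I := 𝓘(ℝ, ℝ)) (I' := 𝓡 n) h1)
  simp only [h2]

theorem action_self : action L γ a a = 0 := by
  rw [action_eq_Ioo]; simp

theorem action_add (hab : a ≤ b) (hbc : b ≤ c) :
    action L γ a c = action L γ a b + action L γ b c := by
  rw [action_eq_Icc, action_eq_Icc, action_eq_Icc, ← Icc_union_Ioc_eq_Icc hab hbc,
    lintegral_union measurableSet_Ioc, restrict_Ioc_eq_restrict_Icc]
  exact disjoint_left.2 fun t ht ht' ↦ (ht.2.trans_lt ht'.1).false

theorem action_mono {a' b' : ℝ} (ha : a ≤ a') (hb : b' ≤ b) :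
    action L γ a' b' ≤ action L γ a b := by
  rw [action_eq_Icc, action_eq_Icc]
  exact lintegral_mono_set (Icc_subset_Icc ha hb)

theorem action_comp_add_right {m : ℝ} (hL : ∀ z t, L z (t + m) = L z t) :
    action L (fun t ↦ γ (t + m)) a b = action L γ (a + m) (b + m) := by
  rw [action_eq_Ioo, action_eq_Ioo, ← (measurePreserving_add_right volume m
    ).setLIntegral_comp_preimage_emb (measurableEmbedding_addRight m)
    (fun t ↦ ENNReal.ofReal (L ⟨γ t, velocity γ t⟩ t)) (Ioo (a + m) (b + m))]
  have : (fun t ↦ t + m) ⁻¹' Ioo (a + m) (b + m) = Ioo a b := by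
    ext t; simp
  rw [this]
  refine setLIntegral_congr_fun measurableSet_Ioo fun t _ ↦ ?_
  simp only [velocity_comp_add_right, hL]

end Action

/-! ### Lower and upper bounds of the action by the displacement -/

section Bounds

variable {n : ℕ} {X : Type*} [MetricSpace X] [ChartedSpace (EuclideanSpace ℝ (Fin n)) X]
  [IsManifold (𝓡 n) ∞ X]
  [Bundle.RiemannianBundle (fun x : X => TangentSpace (𝓡 n) x)]
  [IsContinuousRiemannianBundle (EuclideanSpace ℝ (Fin n)) (fun x : X => TangentSpace (𝓡 n) x)]
  [IsRiemannianManifold (𝓡 n) X]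
  {L : TangentBundle (𝓡 n) X → ℝ → ℝ}

local notation "𝔼" => EuclideanSpace ℝ (Fin n)

/-- Cauchy–Schwarz for the derivative of `s ↦ dist (γ c) (γ s)`, a scalar absolutely continuous
function whose derivative is almost everywhere at most the speed. -/
theorem mul_dist_sq_le_action {C : ℝ} (hC : 0 ≤ C) (hL : ∀ z t, C * ‖z.2‖ ^ 2 ≤ L z t)
    {γ : ℝ → X} {c d : ℝ} (hcd : c ≤ d) (hγ : AbsolutelyContinuousOnInterval γ c d) :
    ENNReal.ofReal (C * dist (γ c) (γ d) ^ 2) ≤ ENNReal.ofReal (d - c) * action L γ c d := by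
  rcases hcd.eq_or_lt with rfl | hcd
  · simp
  rcases hC.eq_or_lt with rfl | hC
  · simp
  by_cases htop : action L γ c d = ⊤
  · rw [htop, ENNReal.mul_top]
    · exact le_top
    · simpa using hcd
  set f : ℝ → ℝ := fun s ↦ dist (γ c) (γ s)
  have hf : AbsolutelyContinuousOnInterval f c d := hγ.dist_left (γ c)
  have hae : ∀ᵐ t, t ∈ Ioo c d → |deriv f t| ≤ ‖velocity (n := n) γ t‖ := by
    filter_upwards [hf.ae_differentiableAt, ae_mdifferentiableAt (n := n) hcd.le hγ] with t h1 h2 ht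
    exact abs_deriv_dist_le (γ c) (h2 ht)
      (h1 (by rw [uIcc_of_le hcd.le]; exact Ioo_subset_Icc_self ht)).hasDerivAt
  have hle : ∫⁻ t in Ioo c d, ENNReal.ofReal (C * deriv f t ^ 2) ≤ action L γ c d := by
    rw [action_eq_Ioo]
    refine lintegral_mono_ae ?_
    refine (ae_restrict_iff' measurableSet_Ioo).2 ?_
    filter_upwards [hae] with t ht htI
    apply ENNReal.ofReal_le_ofReal
    refine le_trans ?_ (hL _ t)
    gcongr 1
    exact sq_le_sq.2 (by rw [abs_norm]; exact ht htI)
  have hm : Measurable (deriv f) := measurable_deriv f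
  have hint : Integrable (fun t ↦ C * deriv f t ^ 2) (volume.restrict (Ioo c d)) := by
    refine ⟨by fun_prop, ?_⟩
    rw [hasFiniteIntegral_iff_ofReal (ae_of_all _ fun t ↦ by positivity)]
    exact hle.trans_lt (Ne.lt_top htop)
  have hint2 : Integrable (fun t ↦ deriv f t ^ 2) (volume.restrict (Ioo c d)) := by
    have := hint.const_mul C⁻¹
    simpa [← mul_assoc, inv_mul_cancel₀ hC.ne'] using this
  have hint1 : Integrable (deriv f) (volume.restrict (Ioo c d)) := by
    have := hf.intervalIntegrable_deriv
    rw [intervalIntegrable_iff_integrableOn_Ioo_of_le hcd.le] at this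
    exact this
  have hval : ∫ t in Ioo c d, deriv f t = dist (γ c) (γ d) := by
    have := hf.integral_deriv_eq_sub
    rw [intervalIntegral.integral_of_le hcd.le, integral_Ioc_eq_integral_Ioo] at this
    simpa [f] using this
  have hCS := sq_integral_le hint1 hint2
  rw [hval, measureReal_restrict_apply_univ, Real.volume_real_Ioo_of_le hcd.le] at hCS
  calc ENNReal.ofReal (C * dist (γ c) (γ d) ^ 2)
      ≤ ENNReal.ofReal ((d - c) * ∫ t in Ioo c d, C * deriv f t ^ 2) := by
        apply ENNReal.ofReal_le_ofReal
        rw [integral_const_mul]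
        calc C * dist (γ c) (γ d) ^ 2 ≤ C * ((d - c) * ∫ t in Ioo c d, deriv f t ^ 2) := by gcongr
          _ = _ := by ring
    _ = ENNReal.ofReal (d - c) * ∫⁻ t in Ioo c d, ENNReal.ofReal (C * deriv f t ^ 2) := by
        rw [ENNReal.ofReal_mul (sub_nonneg.2 hcd.le),
          ofReal_integral_eq_lintegral_ofReal hint (ae_of_all _ fun t ↦ by positivity)]
    _ ≤ _ := mul_le_mul_right hle _

omit [IsManifold (𝓡 n) ∞ X] [IsContinuousRiemannianBundle 𝔼 (fun x : X => TangentSpace (𝓡 n) x)]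
  [IsRiemannianManifold (𝓡 n) X] in
theorem action_le_of_norm_velocity_le {V A : ℝ} (hA : 0 ≤ A) (hL : ∀ z t, ‖z.2‖ ≤ V → L z t ≤ A)
    {γ : ℝ → X} {c d : ℝ} (hγ : ∀ t ∈ Ioo c d, ‖velocity (n := n) γ t‖ ≤ V) :
    action L γ c d ≤ ENNReal.ofReal (A * (d - c)) := by
  rw [action_eq_Ioo]
  calc _ ≤ ∫⁻ _ in Ioo c d, ENNReal.ofReal A :=
        setLIntegral_mono' measurableSet_Ioo fun t ht ↦ ENNReal.ofReal_le_ofReal (hL _ _ (hγ t ht))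
    _ = _ := by rw [setLIntegral_const, Real.volume_Ioo, ENNReal.ofReal_mul hA]

/-- Two points are joined by a `C¹` curve whose speed is bounded by any number larger than the
average displacement. -/
theorem exists_curve_norm_velocity_le {x y : X} {V c d : ℝ} (hcd : c < d)
    (hxy : dist x y < V * (d - c)) :
    ∃ β : ℝ → X, ContMDiff 𝓘(ℝ, ℝ) (𝓡 n) 1 β ∧ β c = x ∧ β d = y ∧
      ∀ t, ‖velocity (n := n) β t‖ ≤ V := by
  have hpos : 0 < V * (d - c) := dist_nonneg.trans_lt hxy
  have hV : 0 < V := pos_of_mul_pos_left hpos (sub_nonneg.2 hcd.le)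
  have hlt : Manifold.riemannianEDist (𝓡 n) x y < ENNReal.ofReal (V * (d - c)) := by
    rw [← IsRiemannianManifold.out (I := 𝓡 n) x y, edist_dist]
    exact (ENNReal.ofReal_lt_ofReal_iff hpos).2 hxy
  obtain ⟨γ, h0, h1, hγ, hlen, -, -⟩ :=
    Manifold.exists_lt_locally_constant_of_riemannianEDist_lt hlt zero_lt_one
  have hvc : Continuous fun t ↦ ‖velocity (n := n) γ t‖ := by
    have h2 : Continuous (fun t : ℝ ↦ (⟨t, (1 : ℝ)⟩ : TangentBundle 𝓘(ℝ, ℝ) ℝ)) :=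
      (tangentBundleModelSpaceHomeomorph 𝓘(ℝ, ℝ)).symm.continuous.comp
        (Continuous.prodMk continuous_id (continuous_const (y := (1 : ℝ))))
    exact continuous_norm_snd.comp ((hγ.continuous_tangentMap le_rfl).comp h2)
  have hint : Integrable (fun t ↦ ‖velocity (n := n) γ t‖) (volume.restrict (Ioc 0 1)) :=
    hvc.integrableOn_Ioc
  set ℓ : ℝ := ∫ t in (0 : ℝ)..1, ‖velocity (n := n) γ t‖ with hℓ
  have hℓlt : ℓ < V * (d - c) := by
    rw [← ENNReal.ofReal_lt_ofReal_iff hpos]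
    refine lt_of_eq_of_lt ?_ hlen
    rw [hℓ, intervalIntegral.integral_of_le zero_le_one,
      ofReal_integral_eq_lintegral_ofReal hint (ae_of_all _ fun t ↦ norm_nonneg _),
      restrict_Ioc_eq_restrict_Icc, Manifold.pathELength_eq_lintegral_mfderiv_Icc]
    exact lintegral_congr fun t ↦ ofReal_norm _
  -- The unused length is spread over the curve: adding `δ` to the speed makes the density `G`
  -- positive even where `γ` stops, and gives it total mass exactly `V * (d - c)`. The
  -- reparametrized speed is `V‖γ'‖ / (‖γ'‖ + δ) ≤ V`.
  set δ : ℝ := V * (d - c) - ℓ with hδ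
  have hδ0 : 0 < δ := sub_pos.2 hℓlt
  set G : ℝ → ℝ := fun t ↦ ‖velocity (n := n) γ t‖ + δ
  have hG : Continuous G := hvc.add continuous_const
  have hGpos : ∀ t, 0 < G t := fun t ↦ by positivity
  set S : ℝ → ℝ := fun τ ↦ ∫ t in (0 : ℝ)..τ, G t
  have hS : ∀ τ, HasDerivAt S (G τ) τ := fun τ ↦
    intervalIntegral.integral_hasDerivAt_right (hG.intervalIntegrable _ _)
      hG.aestronglyMeasurable.stronglyMeasurableAtFilter hG.continuousAt
  have hSmono : StrictMono S := strictMono_of_hasDerivAt_pos hS hGpos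
  have hS0 : S 0 = 0 := intervalIntegral.integral_same
  have hS1 : S 1 = V * (d - c) := by
    simp only [S, G]
    rw [intervalIntegral.integral_add (hvc.intervalIntegrable _ _)
      (continuous_const.intervalIntegrable _ _)]
    simp [hδ, hℓ]
  have hmono : Monotone fun τ ↦ S τ - δ * τ := by
    refine monotone_of_hasDerivAt_nonneg (f' := fun τ ↦ G τ - δ * 1)
      (fun τ ↦ (hS τ).fun_sub ((hasDerivAt_id τ).const_mul δ)) fun τ ↦ ?_
    simp [G]
  have hScont : Continuous S := continuous_iff_continuousAt.2 fun τ ↦ (hS τ).continuousAt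
  have hsurj : Function.Surjective S := by
    refine hScont.surjective ?_ ?_
    · refine tendsto_atTop_mono' atTop ?_ (tendsto_id.const_mul_atTop hδ0)
      filter_upwards [eventually_ge_atTop 0] with τ hτ
      have := hmono hτ
      simp only [hS0] at this
      simp only [id]; linarith
    · refine tendsto_atBot_mono' atBot ?_ (tendsto_id.const_mul_atBot hδ0)
      filter_upwards [eventually_le_atBot 0] with τ hτ
      have := hmono hτ
      simp only [hS0] at this
      simp only [id]; linarith
  set Φ : ℝ ≃ₜ ℝ := (hSmono.orderIsoOfSurjective S hsurj).toHomeomorph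
  have hΦ : (Φ : ℝ → ℝ) = S := rfl
  have hSC : ContDiff ℝ 1 S := by
    rw [contDiff_one_iff_deriv]
    refine ⟨fun τ ↦ (hS τ).differentiableAt, ?_⟩
    have : deriv S = G := funext fun τ ↦ (hS τ).deriv
    rwa [this]
  have hΦC : ContDiff ℝ 1 Φ.symm :=
    Φ.contDiff_symm_deriv (fun τ ↦ (hGpos τ).ne') hS hSC
  have hΦd : ∀ s, HasDerivAt Φ.symm (G (Φ.symm s))⁻¹ s := fun s ↦
    HasDerivAt.of_local_left_inverse Φ.symm.continuous.continuousAt (hS (Φ.symm s))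
      (hGpos _).ne' (Eventually.of_forall Φ.apply_symm_apply)
  set ρ : ℝ → ℝ := fun s ↦ Φ.symm (V * (s - c))
  have hρC : ContDiff ℝ 1 ρ := hΦC.comp (by fun_prop)
  have hρd : ∀ s, HasDerivAt ρ ((G (ρ s))⁻¹ * (V * 1)) s := fun s ↦
    (hΦd _).comp s (((hasDerivAt_id s).sub_const c).const_mul V)
  have hρc : ρ c = 0 := by
    simp only [ρ, sub_self, mul_zero]
    exact Φ.symm_apply_eq.2 hS0.symm
  have hρd1 : ρ d = 1 := by
    simp only [ρ]
    exact Φ.symm_apply_eq.2 hS1.symm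
  refine ⟨fun s ↦ γ (ρ s), hγ.comp (contMDiff_iff_contDiff.2 hρC), by simp only [hρc, h0],
    by simp only [hρd1, h1], fun t ↦ ?_⟩
  rw [velocity_comp (hγ.mdifferentiable one_ne_zero _) (hρd t), norm_smul, Real.norm_eq_abs,
    abs_of_nonneg (by have := hGpos (ρ t); positivity), mul_one, mul_assoc,
    inv_mul_le_iff₀ (hGpos _), mul_comm]
  gcongr
  simp only [G]; linarith

/-- The speed `V + 1` makes the displacement bound strict, since shortest curves need not be
available. -/
theorem exists_action_le {V A c d : ℝ} (hA : 0 ≤ A) (hL : ∀ z t, ‖z.2‖ ≤ V + 1 → L z t ≤ A)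
    {x y : X} (hcd : c < d) (hxy : dist x y ≤ V * (d - c)) :
    ∃ β : ℝ → X, AbsolutelyContinuousOnInterval β c d ∧ β c = x ∧ β d = y ∧
      action L β c d ≤ ENNReal.ofReal (A * (d - c)) := by
  obtain ⟨β, hβ, h1, h2, h3⟩ := exists_curve_norm_velocity_le (n := n) (V := V + 1) hcd
    (hxy.trans_lt (by nlinarith))
  exact ⟨β, hβ.contMDiffOn.absolutelyContinuousOnInterval hcd, h1, h2,
    action_le_of_norm_velocity_le hA hL fun t _ ↦ h3 t⟩

end Bounds

end Lagrangian


/-! ### The action potential, and the displacement estimates for minimizers -/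

namespace Lagrangian

section Potential

variable {n : ℕ} {X : Type*} [MetricSpace X] [ChartedSpace (EuclideanSpace ℝ (Fin n)) X]

/-- The least action of curves from `x` at time `c` to `y` at time `d`. -/
noncomputable def potential (L : TangentBundle (𝓡 n) X → ℝ → ℝ) (c d : ℝ) (x y : X) : ℝ≥0∞ :=
  ⨅ β : ℝ → X, ⨅ _ : AbsolutelyContinuousOnInterval β c d ∧ β c = x ∧ β d = y, action L β c d

variable {L : TangentBundle (𝓡 n) X → ℝ → ℝ}

theorem potential_le {β : ℝ → X} {c d : ℝ} (hβ : AbsolutelyContinuousOnInterval β c d) :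
    potential L c d (β c) (β d) ≤ action L β c d :=
  iInf₂_le β ⟨hβ, rfl, rfl⟩

theorem exists_gluing {β β' : ℝ → X} {a b c : ℝ} (hab : a ≤ b) (hbc : b ≤ c)
    (hβ : AbsolutelyContinuousOnInterval β a b) (hβ' : AbsolutelyContinuousOnInterval β' b c)
    (h : β b = β' b) :
    ∃ η : ℝ → X, AbsolutelyContinuousOnInterval η a c ∧ EqOn η β (Icc a b) ∧
      EqOn η β' (Icc b c) := by
  set η : ℝ → X := fun t ↦ if t ≤ b then β t else β' t
  have h1 : EqOn η β (Icc a b) := fun t ht ↦ if_pos ht.2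
  have h2 : EqOn η β' (Icc b c) := fun t ht ↦ by
    rcases ht.1.eq_or_lt with rfl | hlt
    · simpa [η] using h
    · exact if_neg (not_le.2 hlt)
  exact ⟨η, AbsolutelyContinuousOnInterval.trans hab hbc
    (hβ.congr (by rwa [uIcc_of_le hab])) (hβ'.congr (by rwa [uIcc_of_le hbc])), h1, h2⟩

theorem potential_triangle {a b c : ℝ} (hab : a ≤ b) (hbc : b ≤ c) (x y z : X) :
    potential L a c x z ≤ potential L a b x y + potential L b c y z := by
  simp only [potential, ENNReal.iInf_add, ENNReal.add_iInf]
  refine le_iInf fun β' ↦ le_iInf fun hβ' ↦ le_iInf fun β ↦ le_iInf fun hβ ↦ ?_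
  obtain ⟨η, hη, h1, h2⟩ := exists_gluing hab hbc hβ.1 hβ'.1 (hβ.2.2.trans hβ'.2.1.symm)
  refine (iInf₂_le η ⟨hη, (h1 (left_mem_Icc.2 hab)).trans hβ.2.1,
    (h2 (right_mem_Icc.2 hbc)).trans hβ'.2.2⟩).trans ?_
  rw [action_add hab hbc, action_congr h1, action_congr h2]

/-- The shift `m` may be negative, so this inequality also yields the reverse one. -/
theorem potential_add_le {m : ℝ} (hL : ∀ z t, L z (t + m) = L z t) (c d : ℝ) (x y : X) :
    potential L c d x y ≤ potential L (c + m) (d + m) x y := by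
  refine le_iInf₂ fun β hβ ↦ ?_
  refine (iInf₂_le (fun t ↦ β (t + m)) ⟨hβ.1.comp_add_right m, hβ.2.1, hβ.2.2⟩).trans ?_
  rw [action_comp_add_right hL]

/-- A better curve on `[c, d]` could be glued into `γ`. Finite action is needed to cancel the two
outer pieces in `[0, ∞]`. -/
theorem IsMinimizingSegment.restrict {γ : ℝ → X} {a b c d : ℝ} (h : IsMinimizingSegment L γ a b)
    (hac : a ≤ c) (hcd : c ≤ d) (hdb : d ≤ b) (hfin : action L γ a b ≠ ⊤) :
    IsMinimizingSegment L γ c d := by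
  have hab : a ≤ b := hac.trans (hcd.trans hdb)
  have hmono : ∀ {c' d'}, a ≤ c' → c' ≤ d' → d' ≤ b → AbsolutelyContinuousOnInterval γ c' d' :=
    fun h1 h2 h3 ↦ h.1.mono (by
      rw [uIcc_of_le h2, uIcc_of_le hab]; exact Icc_subset_Icc h1 h3)
  refine ⟨hmono hac hcd hdb, fun β hβ hc hd ↦ ?_⟩
  obtain ⟨η₁, hη₁, h1, h2⟩ := exists_gluing hac hcd (hmono le_rfl hac (hcd.trans hdb)) hβ hc.symm
  have hη₁d : η₁ d = γ d := (h2 (right_mem_Icc.2 hcd)).trans hd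
  obtain ⟨η, hη, h3, h4⟩ := exists_gluing (hac.trans hcd) hdb hη₁
    (hmono (hac.trans hcd) hdb le_rfl) hη₁d
  have e1 : EqOn η γ (Icc a c) := fun t ht ↦ (h3 ⟨ht.1, ht.2.trans hcd⟩).trans (h1 ht)
  have e2 : EqOn η β (Icc c d) := fun t ht ↦ (h3 ⟨hac.trans ht.1, ht.2⟩).trans (h2 ht)
  have hle := h.2 η hη (e1 (left_mem_Icc.2 hac)) (h4 (right_mem_Icc.2 hdb))
  rw [action_add hac (hcd.trans hdb), action_add hcd hdb] at hle
  rw [action_add (γ := η) hac (hcd.trans hdb), action_add (γ := η) hcd hdb, action_congr e1,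
    action_congr e2, action_congr h4] at hle
  have f1 : action L γ a c ≠ ⊤ := ne_top_of_le_ne_top hfin (action_mono le_rfl (hcd.trans hdb))
  have f2 : action L γ d b ≠ ⊤ := ne_top_of_le_ne_top hfin (action_mono (hac.trans hcd) le_rfl)
  exact (ENNReal.add_le_add_iff_right f2).1 ((ENNReal.add_le_add_iff_left f1).1 hle)

/-- Periodicity and two-sided growth bounds of a Lagrangian. -/
structure HasGrowth [Bundle.RiemannianBundle (fun x : X => TangentSpace (𝓡 n) x)]
    (L : TangentBundle (𝓡 n) X → ℝ → ℝ) (A : ℝ → ℝ) (C : ℝ) : Prop where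
  periodic : ∀ z t, L z (t + 1) = L z t
  pos : 0 < C
  lower : ∀ z t, C * ‖z.2‖ ^ 2 ≤ L z t
  nonneg_bound : ∀ V, 0 ≤ A V
  upper : ∀ V z t, ‖z.2‖ ≤ V + 1 → L z t ≤ A V

variable [IsManifold (𝓡 n) ∞ X]
  [Bundle.RiemannianBundle (fun x : X => TangentSpace (𝓡 n) x)]
  [IsContinuousRiemannianBundle (EuclideanSpace ℝ (Fin n)) (fun x : X => TangentSpace (𝓡 n) x)]
  [IsRiemannianManifold (𝓡 n) X] {A : ℝ → ℝ} {C : ℝ}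

omit [IsManifold (𝓡 n) ∞ X] [IsRiemannianManifold (𝓡 n) X]
  [IsContinuousRiemannianBundle (EuclideanSpace ℝ (Fin n)) (fun x : X => TangentSpace (𝓡 n) x)] in
theorem HasGrowth.periodic_nat (hL : HasGrowth L A C) (m : ℕ) (z : TangentBundle (𝓡 n) X) (t : ℝ) :
    L z (t + m) = L z t := by
  induction m with
  | zero => simp
  | succ m ih =>
    have := hL.periodic z (t + m)
    push_cast
    rw [← add_assoc, this, ih]

theorem HasGrowth.action_le (hL : HasGrowth L A C) {γ : ℝ → X} {c d V : ℝ} (hcd : c < d)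
    (hγ : IsMinimizingSegment L γ c d) (hV : dist (γ c) (γ d) ≤ V * (d - c)) :
    action L γ c d ≤ ENNReal.ofReal (A V * (d - c)) := by
  obtain ⟨β, h1, h2, h3, h4⟩ := exists_action_le (hL.nonneg_bound V) (hL.upper V) hcd hV
  exact (hγ.2 β h1 h2 h3).trans h4

theorem HasGrowth.action_ne_top (hL : HasGrowth L A C) {γ : ℝ → X} {c d : ℝ} (hcd : c < d)
    (hγ : IsMinimizingSegment L γ c d) : action L γ c d ≠ ⊤ := by
  have := hL.action_le hcd hγ (V := dist (γ c) (γ d) / (d - c))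
    (by rw [div_mul_cancel₀ _ (sub_pos.2 hcd).ne'])
  exact ne_top_of_le_ne_top ENNReal.ofReal_ne_top this

theorem HasGrowth.mul_dist_sq_le (hL : HasGrowth L A C) {γ : ℝ → X} {c d S : ℝ} (hcd : c ≤ d)
    (hS : 0 ≤ S)
    (hγ : AbsolutelyContinuousOnInterval γ c d) (h : action L γ c d ≤ ENNReal.ofReal S) :
    C * dist (γ c) (γ d) ^ 2 ≤ (d - c) * S := by
  have h1 := (mul_dist_sq_le_action hL.pos.le hL.lower hcd hγ).trans (mul_le_mul_right h _)
  rwa [← ENNReal.ofReal_mul (sub_nonneg.2 hcd), ENNReal.ofReal_le_ofReal_iff] at h1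
  exact mul_nonneg (sub_nonneg.2 hcd) hS

/-- By periodicity the potential between times differing by an integer depends only on the duration,
so it may always be started at `a`; this makes it subadditive in the duration. -/
theorem HasGrowth.isMinimizingChain (hL : HasGrowth L A C) {γ : ℝ → X} {a b : ℝ} {N : ℕ}
    (hN : b - a = N) (hab : a < b) (hγ : IsMinimizingSegment L γ a b) :
    IsMinimizingChain (fun k x y ↦ potential L a (a + k) x y) A C N (fun i ↦ γ (a + i))
      (fun i j ↦ (action L γ (a + i) (a + j)).toReal) := by
  have hb : b = a + N := by linarith
  have hfin := hL.action_ne_top hab hγ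
  have hle : ∀ {j : ℕ}, j ≤ N → a + (j : ℝ) ≤ b := fun {j} h ↦ by
    rw [hb]; gcongr
  have hge : ∀ j : ℕ, a ≤ a + (j : ℝ) := fun j ↦ by simp
  have hij : ∀ {i j : ℕ}, i ≤ j → a + (i : ℝ) ≤ a + j := fun h ↦ by gcongr
  have hf : ∀ {i j : ℕ}, j ≤ N → action L γ (a + i) (a + j) ≠ ⊤ := fun {i j} h ↦
    ne_top_of_le_ne_top hfin (action_mono (hge i) (hle h))
  have hres : ∀ {i j : ℕ}, i ≤ j → j ≤ N → IsMinimizingSegment L γ (a + i) (a + j) :=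
    fun {i j} h1 h2 ↦ hγ.restrict (hge i) (hij h1) (hle h2) hfin
  refine ⟨fun k l x y z ↦ ?_, fun V k x y hk hV ↦ ?_, hL.nonneg_bound, hL.pos,
    fun i j ↦ ENNReal.toReal_nonneg, fun i j k h1 h2 h3 ↦ ?_, ?_, fun i j h1 h2 ↦ ?_,
    fun i j h1 h2 ↦ ?_⟩
  · refine (potential_triangle (hge k) (by push_cast; linarith [Nat.cast_nonneg (α := ℝ) l])
      x y z).trans ?_
    gcongr
    refine (potential_add_le (m := -(k : ℝ)) (fun z t ↦ ?_) _ _ y z).trans_eq ?_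
    · rw [← hL.periodic_nat k]; simp
    · congr 1
      · ring
      · push_cast; ring
  · have hlt : a < a + k := by simpa using hk
    obtain ⟨β, h1, h2, h3, h4⟩ := exists_action_le (hL.nonneg_bound V) (hL.upper V) hlt
      (x := x) (y := y) (by simpa using hV)
    have := potential_le (L := L) h1
    rw [h2, h3] at this
    refine this.trans (h4.trans_eq ?_)
    simp
  · rw [action_add (hij h1) (hij h2), ENNReal.toReal_add (hf (h2.trans h3)) (hf h3)]
  · rw [ENNReal.ofReal_toReal (hf le_rfl)]
    refine le_iInf₂ fun β hβ ↦ ?_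
    simp only [Nat.cast_zero, add_zero] at hβ ⊢
    rw [← hb] at hβ ⊢
    exact hγ.2 β hβ.1 hβ.2.1 hβ.2.2
  · rw [ENNReal.ofReal_toReal (hf h2)]
    refine le_trans ?_ (potential_le (hres h1 h2).1)
    refine (potential_add_le (hL.periodic_nat i) _ _ _ _).trans_eq ?_
    congr 1
    rw [Nat.cast_sub h1]; ring
  · have := hL.mul_dist_sq_le (hij h1) ENNReal.toReal_nonneg (hres h1 h2).1
      (ENNReal.ofReal_toReal (hf h2)).ge
    rw [Nat.cast_sub h1]
    convert! this using 2
    ring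

/-- Along minimizers of integer length with given average displacement, the action is at most
proportional to time on all long subintervals. -/
theorem HasGrowth.exists_action_le (hL : HasGrowth L A C) (K : ℝ) :
    ∃ R S : ℝ, 0 ≤ R ∧ 0 ≤ S ∧ ∀ (γ : ℝ → X) (a b : ℝ), IsIntegerMinimizer L K γ a b →
      (∀ i : ℕ, a + i + 1 ≤ b → dist (γ (a + i)) (γ (a + i + 1)) ≤ R) ∧
      ∀ c d, a ≤ c → c ≤ d → d ≤ b → action L γ c d ≤ ENNReal.ofReal (S * (d - c + 2)) := by
  set B := A K
  have hB : 0 ≤ B := hL.nonneg_bound K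
  set R := 2 + 2 * (A 1 + A √(24 * B / C) + 4 * B) / C with hR
  have hR0 : 0 ≤ R := by
    have := hL.nonneg_bound 1
    have := hL.nonneg_bound √(24 * B / C)
    have := hL.pos
    positivity
  refine ⟨R, A R, hR0, hL.nonneg_bound R, fun γ a b ⟨hab, ⟨m, hm⟩, hγ, hK⟩ ↦ ?_⟩
  have hchain := hL.isMinimizingChain hm hab hγ
  have hfin := hL.action_ne_top hab hγ
  have hσ : (action L γ (a + (0 : ℕ)) (a + m)).toReal ≤ B * m := by
    have h1 := hL.action_le hab hγ (V := K) (by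
      rw [← hK, avgDisplacement, div_mul_cancel₀ _ (sub_pos.2 hab).ne'])
    rw [← hm, Nat.cast_zero, add_zero, add_sub_cancel]
    exact ENNReal.toReal_le_of_le_ofReal (mul_nonneg hB (sub_nonneg.2 hab.le)) h1
  have hstep : ∀ i : ℕ, a + i + 1 ≤ b → dist (γ (a + i)) (γ (a + i + 1)) ≤ R := fun i hi ↦ by
    have hi' : i < m := by
      have : (i : ℝ) + 1 ≤ m := by linarith
      exact_mod_cast this
    have := hchain.dist_step_le hB hσ hi'
    push_cast at this
    rwa [← add_assoc] at this
  refine ⟨hstep, fun c d hac hcd hdb ↦ ?_⟩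
  have hblock : ∀ k i : ℕ, a + i + k ≤ b →
      action L γ (a + i) (a + i + k) ≤ ENNReal.ofReal (A R * k) := by
    intro k i
    induction k with
    | zero => intro _; simp [action_self]
    | succ k ih =>
      intro h
      push_cast at h
      have hk0 : (0 : ℝ) ≤ k := Nat.cast_nonneg k
      have hi0 : (0 : ℝ) ≤ i := Nat.cast_nonneg i
      have e : a + i + ((k + 1 : ℕ) : ℝ) = a + i + k + 1 := by push_cast; ring
      rw [e, action_add (b := a + i + k) (by linarith) (by linarith)]
      have h1 : action L γ (a + i + k) (a + i + k + 1) ≤ ENNReal.ofReal (A R * 1) := by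
        have h2 := hL.action_le (c := a + i + k) (d := a + i + k + 1) (V := R) (by linarith)
          (hγ.restrict (by linarith) (by linarith) (by linarith) hfin) (by
            have := hstep (i + k) (by push_cast; linarith)
            push_cast at this
            rw [← add_assoc] at this
            linarith)
        rwa [add_sub_cancel_left] at h2
      refine (add_le_add (ih (by linarith)) h1).trans_eq ?_
      have := hL.nonneg_bound R
      rw [← ENNReal.ofReal_add (by positivity) (by positivity)]
      push_cast; congr 1; ring
  -- Rounding `[c, d]` outward to integer times relative to `a` adds at most `2` to its length.
  set i := ⌊c - a⌋₊ with hi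
  set j := ⌈d - a⌉₊ with hj
  have hi1 : (i : ℝ) ≤ c - a := Nat.floor_le (by linarith)
  have hi2 : c - a < i + 1 := Nat.lt_floor_add_one _
  have hj1 : d - a ≤ j := Nat.le_ceil _
  have hj2 : (j : ℝ) < d - a + 1 := Nat.ceil_lt_add_one (by linarith)
  have hjm : j ≤ m := Nat.ceil_le.2 (by linarith)
  have hij : i ≤ j := by
    have : (i : ℝ) ≤ j := by linarith
    exact_mod_cast this
  have hjm' : (j : ℝ) ≤ m := by exact_mod_cast hjm
  have hsub : ((j - i : ℕ) : ℝ) = j - i := Nat.cast_sub hij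
  have := hblock (j - i) i (by rw [hsub]; linarith)
  refine (action_mono (by linarith) (by rw [hsub]; linarith)).trans (this.trans ?_)
  apply ENNReal.ofReal_le_ofReal
  rw [hsub]
  exact mul_le_mul_of_nonneg_left (by linarith) (hL.nonneg_bound R)

/-- A long interval of average displacement below `1` has average action at most `A 1`, whatever `K`
is. Exchange with it bounds every step by `K₀`, which involves only `A` and `C`; but average
displacement `K` forces a step of length at least `K`. The dependence on `K` enters only in `N₀`,
through the crude step bound `R` that says when an interval is long enough. -/
theorem HasGrowth.exists_avgDisplacement_ge (hL : HasGrowth L A C) :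
    ∃ K₀ : ℝ, 0 < K₀ ∧ ∀ K : ℝ, K₀ < K → ∃ N₀ : ℕ, 0 < N₀ ∧ ∀ (γ : ℝ → X) (a b : ℝ),
      IsIntegerMinimizer L K γ a b → ∀ c d : ℝ, a ≤ c → d ≤ b → (N₀ : ℝ) ≤ d - c →
        1 ≤ avgDisplacement γ c d := by
  have hA1 : 0 ≤ A 1 := hL.nonneg_bound 1
  -- The factor `2` pays for rounding `[c, d]` inward to integer times, which loses less than `2` of
  -- a length of at least `4`.
  set B := 2 * A 1
  have hB : 0 ≤ B := by positivity
  set K₀ := 2 + 2 * (A 1 + A √(24 * B / C)) / C with hK₀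
  have hK₀pos : 0 < K₀ := by
    have := hL.nonneg_bound √(24 * B / C)
    have := hL.pos
    positivity
  refine ⟨K₀, hK₀pos, fun K hK ↦ ?_⟩
  obtain ⟨R, S, hR, hS, hRS⟩ := hL.exists_action_le K
  -- After the inward rounding at least `4 * R + 7` steps remain, as the exchange needs for a step
  -- of length at most `R`.
  refine ⟨⌈4 * R + 9⌉₊ + 4, by omega, fun γ a b hmin c d hac hdb hcd ↦ ?_⟩
  obtain ⟨hab, ⟨m, hm⟩, hγ, hKm⟩ := hmin
  have hchain := hL.isMinimizingChain hm hab hγ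
  have hfin := hL.action_ne_top hab hγ
  have hceil := Nat.le_ceil (4 * R + 9)
  push_cast at hcd
  have hcd' : 0 < d - c := by linarith
  by_contra! hlt
  rw [avgDisplacement, div_lt_one hcd'] at hlt
  have hmpos : 0 < m := by
    have : (0 : ℝ) < m := by linarith
    exact_mod_cast this
  obtain ⟨i, him, hi⟩ : ∃ i < m, K ≤ dist (γ (a + i)) (γ (a + (i + 1 : ℕ))) := by
    by_contra! hcon
    have h1 := dist_le_range_sum_dist (fun i : ℕ ↦ γ (a + i)) m
    have h2 : ∑ i ∈ Finset.range m, dist (γ (a + i)) (γ (a + (i + 1 : ℕ))) <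
        ∑ _i ∈ Finset.range m, K :=
      Finset.sum_lt_sum_of_nonempty (Finset.nonempty_range_iff.2 hmpos.ne')
        fun i hi ↦ hcon i (Finset.mem_range.1 hi)
    rw [Finset.sum_const, Finset.card_range, nsmul_eq_mul] at h2
    have h3 : dist (γ a) (γ b) = K * m := by
      rw [← hKm, avgDisplacement, ← hm, div_mul_cancel₀ _ (sub_pos.2 hab).ne']
    have h4 : a + (m : ℝ) = b := by linarith
    simp only [Nat.cast_zero, add_zero, h4] at h1
    linarith
  set j := ⌈c - a⌉₊ with hj
  set j' := ⌊d - a⌋₊ with hj'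
  have hj1 : c - a ≤ j := Nat.le_ceil _
  have hj2 : (j : ℝ) < c - a + 1 := Nat.ceil_lt_add_one (by linarith)
  have hj3 : (j' : ℝ) ≤ d - a := Nat.floor_le (by linarith)
  have hj4 : d - a < j' + 1 := Nat.lt_floor_add_one _
  have hjm : j' ≤ m := by
    have : (j' : ℝ) ≤ m := by linarith
    exact_mod_cast this
  have hjj : j ≤ j' := by
    have : (j : ℝ) ≤ j' := by linarith
    exact_mod_cast this
  have hsub : ((j' - j : ℕ) : ℝ) = j' - j := Nat.cast_sub hjj
  have hact := hL.action_le (V := 1) (by linarith)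
    (hγ.restrict hac (by linarith) hdb hfin) (by linarith)
  have hσ : (action L γ (a + j) (a + j')).toReal ≤ B * (j' - j : ℕ) := by
    refine (ENNReal.toReal_le_of_le_ofReal (mul_nonneg hA1 hcd'.le)
      ((action_mono (by linarith) (by linarith)).trans hact)).trans ?_
    rw [hsub]
    nlinarith
  have hRi := (hRS γ a b ⟨hab, ⟨m, hm⟩, hγ, hKm⟩).1 i (by
    have : (i : ℝ) + 1 ≤ m := by exact_mod_cast him
    linarith)
  have := hchain.dist_step_le_of_slow hB him hjm hσ (by
    rw [hsub]
    push_cast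
    rw [← add_assoc]
    linarith)
  linarith

/-- The affine action bound gives `C * dist² ≤ S * (d - c) * (d - c + 2) ≤ S * (d - c + 1)²`, the
upper estimate. The lower one is the assumption on intervals of length at least `N₀`, and on shorter
ones its left side is negative. -/
theorem HasGrowth.exists_isQuasiGeodesicSegment (hL : HasGrowth L A C) {K : ℝ} {N₀ : ℕ}
    (hN₀ : ∀ (γ : ℝ → X) (a b : ℝ), IsIntegerMinimizer L K γ a b → ∀ c d : ℝ, a ≤ c → d ≤ b →
      (N₀ : ℝ) ≤ d - c → 1 ≤ avgDisplacement γ c d) :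
    ∃ lam ε : ℝ, 1 < lam ∧ 0 < ε ∧ ∀ (γ : ℝ → X) (a b : ℝ),
      IsIntegerMinimizer L K γ a b → IsQuasiGeodesicSegment lam ε γ a b := by
  obtain ⟨R, S, hR, hS, hRS⟩ := hL.exists_action_le (X := X) K
  set s := √(S / C)
  have hs : 0 ≤ s := Real.sqrt_nonneg _
  have hs2 : C * s ^ 2 = S := by
    rw [Real.sq_sqrt (div_nonneg hS hL.pos.le), mul_div_cancel₀ _ hL.pos.ne']
  refine ⟨s + 2, N₀ + s + 1, by linarith, by positivity, fun γ a b hγ c d hac hcd hdb ↦ ?_⟩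
  have hN0 : (0 : ℝ) ≤ N₀ := Nat.cast_nonneg _
  have hdc : 0 ≤ d - c := sub_nonneg.2 hcd
  have hinv : (s + 2)⁻¹ * (d - c) ≤ d - c :=
    mul_le_of_le_one_left hdc (inv_le_one_of_one_le₀ (by linarith))
  constructor
  · rcases le_or_gt (N₀ : ℝ) (d - c) with h | h
    · rcases hdc.eq_or_lt with h0 | h0
      · rw [← h0]
        have := dist_nonneg (x := γ c) (y := γ d)
        linarith
      have := hN₀ γ a b hγ c d hac hdb h
      rw [avgDisplacement, one_le_div h0] at this
      linarith
    · have := dist_nonneg (x := γ c) (y := γ d)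
      linarith
  · have h1 := (hRS γ a b hγ).2 c d hac hcd hdb
    have h2 := hL.mul_dist_sq_le hcd (by positivity) (hγ.2.2.1.1.mono (by
      rw [uIcc_of_le hcd, uIcc_of_le hγ.1.le]; exact Icc_subset_Icc hac hdb)) h1
    have h3 : dist (γ c) (γ d) ≤ s * (d - c + 1) := by
      refine (pow_le_pow_iff_left₀ dist_nonneg (by positivity) two_ne_zero).1 ?_
      have h4 : C * dist (γ c) (γ d) ^ 2 ≤ C * (s * (d - c + 1)) ^ 2 := by
        calc _ ≤ _ := h2
          _ ≤ S * (d - c + 1) ^ 2 := by nlinarith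
          _ = _ := by rw [← hs2]; ring
      exact le_of_mul_le_mul_left h4 hL.pos
    nlinarith

end Potential

end Lagrangian


/-! ### Lifting curves through a local diffeomorphism and a covering -/

namespace Lagrangian

section LocalDiffeo

variable {n : ℕ} {M X : Type*} [TopologicalSpace M] [ChartedSpace (EuclideanSpace ℝ (Fin n)) M]
  [TopologicalSpace X] [ChartedSpace (EuclideanSpace ℝ (Fin n)) X]
  {p : X → M} {γ : ℝ → X} {s : Set ℝ} {t : ℝ}

theorem eventuallyEq_localInverse (hp : IsLocalDiffeomorph (𝓡 n) (𝓡 n) ∞ p)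
    (hγ : ContinuousWithinAt γ s t) :
    γ =ᶠ[𝓝[s] t] (hp (γ t)).localInverse ∘ fun τ ↦ p (γ τ) := by
  filter_upwards [hγ.eventually (hp (γ t)).localInverse_eventuallyEq_left] with τ hτ
  exact hτ.symm

theorem contMDiffWithinAt_of_comp (hp : IsLocalDiffeomorph (𝓡 n) (𝓡 n) ∞ p)
    (hγ : ContinuousWithinAt γ s t) (h : ContMDiffWithinAt 𝓘(ℝ, ℝ) (𝓡 n) 1 (fun τ ↦ p (γ τ)) s t) :
    ContMDiffWithinAt 𝓘(ℝ, ℝ) (𝓡 n) 1 γ s t := by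
  have h1 : ContMDiffAt (𝓡 n) (𝓡 n) 1 (hp (γ t)).localInverse (p (γ t)) :=
    (hp (γ t)).localInverse_contMDiffAt.of_le (one_le_two.trans two_le_infty)
  exact (h1.comp_contMDiffWithinAt t h).congr_of_eventuallyEq (eventuallyEq_localInverse hp hγ)
    ((hp (γ t)).localInverse_eventuallyEq_left.eq_of_nhds).symm

theorem mdifferentiableWithinAt_of_comp (hp : IsLocalDiffeomorph (𝓡 n) (𝓡 n) ∞ p)
    (hγ : ContinuousWithinAt γ s t)
    (h : MDifferentiableWithinAt 𝓘(ℝ, ℝ) (𝓡 n) (fun τ ↦ p (γ τ)) s t) :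
    MDifferentiableWithinAt 𝓘(ℝ, ℝ) (𝓡 n) γ s t := by
  have h1 : MDifferentiableAt (𝓡 n) (𝓡 n) (hp (γ t)).localInverse (p (γ t)) :=
    (hp (γ t)).localInverse_mdifferentiableAt (by simp)
  exact (h1.comp_mdifferentiableWithinAt t h).congr_of_eventuallyEq
    (eventuallyEq_localInverse hp hγ)
    ((hp (γ t)).localInverse_eventuallyEq_left.eq_of_nhds).symm

theorem velocityWithin_comp (hp : IsLocalDiffeomorph (𝓡 n) (𝓡 n) ∞ p)
    (hs : UniqueDiffWithinAt ℝ s t) (hγ : MDifferentiableWithinAt 𝓘(ℝ, ℝ) (𝓡 n) γ s t) :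
    MDifferentiableWithinAt 𝓘(ℝ, ℝ) (𝓡 n) (fun τ ↦ p (γ τ)) s t ∧
    velocityWithin (n := n) (fun τ ↦ p (γ τ)) s t =
      tangentMap (𝓡 n) (𝓡 n) p (velocityWithin γ s t) := by
  have h1 : MDifferentiableAt (𝓡 n) (𝓡 n) p (γ t) := (hp (γ t)).mdifferentiableAt (by simp)
  have h2 := h1.hasMFDerivAt.comp_hasMFDerivWithinAt t hγ.hasMFDerivWithinAt
  refine ⟨h2.mdifferentiableWithinAt, ?_⟩
  refine Bundle.TotalSpace.ext rfl (heq_of_eq ?_)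
  exact congrArg (fun A : ℝ →L[ℝ] EuclideanSpace ℝ (Fin n) ↦ A 1)
    (h2.mfderivWithin hs.uniqueMDiffWithinAt)

/-- A continuous curve in an evenly covered set lifts, with the same end points as any other curve
which projects to the evenly covered set and has the same projected end points. -/
theorem exists_lift_of_isEvenlyCovered {I : Type*} [TopologicalSpace I] [DiscreteTopology I]
    {U : Set M} (H : p ⁻¹' U ≃ₜ U × I) (hH : ∀ x, (H x).1.1 = p x)
    {a b : ℝ} (hab : a ≤ b) (hγ : ContinuousOn γ (Icc a b)) (hγU : ∀ t ∈ Icc a b, p (γ t) ∈ U)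
    {β : ℝ → M} (hβ : ContinuousOn β (Icc a b)) (hβU : MapsTo β (Icc a b) U)
    (ha : β a = p (γ a)) (hb : β b = p (γ b)) :
    ∃ η : ℝ → X, ContinuousOn η (Icc a b) ∧ (∀ t ∈ Icc a b, p (η t) = β t) ∧
      η a = γ a ∧ η b = γ b := by
  classical
  set f : Icc a b → p ⁻¹' U := fun t ↦ ⟨γ t, hγU t t.2⟩
  have hf : Continuous f := (continuousOn_iff_continuous_domRestrict.1 hγ).subtype_mk _
  set A : Icc a b := ⟨a, left_mem_Icc.2 hab⟩
  set B : Icc a b := ⟨b, right_mem_Icc.2 hab⟩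
  have hconst : ∀ t, (H (f t)).2 = (H (f A)).2 := fun t ↦
    haveI : PreconnectedSpace (Icc a b) := Subtype.preconnectedSpace isPreconnected_Icc
    PreconnectedSpace.constant inferInstance ((continuous_snd.comp H.continuous).comp hf)
  set i := (H (f A)).2
  set g : Icc a b → X := fun t ↦ (H.symm (⟨β t, hβU t.2⟩, i)).1
  have hg : Continuous g := by
    refine continuous_subtype_val.comp (H.symm.continuous.comp (Continuous.prodMk ?_ continuous_const))
    exact (continuousOn_iff_continuous_domRestrict.1 hβ).subtype_mk _
  have hpg : ∀ t, p (g t) = β t := fun t ↦ by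
    have := hH (H.symm (⟨β t, hβU t.2⟩, i))
    rw [H.apply_symm_apply] at this
    exact this.symm
  have hend : ∀ t : Icc a b, β t = p (γ t) → g t = γ t := fun t ht ↦ by
    have : H (f t) = (⟨β t, hβU t.2⟩, i) := by
      exact Prod.ext (Subtype.ext ((hH (f t)).trans ht.symm)) (hconst t)
    simp only [g]
    rw [← this, H.symm_apply_apply]
  refine ⟨fun t ↦ g (projIcc a b hab t), (hg.comp continuous_projIcc).continuousOn,
    fun t ht ↦ ?_, ?_, ?_⟩
  · rw [hpg, projIcc_of_mem hab ht]
  · change g (projIcc a b hab a) = γ a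
    rw [projIcc_left]; exact hend A ha
  · change g (projIcc a b hab b) = γ b
    rw [projIcc_right]; exact hend B hb

end LocalDiffeo

/-! ### Transfer of the hypotheses and of minimality between the cover and charts of the base -/

section Cover

variable {n : ℕ} {M X : Type*} [TopologicalSpace M] [ChartedSpace (EuclideanSpace ℝ (Fin n)) M]
  [IsManifold (𝓡 n) ∞ M]
  [Bundle.RiemannianBundle (fun x : M => TangentSpace (𝓡 n) x)]
  [IsContinuousRiemannianBundle (EuclideanSpace ℝ (Fin n)) (fun x : M => TangentSpace (𝓡 n) x)]
  [MetricSpace X] [ChartedSpace (EuclideanSpace ℝ (Fin n)) X]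
  [IsManifold (𝓡 n) ∞ X]
  [Bundle.RiemannianBundle (fun x : X => TangentSpace (𝓡 n) x)]
  [IsContinuousRiemannianBundle (EuclideanSpace ℝ (Fin n)) (fun x : X => TangentSpace (𝓡 n) x)]
  [IsRiemannianManifold (𝓡 n) X]
  {p : X → M} {L : TangentBundle (𝓡 n) M → ℝ → ℝ}

local notation "𝔼" => EuclideanSpace ℝ (Fin n)

theorem StandingHypotheses.exists_bound [CompactSpace M] (hL : StandingHypotheses L) (V : ℝ) :
    ∃ A : ℝ, 0 ≤ A ∧ ∀ z t, ‖z.2‖ ≤ V → L z t ≤ A := by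
  obtain ⟨k, hk, hkV⟩ := exists_isCompact_norm_le (n := n) (M := M) V
  have hc : Continuous (fun z : TangentBundle (𝓡 n) M × ℝ ↦ L z.1 z.2) := hL.contMDiff.continuous
  obtain ⟨A, hA⟩ := (hk.prod (isCompact_Icc (a := (0 : ℝ)) (b := 1))).bddAbove_image hc.continuousOn
  refine ⟨max A 0, le_max_right _ _, fun z t hz ↦ ?_⟩
  obtain ⟨t', ht', heq⟩ := Function.Periodic.exists_mem_Ico₀ (f := L z) (hL.periodic z) one_pos t
  rw [heq]
  exact (hA (mem_image_of_mem _ (show (z, t') ∈ k ×ˢ Icc (0 : ℝ) 1 from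
    ⟨hkV hz, ht'.1, ht'.2.le⟩))).trans (le_max_left _ _)

omit [IsContinuousRiemannianBundle 𝔼 (fun x : X => TangentSpace (𝓡 n) x)]
  [IsRiemannianManifold (𝓡 n) X] [IsManifold (𝓡 n) ∞ X] in
theorem exists_hasGrowth [CompactSpace M] (hp : IsRiemannianUniversalCover (n := n) p)
    (hL : StandingHypotheses L) : ∃ A C, HasGrowth (lift L p) A C := by
  choose A hA0 hA using fun V : ℝ ↦ hL.exists_bound (V + 1)
  obtain ⟨C, hC0, hC⟩ := hL.superquadratic
  refine ⟨A, C, fun z t ↦ hL.periodic _ t, hC0, fun z t ↦ ?_, hA0, fun V z t hz ↦ hA V _ t ?_⟩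
  · rw [← hp.norm_mfderiv z.1 z.2]
    exact hC _ _ t
  · rwa [← hp.norm_mfderiv z.1 z.2] at hz

/-- The Lagrangian in a chart, as a function of three vector variables. -/
noncomputable def chartLagrangian (L : TangentBundle (𝓡 n) M → ℝ → ℝ) (x₀ : M)
    (z : EuclideanSpace ℝ (Fin n) × EuclideanSpace ℝ (Fin n) × ℝ) : ℝ :=
  inChart L x₀ z.1 z.2.1 z.2.2

theorem StandingHypotheses.isTonelliOn (hL : StandingHypotheses L) (x₀ : M) {U k : Set 𝔼}
    (hU : IsOpen U) (hUk : U ⊆ k) (hk : IsCompact k) (hkt : k ⊆ (chartAt 𝔼 x₀).target) :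
    ∃ C, IsTonelliOn (chartLagrangian L x₀) U C := by
  obtain ⟨C, hC0, hC⟩ := hL.superquadratic
  obtain ⟨m, hm0, c, -, hm⟩ := exists_norm_chartVector_bounds x₀ hk hkt
  refine ⟨C * m ^ 2, hU, (contDiffOn_inChart hL.contMDiff x₀).mono
    (prod_mono (hUk.trans hkt) le_rfl), fun q hq v w t hw ↦ ?_, by positivity,
    fun q hq u t ↦ ?_⟩
  · have h := hL.convex _ (chartDeriv x₀ q v) (chartDeriv x₀ q w) t
      (fun h ↦ hw (mfderiv_chart_symm_injective x₀ (hkt (hUk hq)) h))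
    have heq : (fun s : ℝ ↦ chartLagrangian L x₀ (q, v + s • w, t)) =
        fun s : ℝ ↦ L ⟨(chartAt 𝔼 x₀).symm q, chartDeriv x₀ q v + s • chartDeriv x₀ q w⟩ t := by
      ext s
      change L ⟨_, chartDeriv x₀ q (v + s • w)⟩ t = _
      rw [map_add, map_smul]
    rw [heq]; exact h
  · refine le_trans ?_ (hC _ (chartDeriv x₀ q u) t)
    rw [mul_assoc, ← mul_pow]
    gcongr
    exact (hm q (hUk hq) u).1

omit [IsManifold (𝓡 n) ∞ M] [IsContinuousRiemannianBundle 𝔼 (fun x : M => TangentSpace (𝓡 n) x)]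
  [IsManifold (𝓡 n) ∞ X]
  [IsContinuousRiemannianBundle 𝔼 (fun x : X => TangentSpace (𝓡 n) x)] in
theorem riemannianEDist_map_le (hp : IsRiemannianUniversalCover (n := n) p) (y z : X) :
    Manifold.riemannianEDist (𝓡 n) (p y) (p z) ≤ edist y z := by
  refine le_of_forall_gt fun r hr ↦ ?_
  rw [IsRiemannianManifold.out (I := 𝓡 n) y z] at hr
  obtain ⟨γ, h0, h1, hγ, hlen⟩ := Manifold.exists_lt_of_riemannianEDist_lt hr
  have hpc : ContMDiff (𝓡 n) (𝓡 n) 1 p :=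
    hp.isLocalDiffeomorph.contMDiff.of_le (one_le_two.trans two_le_infty)
  refine (Manifold.riemannianEDist_le_pathELength (γ := fun t ↦ p (γ t)) (a := 0) (b := 1)
    (hpc.comp_contMDiffOn hγ) (by simp only [h0]) (by simp only [h1]) zero_le_one).trans_lt ?_
  refine lt_of_eq_of_lt ?_ hlen
  rw [pathELength_eq_velocityWithin, pathELength_eq_velocityWithin]
  refine setLIntegral_congr_fun measurableSet_Icc fun t ht ↦ ?_
  have := (velocityWithin_comp hp.isLocalDiffeomorph (uniqueDiffOn_Icc zero_lt_one t ht)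
    (hγ.mdifferentiableOn one_ne_zero t ht)).2
  change ENNReal.ofReal ‖(velocityWithin (fun τ ↦ p (γ τ)) (Icc 0 1) t).2‖ = _
  rw [this]
  congr 1
  exact hp.norm_mfderiv _ _

omit [IsManifold (𝓡 n) ∞ X]
  [IsContinuousRiemannianBundle 𝔼 (fun x : X => TangentSpace (𝓡 n) x)] in
-- The projection preserves lengths of curves and hence does not increase distances. So a
-- displacement bound in the cover keeps the projected curve in a single chart of the base.
theorem exists_confinement [T2Space M] [CompactSpace M] (hp : IsRiemannianUniversalCover (n := n) p)
    {x₀ : M} {W : Set M} (hW : W ∈ 𝓝 x₀) :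
    ∃ ρ : ℝ, 0 < ρ ∧ ∃ W' ∈ 𝓝 x₀, ∀ y z : X, p y ∈ W' → dist y z < ρ → p z ∈ W := by
  obtain ⟨c, hc0, hc⟩ := setOfPred_riemannianEDist_lt_subset_nhds (𝓡 n) hW
  have hc2 : (0 : ℝ) < c / 2 := by have : (0 : ℝ) < c := hc0; positivity
  refine ⟨c / 2, hc2, _, eventually_riemannianEDist_lt (𝓡 n) x₀
    (c := ENNReal.ofReal (c / 2)) (by simpa using hc0), fun y z hy hyz ↦ hc ?_⟩
  have h1 : Manifold.riemannianEDist (𝓡 n) (p y) (p z) < ENNReal.ofReal (c / 2) := by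
    refine (riemannianEDist_map_le hp y z).trans_lt ?_
    rw [edist_dist]
    exact (ENNReal.ofReal_lt_ofReal_iff hc2).2 hyz
  calc Manifold.riemannianEDist (𝓡 n) x₀ (p z)
      ≤ Manifold.riemannianEDist (𝓡 n) x₀ (p y) + Manifold.riemannianEDist (𝓡 n) (p y) (p z) :=
        Manifold.riemannianEDist_triangle
    _ < ENNReal.ofReal (c / 2) + ENNReal.ofReal (c / 2) := ENNReal.add_lt_add hy h1
    _ = c := by
        rw [← ENNReal.ofReal_add hc2.le hc2.le, add_halves, ENNReal.ofReal_coe_nnreal]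

omit [Bundle.RiemannianBundle (fun x : M => TangentSpace (𝓡 n) x)]
  [IsContinuousRiemannianBundle 𝔼 (fun x : M => TangentSpace (𝓡 n) x)] in
theorem absolutelyContinuousOnInterval_chart (hp : IsLocalDiffeomorph (𝓡 n) (𝓡 n) ∞ p) (x₀ : M)
    {γ : ℝ → X} {a b : ℝ} (hγ : AbsolutelyContinuousOnInterval γ a b)
    (hγx : ∀ t ∈ uIcc a b, p (γ t) ∈ (chartAt 𝔼 x₀).source) :
    AbsolutelyContinuousOnInterval (fun t ↦ chartAt 𝔼 x₀ (p (γ t))) a b := by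
  have hpc : ContMDiff (𝓡 n) (𝓡 n) 1 p :=
    hp.contMDiff.of_le (one_le_two.trans two_le_infty)
  have hf : ContMDiffOn (𝓡 n) 𝓘(ℝ, 𝔼) 1 (fun x ↦ chartAt 𝔼 x₀ (p x))
      (p ⁻¹' (chartAt 𝔼 x₀).source) :=
    (contMDiffOn_chart_one x₀).comp hpc.contMDiffOn le_rfl
  have hO : IsOpen (p ⁻¹' (chartAt 𝔼 x₀).source) :=
    (chartAt 𝔼 x₀).open_source.preimage hpc.continuous
  have hm : MapsTo γ (uIcc a b) (p ⁻¹' (chartAt 𝔼 x₀).source) := fun t ht ↦ hγx t ht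
  have h := AbsolutelyContinuousOnInterval.comp_contMDiffOn (n := n) hγ hO hf hm
  exact h

omit [Bundle.RiemannianBundle (fun x : M => TangentSpace (𝓡 n) x)]
  [IsContinuousRiemannianBundle 𝔼 (fun x : M => TangentSpace (𝓡 n) x)] in
/-- The action of a curve read in a chart of the base. -/
theorem action_eq_chart (hp : IsLocalDiffeomorph (𝓡 n) (𝓡 n) ∞ p) (x₀ : M)
    {γ : ℝ → X} {a b : ℝ} (hab : a ≤ b) (hγ : AbsolutelyContinuousOnInterval γ a b)
    (hγx : ∀ t ∈ Icc a b, p (γ t) ∈ (chartAt 𝔼 x₀).source) {q : ℝ → 𝔼}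
    (hq : EqOn (fun t ↦ chartAt 𝔼 x₀ (p (γ t))) q (Icc a b)) :
    action (lift L p) γ a b =
      ∫⁻ t in Icc a b, ENNReal.ofReal (chartLagrangian L x₀ (q t, deriv q t, t)) := by
  have hac : AbsolutelyContinuousOnInterval q a b :=
    (absolutelyContinuousOnInterval_chart hp x₀ hγ (by rwa [uIcc_of_le hab])).congr
      (by rw [uIcc_of_le hab]; exact hq.symm)
  rw [action_eq_Ioo, ← restrict_Ioo_eq_restrict_Icc]
  refine lintegral_congr_ae ((ae_restrict_iff' measurableSet_Ioo).2 ?_)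
  filter_upwards [hac.ae_hasDerivAt, ae_mdifferentiableAt (n := n) hab hγ] with t h1 h2 ht
  have htI := Ioo_subset_Icc_self ht
  have hev : (fun τ ↦ chartAt 𝔼 x₀ (p (γ τ))) =ᶠ[𝓝 t] q := by
    filter_upwards [Icc_mem_nhds ht.1 ht.2] with τ hτ using hq hτ
  have hd : HasDerivAt (fun τ ↦ chartAt 𝔼 x₀ (p (γ τ))) (deriv q t) t :=
    (h1 (by rwa [uIcc_of_le hab])).congr_of_eventuallyEq hev
  obtain ⟨h3, h4⟩ := velocityWithin_comp hp uniqueDiffWithinAt_univ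
    (mdifferentiableWithinAt_univ.2 (h2 ht))
  have h5 := (velocityWithin_eq_chartVector x₀ uniqueDiffWithinAt_univ h3.continuousWithinAt
    (hγx t htI) hd.hasDerivWithinAt).2
  rw [h4, velocityWithin_of_mem_nhds univ_mem] at h5
  change ENNReal.ofReal (L (tangentMap (𝓡 n) (𝓡 n) p ⟨γ t, velocity γ t⟩) t) = _
  have h6 : chartAt 𝔼 x₀ (p (γ t)) = q t := hq htI
  rw [h5, h6]
  rfl

omit [Bundle.RiemannianBundle (fun x : M => TangentSpace (𝓡 n) x)]
  [IsContinuousRiemannianBundle 𝔼 (fun x : M => TangentSpace (𝓡 n) x)] in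
/-- A minimizer read in a chart of the base minimizes among `C¹` curves in the chart. -/
theorem isMinimizerIn_chart (hp : IsLocalDiffeomorph (𝓡 n) (𝓡 n) ∞ p) (x₀ : M)
    {I : Type*} [TopologicalSpace I] [DiscreteTopology I]
    {U : Set M} (H : p ⁻¹' U ≃ₜ U × I) (hH : ∀ x, (H x).1.1 = p x) {k : Set 𝔼}
    (hk : k ⊆ (chartAt 𝔼 x₀).target) (hkU : MapsTo (chartAt 𝔼 x₀).symm k U)
    {γ : ℝ → X} {a b : ℝ} (hab : a < b) (hγ : IsMinimizingSegment (lift L p) γ a b)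
    (hγx : ∀ t ∈ Icc a b, p (γ t) ∈ (chartAt 𝔼 x₀).source)
    (hγk : ∀ t ∈ Icc a b, chartAt 𝔼 x₀ (p (γ t)) ∈ k) :
    IsMinimizerIn (chartLagrangian L x₀) k (fun t ↦ chartAt 𝔼 x₀ (p (γ t))) a b := by
  set φ := chartAt 𝔼 x₀
  intro β hβ hβk hβa hβb
  have hγc : ContinuousOn γ (Icc a b) := by
    have := hγ.1.continuousOn_metric; rwa [uIcc_of_le hab.le] at this
  have hβM : ContMDiffOn 𝓘(ℝ, ℝ) (𝓡 n) 1 (fun t ↦ φ.symm (β t)) (Icc a b) :=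
    (contMDiffOn_chart_symm_one x₀).comp (contMDiffOn_iff_contDiffOn.2 hβ) fun t ht ↦ hk (hβk ht)
  have hA := left_mem_Icc.2 hab.le
  have hB := right_mem_Icc.2 hab.le
  -- A competitor in the chart becomes a competitor in the cover: over an evenly covered set `γ`
  -- stays in one sheet, and lifting to that sheet preserves both endpoints.
  obtain ⟨η, hηc, hpη, hηa, hηb⟩ := exists_lift_of_isEvenlyCovered H hH hab.le hγc
    (fun t ht ↦ by rw [← φ.left_inv (hγx t ht)]; exact hkU (hγk t ht)) hβM.continuousOn
    (fun t ht ↦ hkU (hβk ht)) (by rw [hβa]; exact φ.left_inv (hγx a hA))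
    (by rw [hβb]; exact φ.left_inv (hγx b hB))
  have hηC : ContMDiffOn 𝓘(ℝ, ℝ) (𝓡 n) 1 η (Icc a b) := fun t ht ↦
    contMDiffWithinAt_of_comp hp (hηc t ht) ((hβM t ht).congr hpη (hpη t ht))
  have hηAC := hηC.absolutelyContinuousOnInterval hab
  have hle := hγ.2 η hηAC hηa hηb
  have hφη : EqOn (fun t ↦ φ (p (η t))) β (Icc a b) := fun t ht ↦ by
    simp only [hpη t ht]; exact φ.right_inv (hk (hβk ht))
  rw [action_eq_chart hp x₀ hab.le hγ.1 hγx (fun _ _ ↦ rfl),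
    action_eq_chart hp x₀ hab.le hηAC (fun t ht ↦ by
      rw [hpη t ht]; exact φ.map_target (hk (hβk ht))) hφη] at hle
  refine hle.trans_eq ?_
  rw [← restrict_Ioo_eq_restrict_Icc]
  refine setLIntegral_congr_fun measurableSet_Ioo fun t ht ↦ ?_
  simp only [derivWithin_of_mem_nhds (Icc_mem_nhds ht.1 ht.2)]

end Cover

end Lagrangian


/-! ### Coordinates on the tangent bundle and Euler–Lagrange solutions in a chart -/

namespace Lagrangian

section Coordinates

variable {n : ℕ} {M : Type*} [TopologicalSpace M] [ChartedSpace (EuclideanSpace ℝ (Fin n)) M]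
  [IsManifold (𝓡 n) ∞ M]

local notation "𝔼" => EuclideanSpace ℝ (Fin n)

/-- The coordinates of a tangent vector in the chart at `x₀`. -/
noncomputable def chartCoord (x₀ : M) (z : TangentBundle (𝓡 n) M) :
    EuclideanSpace ℝ (Fin n) × EuclideanSpace ℝ (Fin n) :=
  extChartAt (𝓡 n).tangent (⟨x₀, 0⟩ : TangentBundle (𝓡 n) M) z

theorem chartCoord_chartVector (x₀ : M) {q : 𝔼} (hq : q ∈ (chartAt 𝔼 x₀).target) (u : 𝔼) :
    chartCoord x₀ (chartVector x₀ q u) = (q, u) := by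
  rw [chartCoord, chartVector_eq x₀ hq]
  refine (extChartAt (𝓡 n).tangent (⟨x₀, 0⟩ : TangentBundle (𝓡 n) M)).right_inv ?_
  rw [extChartAt_target]
  refine ⟨?_, ?_⟩
  · rw [mem_preimage, TangentBundle.mem_chart_target_iff]
    exact hq
  · rw [ModelWithCorners.range_eq_univ]; trivial

theorem continuousAt_chartCoord (x₀ : M) {z : TangentBundle (𝓡 n) M}
    (hz : z.1 ∈ (chartAt 𝔼 x₀).source) : ContinuousAt (chartCoord x₀) z := by
  refine continuousAt_extChartAt' ?_
  rw [extChartAt_source, TangentBundle.mem_chart_source_iff]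
  exact hz

end Coordinates

section EulerLagrange

variable {n : ℕ} {M : Type*} [TopologicalSpace M] [ChartedSpace (EuclideanSpace ℝ (Fin n)) M]
  [IsManifold (𝓡 n) ∞ M] {L : TangentBundle (𝓡 n) M → ℝ → ℝ} {η : ℝ → M}

local notation "𝔼" => EuclideanSpace ℝ (Fin n)

theorem contDiffOn_chart_comp (hη : ContMDiff 𝓘(ℝ, ℝ) (𝓡 n) 2 η) (x₀ : M) :
    ContDiffOn ℝ 2 (fun t ↦ chartAt 𝔼 x₀ (η t)) (η ⁻¹' (chartAt 𝔼 x₀).source) := by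
  rw [← contMDiffOn_iff_contDiffOn]
  exact (contMDiffOn_chart (I := 𝓡 n) (n := 2) (x := x₀)).comp hη.contMDiffOn le_rfl

omit [IsManifold (𝓡 n) ∞ M] in
theorem isOpen_preimage_chart_source (hη : ContMDiff 𝓘(ℝ, ℝ) (𝓡 n) 2 η) (x₀ : M) :
    IsOpen (η ⁻¹' (chartAt 𝔼 x₀).source) :=
  (chartAt 𝔼 x₀).open_source.preimage hη.continuous

theorem hasDerivAt_chart_comp (hη : ContMDiff 𝓘(ℝ, ℝ) (𝓡 n) 2 η) (x₀ : M) {t : ℝ}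
    (ht : η t ∈ (chartAt 𝔼 x₀).source) :
    HasDerivAt (fun t ↦ chartAt 𝔼 x₀ (η t)) (deriv (fun t ↦ chartAt 𝔼 x₀ (η t)) t) t :=
  (((contDiffOn_chart_comp hη x₀).differentiableOn two_ne_zero).differentiableAt
    ((isOpen_preimage_chart_source hη x₀).mem_nhds ht)).hasDerivAt

theorem chartVector_deriv_eq (hη : ContMDiff 𝓘(ℝ, ℝ) (𝓡 n) 2 η) (x₀ : M) {t : ℝ}
    (ht : η t ∈ (chartAt 𝔼 x₀).source) :
    (⟨η t, velocity η t⟩ : TangentBundle (𝓡 n) M) =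
      chartVector x₀ (chartAt 𝔼 x₀ (η t)) (deriv (fun t ↦ chartAt 𝔼 x₀ (η t)) t) := by
  rw [← velocityWithin_of_mem_nhds univ_mem]
  exact (velocityWithin_eq_chartVector x₀ uniqueDiffWithinAt_univ
    hη.continuous.continuousAt.continuousWithinAt ht
    (hasDerivAt_chart_comp hη x₀ ht).hasDerivWithinAt).2

/-- The partial derivatives in the definition of a solution are rewritten through the full
derivative of `chartLagrangian`, the form in which minimizers satisfy the same equation. -/
theorem IsEulerLagrangeSolution.hasDerivAt_momentum (hη : IsEulerLagrangeSolution L η)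
    (hL : ContMDiff ((𝓡 n).tangent.prod 𝓘(ℝ, ℝ)) 𝓘(ℝ, ℝ) 2
      (fun z : TangentBundle (𝓡 n) M × ℝ => L z.1 z.2)) (x₀ : M) {t : ℝ}
    (ht : η t ∈ (chartAt 𝔼 x₀).source) (e : 𝔼) :
    HasDerivAt (fun s ↦ momentum (chartLagrangian L x₀)
        (chartAt 𝔼 x₀ (η s), deriv (fun t ↦ chartAt 𝔼 x₀ (η t)) s, s) e)
      (force (chartLagrangian L x₀)
        (chartAt 𝔼 x₀ (η t), deriv (fun t ↦ chartAt 𝔼 x₀ (η t)) t, t) e) t := by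
  set φ := chartAt 𝔼 x₀
  set q : ℝ → 𝔼 := fun t ↦ φ (η t)
  have hF : ContDiffOn ℝ 2 (chartLagrangian L x₀) (φ.target ×ˢ univ) := contDiffOn_inChart hL x₀
  have hopen : IsOpen (φ.target ×ˢ (univ : Set (𝔼 × ℝ))) := φ.open_target.prod isOpen_univ
  have hd : ∀ y ∈ φ.target, ∀ u s, DifferentiableAt ℝ (chartLagrangian L x₀) (y, u, s) :=
    fun y hy u s ↦ (hF.differentiableOn two_ne_zero).differentiableAt
      (hopen.mem_nhds ⟨hy, trivial⟩)
  have hmom : ∀ y ∈ φ.target, ∀ u s,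
      fderiv ℝ (fun w ↦ inChart L x₀ y w s) u e = momentum (chartLagrangian L x₀) (y, u, s) e := by
    intro y hy u s
    have h1 : HasFDerivAt (fun w : 𝔼 ↦ (y, w, s)) ((0 : 𝔼 →L[ℝ] 𝔼).prod
        ((ContinuousLinearMap.id ℝ 𝔼).prod (0 : 𝔼 →L[ℝ] ℝ))) u :=
      (hasFDerivAt_const y u).prodMk ((hasFDerivAt_id u).prodMk (hasFDerivAt_const s u))
    have h2 := (hd y hy u s).hasFDerivAt.comp u h1
    have h3 : fderiv ℝ (fun w ↦ inChart L x₀ y w s) u = _ := h2.fderiv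
    rw [h3, momentum_apply]
    rfl
  have hfor : fderiv ℝ (fun y ↦ inChart L x₀ y (deriv q t) t) (q t) e =
      force (chartLagrangian L x₀) (q t, deriv q t, t) e := by
    have h1 : HasFDerivAt (fun y : 𝔼 ↦ (y, deriv q t, t)) ((ContinuousLinearMap.id ℝ 𝔼).prod
        ((0 : 𝔼 →L[ℝ] 𝔼).prod (0 : 𝔼 →L[ℝ] ℝ))) (q t) :=
      (hasFDerivAt_id _).prodMk ((hasFDerivAt_const _ _).prodMk (hasFDerivAt_const _ _))
    have h2 := (hd (q t) (φ.map_source ht) (deriv q t) t).hasFDerivAt.comp (q t) h1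
    have h3 : fderiv ℝ (fun y ↦ inChart L x₀ y (deriv q t) t) (q t) = _ := h2.fderiv
    rw [h3, force_apply]
    rfl
  have hEL := hη.2 x₀ t ht
  have h1 := hEL.clm_apply (hasDerivAt_const t e)
  rw [map_zero, add_zero] at h1
  rw [← hfor]
  refine h1.congr_of_eventuallyEq ?_
  filter_upwards [(isOpen_preimage_chart_source hη.1 x₀).mem_nhds ht] with s hs
  exact (hmom (q s) (φ.map_source hs) (deriv q s) s).symm

end EulerLagrange

/-! ### Local propagation of velocity convergence on the manifold -/

section Propagation

variable {n : ℕ} {M X : Type*} [TopologicalSpace M] [T2Space M] [CompactSpace M]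
  [ChartedSpace (EuclideanSpace ℝ (Fin n)) M]
  [IsManifold (𝓡 n) ∞ M]
  [Bundle.RiemannianBundle (fun x : M => TangentSpace (𝓡 n) x)]
  [IsContinuousRiemannianBundle (EuclideanSpace ℝ (Fin n)) (fun x : M => TangentSpace (𝓡 n) x)]
  [MetricSpace X] [ChartedSpace (EuclideanSpace ℝ (Fin n)) X]
  [IsManifold (𝓡 n) ∞ X]
  [Bundle.RiemannianBundle (fun x : X => TangentSpace (𝓡 n) x)]
  [IsContinuousRiemannianBundle (EuclideanSpace ℝ (Fin n)) (fun x : X => TangentSpace (𝓡 n) x)]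
  [IsRiemannianManifold (𝓡 n) X]
  {p : X → M} {L : TangentBundle (𝓡 n) M → ℝ → ℝ}

local notation "𝔼" => EuclideanSpace ℝ (Fin n)

/-- The curves `γ i`, projected to the base, are eventually differentiable at the times `τ i`, and
their velocities there converge to the velocity of `η` at time `t`. -/
def VelocityTendsto (p : X → M) (l : Filter ℕ) (γ : ℕ → ℝ → X) (a b : ℕ → ℝ) (η : ℝ → M)
    (τ : ℕ → ℝ) (t : ℝ) : Prop :=
  (∀ᶠ i in l, MDifferentiableWithinAt 𝓘(ℝ, ℝ) (𝓡 n) (fun s ↦ p (γ i s)) (Icc (a i) (b i)) (τ i)) ∧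
  Tendsto (fun i ↦ velocityWithin (n := n) (fun s ↦ p (γ i s)) (Icc (a i) (b i)) (τ i)) l
    (𝓝 ⟨η t, velocity η t⟩)

/-- If minimizers are close to an Euler-Lagrange solution at one time, then they are at all nearby
times. -/
theorem exists_velocityTendsto (hp : IsRiemannianUniversalCover (n := n) p)
    (hL : StandingHypotheses L) {η : ℝ → M} (hη : IsEulerLagrangeSolution L η) (s S : ℝ)
    (hS : 0 ≤ S) :
    ∃ δ : ℝ, 0 < δ ∧ ∀ (l : Filter ℕ) (γ : ℕ → ℝ → X) (a b : ℕ → ℝ), (∀ i, a i < b i) →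
      (∀ i, IsMinimizingSegment (lift L p) (γ i) (a i) (b i)) →
      (∀ i c d, a i ≤ c → c ≤ d → d ≤ b i →
        action (lift L p) (γ i) c d ≤ ENNReal.ofReal (S * (d - c + 2))) →
      ∀ (τ τ' : ℕ → ℝ) (t t' : ℝ), (∀ i, τ i ∈ Icc (a i) (b i)) → (∀ i, τ' i ∈ Icc (a i) (b i)) →
        Tendsto τ l (𝓝 t) → Tendsto τ' l (𝓝 t') → |t - s| < δ → |t' - s| < δ →
        VelocityTendsto (n := n) p l γ a b η τ t → VelocityTendsto (n := n) p l γ a b η τ' t' := by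
  obtain ⟨A, C, hG⟩ := exists_hasGrowth hp hL
  set x₀ := η s with hx₀
  set φ := chartAt 𝔼 x₀ with hφ
  obtain ⟨hdisc, U, hxU, hUo, -, H, hH⟩ := hp.isCoveringMap x₀
  have hx₀s : x₀ ∈ φ.source := mem_chart_source 𝔼 x₀
  obtain ⟨r', hr'0, hr'⟩ : ∃ r' > 0, Metric.closedBall (φ x₀) r' ⊆ φ.target ∩ φ.symm ⁻¹' U := by
    refine Metric.nhds_basis_closedBall.mem_iff.1 (inter_mem (chart_target_mem_nhds 𝔼 x₀) ?_)
    refine (φ.continuousAt_symm (mem_chart_target 𝔼 x₀)) ?_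
    rw [φ.left_inv hx₀s]
    exact hUo.mem_nhds hxU
  -- Three nested balls: the Lagrangian is Tonelli on the ball of radius `r'`, competitors live in
  -- radius `r`, and the minimizers are confined to radius `r / 2`.
  set r := r' / 2
  have hr0 : 0 < r := by positivity
  have hrr : r < r' := half_lt_self hr'0
  have hrball : Metric.closedBall (φ x₀) r ⊆ Metric.ball (φ x₀) r' :=
    Metric.closedBall_subset_ball hrr
  have hrt : Metric.closedBall (φ x₀) r ⊆ φ.target ∩ φ.symm ⁻¹' U :=
    (hrball.trans Metric.ball_subset_closedBall).trans hr'
  obtain ⟨C', hF⟩ := hL.isTonelliOn x₀ (Metric.isOpen_ball (x := φ x₀) (ε := r'))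
    Metric.ball_subset_closedBall (isCompact_closedBall _ _) (fun y hy ↦ (hr' hy).1)
  set W : Set M := φ.source ∩ φ ⁻¹' Metric.closedBall (φ x₀) (r / 2)
  have hW : W ∈ 𝓝 x₀ := inter_mem (chart_source_mem_nhds 𝔼 x₀)
    (φ.continuousAt hx₀s (Metric.closedBall_mem_nhds _ (by positivity)))
  obtain ⟨ρ, hρ0, W', hW', hconf⟩ := exists_confinement hp hW
  have hηc : Continuous η := hη.1.continuous
  obtain ⟨δ₁, hδ₁0, hδ₁⟩ : ∃ δ₁ > 0, Metric.closedBall s δ₁ ⊆ η ⁻¹' (W ∩ interior W') :=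
    Metric.nhds_basis_closedBall.mem_iff.1
      (hηc.continuousAt (inter_mem hW (interior_mem_nhds.2 hW')))
  rw [Real.closedBall_eq_Icc] at hδ₁
  set qη : ℝ → 𝔼 := fun t ↦ φ (η t)
  set gη : ℝ → 𝔼 := deriv qη
  have hO := isOpen_preimage_chart_source hη.1 x₀
  have hgηc : ContinuousOn gη (η ⁻¹' φ.source) :=
    (contDiffOn_chart_comp hη.1 x₀).continuousOn_deriv_of_isOpen hO one_le_two
  have hsub : Icc (s - δ₁) (s + δ₁) ⊆ η ⁻¹' φ.source := fun t ht ↦ (hδ₁ ht).1.1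
  obtain ⟨R₁, hR₁⟩ := isCompact_Icc.exists_bound_of_continuousOn (hgηc.mono hsub)
  obtain ⟨δ₂, hδ₂0, c, hc0, hprop⟩ := hF.exists_propagation hr0 hrball (R₁ + 1) (s - 1) (s + 1)
  -- On a window of length at most `2 * δ ≤ 1` the action bound gives `dist² ≤ κ * (2 * δ)`, and `δ`
  -- is chosen to make this less than `ρ ^ 2`.
  set κ := 3 * S / C
  have hκ : 0 ≤ κ := by have := hG.pos; positivity
  refine ⟨min (min δ₁ (δ₂ / 2)) (min (1 / 2) (ρ ^ 2 / (2 * (2 * κ + 1)))), by positivity, ?_⟩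
  set δ := min (min δ₁ (δ₂ / 2)) (min (1 / 2) (ρ ^ 2 / (2 * (2 * κ + 1))))
  have hd1 : δ ≤ δ₁ := (min_le_left _ _).trans (min_le_left _ _)
  have hd2 : δ ≤ δ₂ / 2 := (min_le_left _ _).trans (min_le_right _ _)
  have hd3 : δ ≤ 1 / 2 := (min_le_right _ _).trans (min_le_left _ _)
  have hd4 : δ ≤ ρ ^ 2 / (2 * (2 * κ + 1)) := (min_le_right _ _).trans (min_le_right _ _)
  have hκρ : κ * (2 * δ) < ρ ^ 2 := by
    rw [le_div_iff₀ (by positivity)] at hd4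
    nlinarith [sq_pos_of_pos hρ0]
  intro l γ a b hab hmin hact τ τ' t t' hτ hτ' hτt hτt' ht ht' ⟨hdiff, hvel⟩
  have hI : ∀ u, |u - s| < δ → u ∈ Icc (s - δ₁) (s + δ₁) := fun u hu ↦ by
    rw [abs_lt] at hu; constructor <;> linarith [hu.1, hu.2]
  have hts := hsub (hI t ht)
  have hts' := hsub (hI t' ht')
  have hvη := chartVector_deriv_eq hη.1 x₀ hts
  have hvη' := chartVector_deriv_eq hη.1 x₀ hts'
  set vel : ℕ → TangentBundle (𝓡 n) M :=
    fun i ↦ velocityWithin (n := n) (fun s ↦ p (γ i s)) (Icc (a i) (b i)) (τ i) with hveldef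
  set vel' : ℕ → TangentBundle (𝓡 n) M :=
    fun i ↦ velocityWithin (n := n) (fun s ↦ p (γ i s)) (Icc (a i) (b i)) (τ' i) with hveldef'
  have hproj : Tendsto (fun i ↦ p (γ i (τ i))) l (𝓝 (η t)) :=
    ((FiberBundle.continuous_proj 𝔼 (fun x : M ↦ TangentSpace (𝓡 n) x)).tendsto _).comp hvel
  have hw : Tendsto (fun i ↦ chartCoord x₀ (vel i)) l (𝓝 (qη t, gη t)) := by
    have h1 := (continuousAt_chartCoord x₀ (z := ⟨η t, velocity η t⟩) hts).tendsto.comp hvel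
    rwa [hvη, chartCoord_chartVector x₀ (φ.map_source hts)] at h1
  have hqc : ∀ {u}, η u ∈ φ.source → ContinuousAt qη u := fun h ↦
    (hasDerivAt_chart_comp hη.1 x₀ h).continuousAt
  have hgc : ∀ {u}, η u ∈ φ.source → ContinuousAt gη u := fun h ↦
    hgηc.continuousAt (hO.mem_nhds h)
  have herr : Tendsto (fun i ↦ c * (‖(chartCoord x₀ (vel i)).1 - qη (τ i)‖ +
      ‖(chartCoord x₀ (vel i)).2 - gη (τ i)‖)) l (𝓝 0) := by
    have h1 := (hw.fst_nhds.sub ((hqc hts).tendsto.comp hτt)).norm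
    have h2 := (hw.snd_nhds.sub ((hgc hts).tendsto.comp hτt)).norm
    simpa using (h1.add h2).const_mul c
  have hnear : ∀ᶠ i in l, |τ i - s| < δ :=
    (hτt.sub_const s).abs.eventually_lt_const ht
  have hnear' : ∀ᶠ i in l, |τ' i - s| < δ :=
    (hτt'.sub_const s).abs.eventually_lt_const ht'
  have hbound : ∀ᶠ i in l, ‖(chartCoord x₀ (vel i)).2‖ ≤ R₁ + 1 := by
    have h1 : ‖gη t‖ < R₁ + 1 := (hR₁ t (hI t ht)).trans_lt (lt_add_one _)
    exact (hw.snd_nhds.norm.eventually_lt_const h1).mono fun i hi ↦ hi.le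
  have hinW : ∀ᶠ i in l, p (γ i (τ i)) ∈ W' :=
    (hproj (mem_interior_iff_mem_nhds.1 (hδ₁ (hI t ht)).2))
  have hcont : ∀ i, ContinuousOn (γ i) (Icc (a i) (b i)) := fun i ↦ by
    have := (hmin i).1.continuousOn_metric; rwa [uIcc_of_le (hab i).le] at this
  have hpc : Continuous p := hp.isCoveringMap.continuous
  have key : ∀ᶠ i in l, ∃ u : 𝔼, p (γ i (τ' i)) ∈ φ.source ∧
      HasDerivWithinAt (fun s ↦ φ (p (γ i s))) u (Icc (a i) (b i)) (τ' i) ∧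
      ‖φ (p (γ i (τ' i))) - qη (τ' i)‖ + ‖u - gη (τ' i)‖ ≤
        c * (‖(chartCoord x₀ (vel i)).1 - qη (τ i)‖ + ‖(chartCoord x₀ (vel i)).2 - gη (τ i)‖) := by
    filter_upwards [hdiff, hnear, hnear', hbound, hinW] with i hdi hni hni' hbi hWi
    rw [abs_lt] at hni hni'
    set a' := max (a i) (s - δ)
    set b' := min (b i) (s + δ)
    have haa' : a i ≤ a' := le_max_left _ _
    have hbb' : b' ≤ b i := min_le_left _ _
    have hsa' : s - δ ≤ a' := le_max_right _ _
    have hsb' : b' ≤ s + δ := min_le_right _ _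
    have hab' : a' < b' := by
      have h1 := hτ i
      have := hab i
      refine max_lt (lt_min this ?_) (lt_min ?_ ?_) <;> linarith [h1.1, h1.2]
    have hJ : ∀ u, u ∈ Icc (a i) (b i) → |u - s| < δ → u ∈ Icc a' b' := fun u h1 h2 ↦ by
      rw [abs_lt] at h2
      exact ⟨max_le h1.1 (by linarith), le_min h1.2 (by linarith)⟩
    have hτJ := hJ _ (hτ i) (abs_lt.2 hni)
    have hτJ' := hJ _ (hτ' i) (abs_lt.2 hni')
    -- The cut at `s ± δ` is invisible near `u`, so one-sided derivatives occur only at true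
    -- endpoints of the minimizer.
    have hset : ∀ u, |u - s| < δ → Icc a' b' =ᶠ[𝓝 u] Icc (a i) (b i) := fun u hu ↦ by
      rw [abs_lt] at hu
      filter_upwards [Ioo_mem_nhds (show s - δ < u by linarith) (show u < s + δ by linarith)]
        with v hv
      refine propext ⟨fun h ↦ ⟨haa'.trans h.1, h.2.trans hbb'⟩, fun h ↦ hJ v h ?_⟩
      rw [abs_lt]; constructor <;> linarith [hv.1, hv.2]
    have hsubJ : Icc a' b' ⊆ Icc (a i) (b i) := Icc_subset_Icc haa' hbb'
    have hacJ : ∀ {c d}, a' ≤ c → c ≤ d → d ≤ b' → AbsolutelyContinuousOnInterval (γ i) c d :=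
      fun {c d} h1 h2 h3 ↦ (hmin i).1.mono (by
        rw [uIcc_of_le h2, uIcc_of_le (hab i).le]
        exact Icc_subset_Icc (haa'.trans h1) (h3.trans hbb'))
    have hdist : ∀ c ∈ Icc a' b', ∀ d ∈ Icc a' b', dist (γ i c) (γ i d) < ρ := by
      intro c hc d hd
      wlog hcd : c ≤ d generalizing c d
      · rw [dist_comm]; exact this d hd c hc (not_le.1 hcd).le
      have h1 := hact i c d (haa'.trans hc.1) hcd (hd.2.trans hbb')
      have hlen : d - c ≤ 2 * δ := by linarith [hc.1, hd.2]
      have hdc := sub_nonneg.2 hcd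
      have h2 := hG.mul_dist_sq_le hcd (by positivity) (hacJ hc.1 hcd hd.2) h1
      have h3 : dist (γ i c) (γ i d) ^ 2 ≤ κ * (2 * δ) := by
        have h4 : C * dist (γ i c) (γ i d) ^ 2 ≤ C * (κ * (2 * δ)) := by
          calc _ ≤ (d - c) * (S * (d - c + 2)) := h2
            _ ≤ (2 * δ) * (S * 3) := by gcongr <;> linarith
            _ = C * (κ * (2 * δ)) := by
              simp only [κ]; field_simp [hG.pos.ne']
        exact le_of_mul_le_mul_left h4 hG.pos
      exact lt_of_pow_lt_pow_left₀ 2 hρ0.le (h3.trans_lt hκρ)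
    have hWJ : ∀ u ∈ Icc a' b', p (γ i u) ∈ W := fun u hu ↦
      hconf _ _ hWi (hdist _ hτJ u hu)
    have hUD := uniqueDiffOn_Icc (hab i) (τ i) (hτ i)
    have hsrc : p (γ i (τ i)) ∈ φ.source := (hWJ _ hτJ).1
    obtain ⟨v, hv, hvv⟩ := hasDerivWithinAt_chart_velocity x₀ hUD hdi hsrc
    have hcoord : chartCoord x₀ (vel i) = (φ (p (γ i (τ i))), v) := by
      have : vel i = chartVector x₀ (φ (p (γ i (τ i)))) v := hvv
      rw [this, chartCoord_chartVector x₀ (φ.map_source hsrc)]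
    rw [hcoord] at hbi ⊢
    have hJI : ∀ u ∈ Icc a' b', u ∈ Icc (s - δ₁) (s + δ₁) := fun u hu ↦
      ⟨by linarith [hu.1], by linarith [hu.2]⟩
    have hηsrc : ∀ u ∈ Icc a' b', η u ∈ φ.source := fun u hu ↦ hsub (hJI u hu)
    have hball : Metric.closedBall (φ x₀) (r / 2) ⊆ Metric.closedBall (φ x₀) r :=
      Metric.closedBall_subset_closedBall (by linarith)
    have hacq : AbsolutelyContinuousOnInterval (fun u ↦ φ (p (γ i u))) a' b' :=
      absolutelyContinuousOnInterval_chart hp.isLocalDiffeomorph x₀ (hacJ le_rfl hab'.le le_rfl)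
        (fun u hu ↦ by rw [uIcc_of_le hab'.le] at hu; exact (hWJ u hu).1)
    obtain ⟨g, hg, hgle⟩ := hprop (fun u ↦ φ (p (γ i u))) a' b' hab' (by linarith) (by linarith)
      (by linarith) hacq (fun u hu ↦ (hWJ u hu).2)
      (fun u w h1 h2 h3 ↦ isMinimizerIn_chart hp.isLocalDiffeomorph x₀ H hH
        (fun y hy ↦ (hrt hy).1) (fun y hy ↦ (hrt hy).2) h2
        ((hmin i).restrict (haa'.trans h1) h2.le (h3.trans hbb')
          (hG.action_ne_top (hab i) (hmin i)))
        (fun y hy ↦ (hWJ y ⟨h1.trans hy.1, hy.2.trans h3⟩).1)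
        (fun y hy ↦ hball (hWJ y ⟨h1.trans hy.1, hy.2.trans h3⟩).2))
      (τ i) hτJ v (hv.mono hsubJ) hbi qη gη
      (fun u hu ↦ (hasDerivAt_chart_comp hη.1 x₀ (hηsrc u hu)).hasDerivWithinAt)
      (hgηc.mono hηsrc) (fun u hu ↦ hball (hδ₁ (hJI u hu)).1.2)
      (fun u hu ↦ (hR₁ u (hJI u hu)).trans (le_add_of_nonneg_right zero_le_one))
      (fun e u hu ↦ (hη.hasDerivAt_momentum hL.contMDiff x₀ (hηsrc u hu) e).hasDerivWithinAt)
    refine ⟨g (τ' i), (hWJ _ hτJ').1, ?_, hgle _ hτJ'⟩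
    exact (hasDerivWithinAt_congr_set (hset _ (abs_lt.2 hni'))).1 (hg _ hτJ')
  have key2 : ∀ᶠ i in l, MDifferentiableWithinAt 𝓘(ℝ, ℝ) (𝓡 n) (fun s ↦ p (γ i s))
        (Icc (a i) (b i)) (τ' i) ∧
      vel' i = chartVector x₀ (chartCoord x₀ (vel' i)).1 (chartCoord x₀ (vel' i)).2 ∧
      ‖(chartCoord x₀ (vel' i)).1 - qη (τ' i)‖ + ‖(chartCoord x₀ (vel' i)).2 - gη (τ' i)‖ ≤
        c * (‖(chartCoord x₀ (vel i)).1 - qη (τ i)‖ + ‖(chartCoord x₀ (vel i)).2 - gη (τ i)‖) := by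
    filter_upwards [key] with i ⟨u, hu1, hu2, hu3⟩
    obtain ⟨h1, h2⟩ := velocityWithin_eq_chartVector x₀ (uniqueDiffOn_Icc (hab i) _ (hτ' i))
      (hpc.comp_continuousOn (hcont i) _ (hτ' i)) hu1 hu2
    have h3 : chartCoord x₀ (vel' i) = (φ (p (γ i (τ' i))), u) := by
      have : vel' i = chartVector x₀ (φ (p (γ i (τ' i)))) u := h2
      rw [this, chartCoord_chartVector x₀ (φ.map_source hu1)]
    rw [h3]
    exact ⟨h1, h2, hu3⟩
  refine ⟨key2.mono fun i hi ↦ hi.1, ?_⟩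
  have hq' : Tendsto (fun i ↦ (chartCoord x₀ (vel' i)).1) l (𝓝 (qη t')) := by
    have h1 : Tendsto (fun i ↦ (chartCoord x₀ (vel' i)).1 - qη (τ' i)) l (𝓝 0) :=
      squeeze_zero_norm' (key2.mono fun i hi ↦ le_trans (le_add_of_nonneg_right (norm_nonneg _))
        hi.2.2) herr
    simpa using h1.add ((hqc hts').tendsto.comp hτt')
  have hg' : Tendsto (fun i ↦ (chartCoord x₀ (vel' i)).2) l (𝓝 (gη t')) := by
    have h1 : Tendsto (fun i ↦ (chartCoord x₀ (vel' i)).2 - gη (τ' i)) l (𝓝 0) :=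
      squeeze_zero_norm' (key2.mono fun i hi ↦ le_trans (le_add_of_nonneg_left (norm_nonneg _))
        hi.2.2) herr
    simpa using h1.add ((hgc hts').tendsto.comp hτt')
  have hcv : ContinuousAt (fun z : 𝔼 × 𝔼 ↦ chartVector x₀ z.1 z.2) (qη t', gη t') :=
    (continuousOn_chartVector x₀).continuousAt
      ((φ.open_target.prod isOpen_univ).mem_nhds ⟨φ.map_source hts', trivial⟩)
  have hlim := hcv.tendsto.comp (hq'.prodMk_nhds hg')
  rw [hvη']
  exact hlim.congr' (key2.mono fun i hi ↦ hi.2.1.symm)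

end Propagation

end Lagrangian


/-! ### Integer shifts and times of bounded speed -/

namespace Lagrangian

section Shift

variable {n : ℕ} {X : Type*} [MetricSpace X] [ChartedSpace (EuclideanSpace ℝ (Fin n)) X]
  {L : TangentBundle (𝓡 n) X → ℝ → ℝ} {γ : ℝ → X} {a b : ℝ}

theorem IsMinimizingSegment.comp_add_right {m : ℝ} (hL : ∀ z t, L z (t + m) = L z t)
    (hγ : IsMinimizingSegment L γ a b) :
    IsMinimizingSegment L (fun t ↦ γ (t + m)) (a - m) (b - m) := by
  refine ⟨AbsolutelyContinuousOnInterval.comp_add_right m (by simpa using hγ.1), fun β hβ ha hb ↦ ?_⟩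
  rw [action_comp_add_right hL, sub_add_cancel, sub_add_cancel]
  have hβ' : AbsolutelyContinuousOnInterval (fun t ↦ β (t + -m)) a b :=
    AbsolutelyContinuousOnInterval.comp_add_right (-m) (by simpa [sub_eq_add_neg] using hβ)
  have hL' : ∀ z t, L z (t + -m) = L z t := fun z t ↦ by
    rw [← hL z (t + -m), neg_add_cancel_right]
  have h := hγ.2 _ hβ' (by simpa [sub_eq_add_neg] using ha) (by simpa [sub_eq_add_neg] using hb)
  rwa [action_comp_add_right hL'] at h

theorem mdifferentiableWithinAt_of_shift (m : ℝ) {t : ℝ} (hab : a < b) (ht : t ∈ Icc a b)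
    (h : MDifferentiableWithinAt 𝓘(ℝ, ℝ) (𝓡 n) (fun s ↦ γ (s + m)) (Icc (a - m) (b - m)) (t - m)) :
    MDifferentiableWithinAt 𝓘(ℝ, ℝ) (𝓡 n) γ (Icc a b) t ∧
    velocityWithin (n := n) γ (Icc a b) t =
      velocityWithin (fun s ↦ γ (s + m)) (Icc (a - m) (b - m)) (t - m) := by
  have hs : HasMFDerivWithinAt 𝓘(ℝ, ℝ) 𝓘(ℝ, ℝ) (fun s : ℝ ↦ s - m) (Icc a b) t
      (ContinuousLinearMap.toSpanSingleton ℝ (1 : ℝ)) :=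
    hasMFDerivWithinAt_iff_hasFDerivWithinAt.2
      ((hasDerivAt_id t).sub_const m).hasFDerivAt.hasFDerivWithinAt
  have hmaps : Icc a b ⊆ (fun s : ℝ ↦ s - m) ⁻¹' Icc (a - m) (b - m) := fun s hs ↦
    ⟨sub_le_sub_right hs.1 m, sub_le_sub_right hs.2 m⟩
  have hc := h.hasMFDerivWithinAt.comp t hs hmaps
  have hfun : (fun s ↦ γ (s + m)) ∘ (fun s : ℝ ↦ s - m) = γ := by
    ext s; simp
  have hc2 : HasMFDerivWithinAt 𝓘(ℝ, ℝ) (𝓡 n) γ (Icc a b) t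
      ((mfderivWithin 𝓘(ℝ, ℝ) (𝓡 n) (fun s ↦ γ (s + m)) (Icc (a - m) (b - m)) (t - m) :
        ℝ →L[ℝ] EuclideanSpace ℝ (Fin n)).comp (ContinuousLinearMap.toSpanSingleton ℝ (1 : ℝ))) := by
    have h1 : γ =ᶠ[𝓝[Icc a b] t] (fun s ↦ γ (s + m)) ∘ (fun s : ℝ ↦ s - m) := by rw [hfun]
    exact hc.congr_of_eventuallyEq h1 (by simp)
  refine ⟨hc2.mdifferentiableWithinAt, ?_⟩
  rw [velocityWithin, hc2.mfderivWithin (uniqueDiffOn_Icc hab t ht).uniqueMDiffWithinAt]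
  refine Bundle.TotalSpace.ext (by simp [velocityWithin]) (heq_of_eq ?_)
  change (mfderivWithin 𝓘(ℝ, ℝ) (𝓡 n) (fun s ↦ γ (s + m)) (Icc (a - m) (b - m)) (t - m) :
        ℝ →L[ℝ] EuclideanSpace ℝ (Fin n)) ((ContinuousLinearMap.toSpanSingleton ℝ (1 : ℝ)) (1 : ℝ)) = _
  rw [ContinuousLinearMap.toSpanSingleton_apply, one_smul]
  rfl

end Shift

section Slow

variable {n : ℕ} {X : Type*} [MetricSpace X] [ChartedSpace (EuclideanSpace ℝ (Fin n)) X]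
  [IsManifold (𝓡 n) ∞ X]
  [Bundle.RiemannianBundle (fun x : X => TangentSpace (𝓡 n) x)]
  [IsContinuousRiemannianBundle (EuclideanSpace ℝ (Fin n)) (fun x : X => TangentSpace (𝓡 n) x)]
  [IsRiemannianManifold (𝓡 n) X]
  {L : TangentBundle (𝓡 n) X → ℝ → ℝ} {A : ℝ → ℝ} {C : ℝ}

/-- Otherwise `L ≥ B + 1` at almost every time of the unit interval, which contradicts the action
bound. -/
theorem HasGrowth.exists_slow_time (hL : HasGrowth L A C) {γ : ℝ → X} {c B : ℝ} (hB : 0 ≤ B)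
    (hγ : AbsolutelyContinuousOnInterval γ c (c + 1))
    (hact : action L γ c (c + 1) ≤ ENNReal.ofReal B) :
    ∃ t ∈ Ioo c (c + 1), MDifferentiableAt 𝓘(ℝ, ℝ) (𝓡 n) γ t ∧
      ‖velocity (n := n) γ t‖ ≤ √((B + 1) / C) := by
  by_contra! hcon
  have hle : ENNReal.ofReal (B + 1) ≤ action L γ c (c + 1) := by
    calc ENNReal.ofReal (B + 1) = ∫⁻ _ in Ioo c (c + 1), ENNReal.ofReal (B + 1) := by
          rw [setLIntegral_const, Real.volume_Ioo]; simp
      _ ≤ _ := by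
          rw [action_eq_Ioo]
          refine lintegral_mono_ae ((ae_restrict_iff' measurableSet_Ioo).2 ?_)
          filter_upwards [ae_mdifferentiableAt (n := n) (by linarith) hγ] with t h1 ht
          have h2 := hcon t ht (h1 ht)
          apply ENNReal.ofReal_le_ofReal
          refine le_trans ?_ (hL.lower _ t)
          have h3 : (B + 1) / C ≤ ‖velocity (n := n) γ t‖ ^ 2 :=
            (Real.sqrt_le_left (norm_nonneg _)).1 h2.le
          rwa [div_le_iff₀' hL.pos] at h3
  have := hle.trans hact
  rw [ENNReal.ofReal_le_ofReal_iff hB] at this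
  linarith

/-- Every time of a minimizer is close to a time of bounded velocity, which after an integer shift
lies in `[0, 1]`. -/
theorem HasGrowth.exists_shift (hL : HasGrowth L A C) {γ : ℝ → X} {a b S t' : ℝ} (hab : a + 1 ≤ b)
    (hγ : IsMinimizingSegment L γ a b) (hS : 0 ≤ S)
    (hact : ∀ c d, a ≤ c → c ≤ d → d ≤ b → action L γ c d ≤ ENNReal.ofReal (S * (d - c + 2)))
    (ht' : t' ∈ Icc a b) :
    ∃ m τ : ℝ, τ ∈ Icc (a - m) (b - m) ∧ τ ∈ Icc 0 1 ∧ |t' - m - τ| ≤ 1 ∧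
      IsMinimizingSegment L (fun t ↦ γ (t + m)) (a - m) (b - m) ∧
      (∀ c d, a - m ≤ c → c ≤ d → d ≤ b - m →
        action L (fun t ↦ γ (t + m)) c d ≤ ENNReal.ofReal (S * (d - c + 2))) ∧
      MDifferentiableWithinAt 𝓘(ℝ, ℝ) (𝓡 n) (fun t ↦ γ (t + m)) (Icc (a - m) (b - m)) τ ∧
      ‖(velocityWithin (n := n) (fun t ↦ γ (t + m)) (Icc (a - m) (b - m)) τ).2‖ ≤
        √((S * 3 + 1) / C) := by
  -- The unit interval `[c, c + 1]` lies in `[a, b]` and contains `t'`, also when `t'` is close to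
  -- `b`.
  set c := min t' (b - 1)
  have hac : a ≤ c := le_min ht'.1 (by linarith)
  have hcb : c + 1 ≤ b := by have := min_le_right t' (b - 1); linarith
  have hct : c ≤ t' := min_le_left _ _
  have htc : t' ≤ c + 1 := by
    rcases min_choice t' (b - 1) with h | h
    · have : c = t' := h
      linarith
    · have : c = b - 1 := h
      linarith [ht'.2]
  obtain ⟨t, ht, hd, hv⟩ := hL.exists_slow_time (c := c) (B := S * 3) (by positivity)
    (hγ.1.mono (by
      rw [uIcc_of_le (by linarith), uIcc_of_le (by linarith)]
      exact Icc_subset_Icc hac hcb))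
    ((hact c (c + 1) hac (by linarith) hcb).trans_eq (by congr 2; ring))
  set m : ℝ := (⌊t⌋ : ℝ)
  have hper : ∀ z s, L z (s + m) = L z s := fun z s ↦ by
    have h1 : Function.Periodic (L z) 1 := hL.periodic z
    have h2 := h1.int_mul ⌊t⌋ s
    rwa [mul_one] at h2
  have hfl := Int.floor_le t
  have hfl2 := Int.lt_floor_add_one t
  have hshift : a - m < b - m := by linarith
  have htI : t - m ∈ Icc (a - m) (b - m) := ⟨by linarith [ht.1], by linarith [ht.2]⟩
  have hd' : MDifferentiableAt 𝓘(ℝ, ℝ) (𝓡 n) (fun s ↦ γ (s + m)) (t - m) := by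
    have h1 : MDifferentiableAt 𝓘(ℝ, ℝ) 𝓘(ℝ, ℝ) (fun s : ℝ ↦ s + m) (t - m) :=
      mdifferentiableAt_iff_differentiableAt.2 (by fun_prop)
    have h2 : MDifferentiableAt 𝓘(ℝ, ℝ) (𝓡 n) γ (t - m + m) := by simpa using hd
    exact h2.comp (t - m) h1
  refine ⟨m, t - m, htI, ⟨by linarith, by linarith⟩, ?_, hγ.comp_add_right hper,
    fun c d h1 h2 h3 ↦ ?_, hd'.mdifferentiableWithinAt, ?_⟩
  · rw [abs_le]; constructor <;> linarith [ht.1, ht.2]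
  · rw [action_comp_add_right hper]
    refine (hact _ _ (by linarith) (by linarith) (by linarith)).trans_eq ?_
    congr 2; ring
  · rw [velocityWithin_Icc_eq hshift htI hd']
    have h : ∀ s, s = t → ‖velocity (n := n) γ s‖ ≤ √((S * 3 + 1) / C) := by
      rintro s rfl; exact hv
    simp only [velocity_comp_add_right]
    exact h _ (sub_add_cancel t m)

end Slow

/-! ### The uniform velocity bound, by compactness and completeness of the flow -/

section Bounded

variable {n : ℕ} {M X : Type*} [TopologicalSpace M] [T2Space M] [CompactSpace M]
  [ChartedSpace (EuclideanSpace ℝ (Fin n)) M]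
  [IsManifold (𝓡 n) ∞ M]
  [Bundle.RiemannianBundle (fun x : M => TangentSpace (𝓡 n) x)]
  [IsContinuousRiemannianBundle (EuclideanSpace ℝ (Fin n)) (fun x : M => TangentSpace (𝓡 n) x)]
  [MetricSpace X] [ChartedSpace (EuclideanSpace ℝ (Fin n)) X]
  [IsManifold (𝓡 n) ∞ X]
  [Bundle.RiemannianBundle (fun x : X => TangentSpace (𝓡 n) x)]
  [IsContinuousRiemannianBundle (EuclideanSpace ℝ (Fin n)) (fun x : X => TangentSpace (𝓡 n) x)]
  [IsRiemannianManifold (𝓡 n) X]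
  {p : X → M} {L : TangentBundle (𝓡 n) M → ℝ → ℝ}

local notation "𝔼" => EuclideanSpace ℝ (Fin n)

/-- Local propagation has a step size depending on the time. Interpolating linearly between the two
time sequences, connectedness of `[0, 1]` passes from local to global; local propagation is
symmetric in the two sequences, as this induction needs. -/
theorem velocityTendsto_of_tendsto (hp : IsRiemannianUniversalCover (n := n) p)
    (hL : StandingHypotheses L) {η : ℝ → M} (hη : IsEulerLagrangeSolution L η) {S : ℝ}
    (hS : 0 ≤ S) (l : Filter ℕ) (γ : ℕ → ℝ → X) (a b : ℕ → ℝ) (hab : ∀ i, a i < b i)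
    (hmin : ∀ i, IsMinimizingSegment (lift L p) (γ i) (a i) (b i))
    (hact : ∀ i c d, a i ≤ c → c ≤ d → d ≤ b i →
      action (lift L p) (γ i) c d ≤ ENNReal.ofReal (S * (d - c + 2)))
    {τ τ' : ℕ → ℝ} {t t' : ℝ} (hτ : ∀ i, τ i ∈ Icc (a i) (b i))
    (hτ' : ∀ i, τ' i ∈ Icc (a i) (b i)) (hτt : Tendsto τ l (𝓝 t)) (hτt' : Tendsto τ' l (𝓝 t'))
    (h : VelocityTendsto (n := n) p l γ a b η τ t) :
    VelocityTendsto (n := n) p l γ a b η τ' t' := by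
  set σ : ℝ → ℕ → ℝ := fun θ i ↦ τ i + θ * (τ' i - τ i)
  set T : ℝ → ℝ := fun θ ↦ t + θ * (t' - t)
  have hT : Continuous T := by fun_prop
  have hσ : ∀ θ ∈ Icc (0 : ℝ) 1, ∀ i, σ θ i ∈ Icc (a i) (b i) := fun θ hθ i ↦ by
    have := (convex_Icc (a i) (b i)).add_smul_sub_mem (hτ i) (hτ' i) hθ
    simpa [σ] using this
  have hσT : ∀ θ, Tendsto (σ θ) l (𝓝 (T θ)) := fun θ ↦
    hτt.add ((hτt'.sub hτt).const_mul θ)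
  have key := isPreconnected_Icc.induction₂' (s := Icc (0 : ℝ) 1)
    (fun θ θ' ↦ VelocityTendsto (n := n) p l γ a b η (σ θ) (T θ) →
      VelocityTendsto (n := n) p l γ a b η (σ θ') (T θ'))
    (fun θ hθ ↦ ?_) (fun _ _ _ _ _ _ h1 h2 h3 ↦ h2 (h1 h3))
    (left_mem_Icc.2 zero_le_one) (right_mem_Icc.2 zero_le_one)
  · have h0 : σ 0 = τ := by ext i; simp [σ]
    have h1 : σ 1 = τ' := by ext i; simp [σ]
    have h0' : T 0 = t := by simp [T]
    have h1' : T 1 = t' := by simp [T]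
    rw [h0, h1, h0', h1'] at key
    exact key h
  · obtain ⟨δ, hδ0, hδ⟩ := exists_velocityTendsto hp hL hη (T θ) S hS
    have hev : ∀ᶠ θ' in 𝓝[Icc 0 1] θ, |T θ' - T θ| < δ := by
      have h1 : Tendsto (fun θ' ↦ |T θ' - T θ|) (𝓝[Icc 0 1] θ) (𝓝 |T θ - T θ|) :=
        (((hT.tendsto θ).sub_const (T θ)).abs).mono_left nhdsWithin_le_nhds
      rw [sub_self, abs_zero] at h1
      exact h1.eventually_lt_const hδ0
    have hself : |T θ - T θ| < δ := by simpa using hδ0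
    filter_upwards [hev, self_mem_nhdsWithin] with θ' hθ' hmem
    exact ⟨hδ l γ a b hab hmin hact _ _ _ _ (hσ θ hθ) (hσ θ' hmem) (hσT θ) (hσT θ') hself hθ',
      hδ l γ a b hab hmin hact _ _ _ _ (hσ θ' hmem) (hσ θ hθ) (hσT θ') (hσT θ) hθ' hself⟩

/-- Argument by contradiction, through a limit of minimizers that violate larger and larger bounds.
Completeness enters here: the limiting solution exists at the limit of the bad times, and its
velocity there is finite. -/
theorem exists_velocity_bound (hp : IsRiemannianUniversalCover (n := n) p)
    (hL : StandingHypotheses L) (K : ℝ) :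
    ∃ K'' : ℝ, K < K'' ∧ ∀ (γ : ℝ → X) (a b : ℝ), IsIntegerMinimizer (lift L p) K γ a b →
      ∀ t ∈ Icc a b, MDifferentiableWithinAt 𝓘(ℝ, ℝ) (𝓡 n) γ (Icc a b) t ∧
        ‖segVelocity (n := n) γ a b t‖ ≤ K'' := by
  obtain ⟨A, C, hG⟩ := exists_hasGrowth hp hL
  obtain ⟨R, S, -, hS, hRS⟩ := hG.exists_action_le K
  by_contra! hcon
  -- The last clause treats both failures at `τ'` at once: either the curve is not differentiable
  -- there, or its speed exceeds `k`.
  have hseq : ∀ k : ℕ, ∃ (γ : ℝ → X) (a b τ τ' : ℝ), a < b ∧ IsMinimizingSegment (lift L p) γ a b ∧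
      (∀ c d, a ≤ c → c ≤ d → d ≤ b →
        action (lift L p) γ c d ≤ ENNReal.ofReal (S * (d - c + 2))) ∧
      τ ∈ Icc a b ∧ τ' ∈ Icc a b ∧ τ ∈ Icc 0 1 ∧ |τ' - τ| ≤ 1 ∧
      MDifferentiableWithinAt 𝓘(ℝ, ℝ) (𝓡 n) γ (Icc a b) τ ∧
      ‖(velocityWithin (n := n) γ (Icc a b) τ).2‖ ≤ √((S * 3 + 1) / C) ∧
      (MDifferentiableWithinAt 𝓘(ℝ, ℝ) (𝓡 n) γ (Icc a b) τ' →
        (k : ℝ) < ‖(velocityWithin (n := n) γ (Icc a b) τ').2‖) := by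
    intro k
    obtain ⟨γ, a, b, hmin, t', ht', hbad⟩ := hcon (max (K + 1) k)
      (lt_of_lt_of_le (lt_add_one K) (le_max_left _ _))
    have hact := (hRS γ a b hmin).2
    obtain ⟨hab, ⟨N, hN⟩, hγ, -⟩ := hmin
    have hab1 : a + 1 ≤ b := by
      have h0 : (0 : ℝ) < N := by linarith
      have h1 : 1 ≤ N := Nat.one_le_iff_ne_zero.2 (by rintro rfl; simp at h0)
      have : (1 : ℝ) ≤ N := by exact_mod_cast h1
      linarith
    obtain ⟨m, τ, hτ, hτ01, hττ', hminm, hactm, hdm, hvm⟩ := hG.exists_shift hab1 hγ hS hact ht'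
    refine ⟨_, a - m, b - m, τ, t' - m, by linarith, hminm, hactm, hτ,
      ⟨by linarith [ht'.1], by linarith [ht'.2]⟩, hτ01, hττ', hdm, hvm, fun hd ↦ ?_⟩
    obtain ⟨h1, h2⟩ := mdifferentiableWithinAt_of_shift m hab ht' hd
    rw [← h2]
    exact (le_max_right _ _).trans_lt (hbad h1)
  choose γ a b τ τ' hab hmin hact hτ hτ' hτ01 hττ' hd hv hbad using hseq
  have hpv : ∀ i t, t ∈ Icc (a i) (b i) →
      MDifferentiableWithinAt 𝓘(ℝ, ℝ) (𝓡 n) (γ i) (Icc (a i) (b i)) t →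
      MDifferentiableWithinAt 𝓘(ℝ, ℝ) (𝓡 n) (fun s ↦ p (γ i s)) (Icc (a i) (b i)) t ∧
      ‖(velocityWithin (n := n) (fun s ↦ p (γ i s)) (Icc (a i) (b i)) t).2‖ =
        ‖(velocityWithin (n := n) (γ i) (Icc (a i) (b i)) t).2‖ := fun i t ht h ↦ by
    obtain ⟨h1, h2⟩ := velocityWithin_comp hp.isLocalDiffeomorph (uniqueDiffOn_Icc (hab i) t ht) h
    refine ⟨h1, ?_⟩
    rw [h2]
    exact hp.norm_mfderiv _ _
  obtain ⟨k, hk, hkV⟩ := exists_isCompact_norm_le (n := n) (M := M) √((S * 3 + 1) / C)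
  -- A nonprincipal ultrafilter takes the limits of both times and of the projected velocity without
  -- extracting subsequences. The limit is taken in `TM`, since the cover need not be compact.
  obtain ⟨t, -, ht⟩ := (isCompact_Icc (a := (0 : ℝ)) (b := 1)).ultrafilter_le_nhds
    ((hyperfilter ℕ).map τ) (tendsto_principal.2 (Eventually.of_forall hτ01))
  obtain ⟨t', -, ht'⟩ := (isCompact_Icc (a := (-1 : ℝ)) (b := 2)).ultrafilter_le_nhds
    ((hyperfilter ℕ).map τ') (tendsto_principal.2 (Eventually.of_forall fun i ↦ by
      have h1 := abs_le.1 (hττ' i)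
      have h2 := hτ01 i
      exact ⟨by linarith [h1.1, h2.1], by linarith [h1.2, h2.2]⟩))
  obtain ⟨z, -, hz⟩ := hk.ultrafilter_le_nhds
    ((hyperfilter ℕ).map fun i ↦
      velocityWithin (n := n) (fun s ↦ p (γ i s)) (Icc (a i) (b i)) (τ i))
    (tendsto_principal.2 (Eventually.of_forall fun i ↦ hkV (by
      change ‖(velocityWithin (n := n) (fun s ↦ p (γ i s)) (Icc (a i) (b i)) (τ i)).2‖ ≤ _
      rw [(hpv i _ (hτ i) (hd i)).2]; exact hv i)))
  obtain ⟨η, hη, hηz⟩ := hL.complete t z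
  have hstart : VelocityTendsto (n := n) p (hyperfilter ℕ) γ a b η τ t :=
    ⟨Eventually.of_forall fun i ↦ (hpv i _ (hτ i) (hd i)).1, by rw [hηz]; exact hz⟩
  obtain ⟨hd', hv'⟩ := velocityTendsto_of_tendsto hp hL hη hS (hyperfilter ℕ) γ a b hab hmin hact
    hτ hτ' ht ht' hstart
  have hnorm := (continuous_norm_snd.tendsto _).comp hv'
  have hlarge : ∀ᶠ i : ℕ in hyperfilter ℕ, ‖velocity (n := n) η t'‖ + 1 < i := by
    have h1 : ∀ᶠ i : ℕ in atTop, ‖velocity (n := n) η t'‖ + 1 < i :=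
      tendsto_natCast_atTop_atTop.eventually_gt_atTop _
    rw [← Nat.cofinite_eq_atTop] at h1
    exact h1.filter_mono hyperfilter_le_cofinite
  obtain ⟨i, h1, h2, h3⟩ := (hd'.and ((hnorm.eventually_lt_const (lt_add_one _)).and hlarge)).exists
  have hcont : ContinuousOn (γ i) (Icc (a i) (b i)) := by
    have := (hmin i).1.continuousOn_metric; rwa [uIcc_of_le (hab i).le] at this
  have h4 := mdifferentiableWithinAt_of_comp hp.isLocalDiffeomorph (hcont _ (hτ' i)) h1
  have h5 := hbad i h4
  rw [← (hpv i _ (hτ' i) h4).2] at h5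
  exact absurd (h5.trans (h2.trans h3)) (lt_irrefl _)

end Bounded

end Lagrangian


/-! ### Conclusion -/

namespace Lagrangian

theorem isContinuousRiemannianBundle_of_smooth {n : ℕ} {M : Type*} [TopologicalSpace M]
    [ChartedSpace (EuclideanSpace ℝ (Fin n)) M] [IsManifold (𝓡 n) ∞ M]
    [Bundle.RiemannianBundle (fun x : M => TangentSpace (𝓡 n) x)]
    [h : IsContMDiffRiemannianBundle (𝓡 n) ∞ (EuclideanSpace ℝ (Fin n))
      (fun x : M => TangentSpace (𝓡 n) x)] :
    IsContinuousRiemannianBundle (EuclideanSpace ℝ (Fin n))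
      (fun x : M => TangentSpace (𝓡 n) x) := by
  obtain ⟨g, hg, hgi⟩ := h.exists_contMDiff
  exact ⟨⟨g, hg.continuous, hgi⟩⟩

end Lagrangian

theorem proposition2p1 {n : ℕ}
    -- a closed connected manifold with a smooth Riemannian metric
    {M : Type*} [TopologicalSpace M] [T2Space M] [CompactSpace M] [ConnectedSpace M]
    [ChartedSpace (EuclideanSpace ℝ (Fin n)) M] [IsManifold (𝓡 n) ∞ M]
    [Bundle.RiemannianBundle (fun x : M => TangentSpace (𝓡 n) x)]
    [IsContMDiffRiemannianBundle (𝓡 n) ∞ (EuclideanSpace ℝ (Fin n))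
      (fun x : M => TangentSpace (𝓡 n) x)]
    -- its universal cover with the lifted metric and the Riemannian distance
    {X : Type*} [MetricSpace X]
    [ChartedSpace (EuclideanSpace ℝ (Fin n)) X] [IsManifold (𝓡 n) ∞ X]
    [Bundle.RiemannianBundle (fun x : X => TangentSpace (𝓡 n) x)]
    [IsContMDiffRiemannianBundle (𝓡 n) ∞ (EuclideanSpace ℝ (Fin n))
      (fun x : X => TangentSpace (𝓡 n) x)]
    [IsRiemannianManifold (𝓡 n) X]
    (p : X → M) (hp : Lagrangian.IsRiemannianUniversalCover (n := n) p)
    (L : TangentBundle (𝓡 n) M → ℝ → ℝ) (hL : Lagrangian.StandingHypotheses L) :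
    (∀ K : ℝ, ∃ K'' : ℝ, K < K'' ∧
      ∀ (γ : ℝ → X) (a b : ℝ),
        Lagrangian.IsIntegerMinimizer (Lagrangian.lift L p) K γ a b →
        ∀ t ∈ Set.Icc a b,
          MDifferentiableWithinAt 𝓘(ℝ, ℝ) (𝓡 n) γ (Set.Icc a b) t ∧
          ‖Lagrangian.segVelocity (n := n) γ a b t‖ ≤ K'') ∧
    (∃ K₀ : ℝ, 0 < K₀ ∧ ∀ K : ℝ, K₀ < K →
      (∃ (k'' : ℝ) (N₀ : ℕ), 0 < k'' ∧ 0 < N₀ ∧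
        ∀ (γ : ℝ → X) (a b : ℝ),
          Lagrangian.IsIntegerMinimizer (Lagrangian.lift L p) K γ a b →
          ∀ c d : ℝ, a ≤ c → d ≤ b → (N₀ : ℝ) ≤ d - c →
            k'' ≤ Lagrangian.avgDisplacement γ c d) ∧
      (∃ lam ε : ℝ, 1 < lam ∧ 0 < ε ∧
        ∀ (γ : ℝ → X) (a b : ℝ),
          Lagrangian.IsIntegerMinimizer (Lagrangian.lift L p) K γ a b →
          Lagrangian.IsQuasiGeodesicSegment lam ε γ a b)) := by

  have hM : IsContinuousRiemannianBundle (EuclideanSpace ℝ (Fin n))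
      (fun x : M => TangentSpace (𝓡 n) x) := Lagrangian.isContinuousRiemannianBundle_of_smooth
  have hX : IsContinuousRiemannianBundle (EuclideanSpace ℝ (Fin n))
      (fun x : X => TangentSpace (𝓡 n) x) := Lagrangian.isContinuousRiemannianBundle_of_smooth
  refine ⟨fun K ↦ Lagrangian.exists_velocity_bound hp hL K, ?_⟩
  obtain ⟨A, C, hG⟩ := Lagrangian.exists_hasGrowth hp hL
  obtain ⟨K₀, hK₀, hK⟩ := hG.exists_avgDisplacement_ge
  refine ⟨K₀, hK₀, fun K hKK ↦ ?_⟩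
  obtain ⟨N₀, hN₀, h⟩ := hK K hKK
  exact ⟨⟨1, N₀, one_pos, hN₀, h⟩, hG.exists_isQuasiGeodesicSegment h⟩
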